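/- Let $d\ge 1$, let $A_\star,\Sigma_w\in\mathbb R^{d\times d}$ with $\Sigma_w$ positive semidefinite and spectral radius $\rho(A_\star)<1$, and let $\gamma\in(\rho(A_\star),1)$. Write $\|\cdot\|$ for the $\ell_2$ operator norm, $\|\cdot\|_F$ for the Frobenius norm, and $\tau=\tau(A_\star,\gamma):=\sup_{k\ge 0}\|A_\star^k\|\gamma^{-k}$. Let $\Sigma_\infty$ be the unique positive semidefinite solution of $\Sigma_\infty=A_\star\Sigma_\infty A_\star^\top+\Sigma_w$, and assume $\lambda_{\min}(\Sigma_\infty)>0$. Consider $$\beta_{t+1}=A_\star\beta_t+w_t,\qquad y_t=x_t^\top\beta_t+\epsilon_t\qquad(t\ge 0),$$ where $\beta_0\sim\mathcal N(0,\Sigma_\infty)$, $x_t\sim\mathcal N(0,I_d)$, $w_t\sim\mathcal N(0,\Sigma_w)$, $\epsilon_t\sim\mathcal N(0,\sigma_\epsilon^2)$ ($t\ge 0$, $\sigma_\epsilon\ge 0$) are all mutually independent. The covariance method, given $\sigma_\epsilon^2$, computes $$\widehat\Sigma_\infty\in\operatorname*{argmin}_{M=M^\top}\sum_{t=0}^{T-1}\bigl(y_t^2-x_t^\top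 Mx_t-\sigma_\epsilon^2\bigr)^2,\qquad \widehat M\in\operatorname*{argmin}_{M\in\mathbb R^{d\times d}}\sum_{t=0}^{T-1}\bigl(y_ty_{t+1}-x_{t+1}^\top Mx_t\bigr)^2,\qquad \widehat A=\widehat M\,\widehat\Sigma_\infty^{-1}.$$ There is a universal constant $c>0$ (the same for all dimensions, models and parameters) such that for every $\delta\in(0,1)$ and every $T\in\mathbb N$ with $T\ge c\,d^4\log\bigl(c\,d^2/\delta\bigr)$ and $$T\ \ge\ \frac{c\,d^2}{\lambda_{\min}(\Sigma_\infty)^2\,\delta}\Bigl[\sigma_\epsilon^4+\frac{\tau^3}{1-\gamma^2}\|\Sigma_\infty\|^2\Bigl(d^2+4\log^2\frac{2T}{\delta}\Bigr)\Bigr],$$ the following holds with probability at least $1-\delta$: the minimizers exist and, for every choice of them, $\widehat\Sigma_\infty$ is invertible and $$\|\widehat A-A_\star\|_F\ \le\ c\,\frac{1+\|A_\star\|}{\lambda_{\min}(\Sigma_\infty)}\sqrt{\frac{c\,d^2}{T\delta}\Bigl[\sigma_\epsilon^4+\frac{\tau^3}{1-\gamma^2}\|\Sigma_\infty\|^2\Bigl(d^2+4\log^2\frac{2T}{\delta}\Bigr)\Bigr]}.$$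 -/

import Mathlib

open MeasureTheory ProbabilityTheory

universe u

noncomputable section

/-- The operator norm of a square matrix with respect to the Euclidean (`ℓ²`) norm. -/
def opNorm {d : ℕ} (A : Matrix (Fin d) (Fin d) ℝ) : ℝ :=
  ‖Matrix.toEuclideanCLM (n := Fin d) (𝕜 := ℝ) A‖

/-- The Frobenius norm. -/
def frobNorm {d : ℕ} (A : Matrix (Fin d) (Fin d) ℝ) : ℝ :=
  √(∑ i, ∑ j, A i j ^ 2)

/-- The smallest eigenvalue of a symmetric matrix of positive size (for such a matrix the real
spectrum is a nonempty finite set, so the infimum is a minimum). -/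
def lamMin {d : ℕ} (S : Matrix (Fin d) (Fin d) ℝ) : ℝ :=
  sInf (spectrum ℝ S)

/-- The spectral radius `ρ(A)` of a real matrix: the largest modulus of a complex eigenvalue. -/
def specRad {d : ℕ} (A : Matrix (Fin d) (Fin d) ℝ) : ENNReal :=
  spectralRadius ℂ (A.map (algebraMap ℝ ℂ))

/-- `τ(A, γ) = sup { ‖A ^ k‖ γ ^ (-k) : k ≥ 0 }`; it is only used for `ρ(A) < γ`, where the
supremum is finite. -/
def tauConst {d : ℕ} (A : Matrix (Fin d) (Fin d) ℝ) (γ : ℝ) : ℝ :=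
  ⨆ k : ℕ, opNorm (A ^ k) * (γ ^ k)⁻¹

/-- The bilinear form `uᵀ M v`. -/
def bilin {d : ℕ} (M : Matrix (Fin d) (Fin d) ℝ) (u v : EuclideanSpace ℝ (Fin d)) : ℝ :=
  inner ℝ u (Matrix.toEuclideanCLM (n := Fin d) (𝕜 := ℝ) M v)

/-- `S` is a positive semidefinite solution of the Lyapunov equation `S = A S Aᵀ + W`
(when `ρ(A) < 1` there is exactly one: the stationary covariance). -/
structure IsStationaryCov {d : ℕ} (A W S : Matrix (Fin d) (Fin d) ℝ) : Prop where
  posSemidef : S.PosSemidef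
  lyapunov : S = A * S * A.transpose + W

/-- The time-varying regression model `β (t+1) = A (β t) + w t`, `y t = (x t)ᵀ (β t) + ε t`, with
standard Gaussian covariates `x`, process noise `w` with covariance `W`, observation noise `ε`
with standard deviation `σ`, initial state `β 0` of covariance `S`, all centred Gaussian and
mutually independent. -/
structure IsRegressionModel {d : ℕ} {Ω : Type*} [MeasurableSpace Ω] (P : Measure Ω)
    (A W S : Matrix (Fin d) (Fin d) ℝ) (σ : NNReal)
    (x w β : ℕ → Ω → EuclideanSpace ℝ (Fin d)) (ε y : ℕ → Ω → ℝ) : Prop where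
  measurable_x : ∀ t, Measurable (x t)
  measurable_w : ∀ t, Measurable (w t)
  measurable_ε : ∀ t, Measurable (ε t)
  measurable_init : Measurable (β 0)
  law_x : ∀ t, HasLaw (x t) (multivariateGaussian 0 1) P
  law_w : ∀ t, HasLaw (w t) (multivariateGaussian 0 W) P
  law_ε : ∀ t, HasLaw (ε t) (gaussianReal 0 (σ ^ 2)) P
  law_init : HasLaw (β 0) (multivariateGaussian 0 S) P
  /-- the random variables `β 0`, `x 0, x 1, …`, `w 0, w 1, …`, `ε 0, ε 1, …` are mutually
  independent -/
  indep : iIndep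
    (Sum.elim (fun _ : Unit => MeasurableSpace.comap (β 0) inferInstance)
      (Sum.elim (fun t : ℕ => MeasurableSpace.comap (x t) inferInstance)
        (Sum.elim (fun t : ℕ => MeasurableSpace.comap (w t) inferInstance)
          (fun t : ℕ => MeasurableSpace.comap (ε t) inferInstance)))) P
  dynamics : ∀ t ω,
    β (t + 1) ω = Matrix.toEuclideanCLM (n := Fin d) (𝕜 := ℝ) A (β t ω) + w t ω
  observation : ∀ t ω, y t ω = inner ℝ (x t ω) (β t ω) + ε t ω

/-- `S` is a least squares estimate of the stationary covariance: among the symmetric matrices, it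
minimizes `∑_{t < T} (y_t² - x_tᵀ S x_t - σ²)²`. -/
def IsCovOLS {d : ℕ} (T : ℕ) (σ : ℝ) (x : ℕ → EuclideanSpace ℝ (Fin d)) (y : ℕ → ℝ)
    (S : Matrix (Fin d) (Fin d) ℝ) : Prop :=
  S.IsSymm ∧ ∀ S' : Matrix (Fin d) (Fin d) ℝ, S'.IsSymm →
    ∑ t ∈ Finset.range T, (y t ^ 2 - bilin S (x t) (x t) - σ ^ 2) ^ 2 ≤
      ∑ t ∈ Finset.range T, (y t ^ 2 - bilin S' (x t) (x t) - σ ^ 2) ^ 2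

/-- `M` is a least squares estimate of the lag-one covariance: among all matrices, it minimizes
`∑_{t < T} (y_t y_{t+1} - x_{t+1}ᵀ M x_t)²`. -/
def IsLagOLS {d : ℕ} (T : ℕ) (x : ℕ → EuclideanSpace ℝ (Fin d)) (y : ℕ → ℝ)
    (M : Matrix (Fin d) (Fin d) ℝ) : Prop :=
  ∀ M' : Matrix (Fin d) (Fin d) ℝ,
    ∑ t ∈ Finset.range T, (y t * y (t + 1) - bilin M (x (t + 1)) (x t)) ^ 2 ≤
      ∑ t ∈ Finset.range T, (y t * y (t + 1) - bilin M' (x (t + 1)) (x t)) ^ 2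

/-- The variance term
`σ⁴ + τ(A, γ)³ / (1 - γ²) ‖S‖² (d² + 4 log(2T/δ)²)`. -/
def varTerm {d : ℕ} (A S : Matrix (Fin d) (Fin d) ℝ) (σ γ δ : ℝ) (T : ℕ) : ℝ :=
  σ ^ 4 + tauConst A γ ^ 3 / (1 - γ ^ 2) * opNorm S ^ 2 *
    ((d : ℝ) ^ 2 + 4 * Real.log (2 * T / δ) ^ 2)

end

-- Both estimators are linear least squares with features `x (t+h) i * x t j`, where `h = 0` gives
-- the covariance and `h = 1` the lag-one covariance; the target is `A ^ h * S`. Let `D` be the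
-- estimation error and call residual times feature, taken at the true parameter, the score.
-- Optimality gives `∑ ⟨D, φ_t⟩² ≤ 2 ⟨D, total score⟩`. The expected Gram matrix is `T` times
-- `featureKernel`, which dominates the identity on all matrices for `h = 1` and on symmetric ones
-- for `h = 0`. If the empirical Gram matrix is within `T / 2` of it in Frobenius norm, then `‖D‖² ≤
-- 16 ‖total score‖² / T²` (`sum_sq_error_le`). It remains to control two second moments and to
-- apply Markov's inequality.
--
-- The Gram deviation is a sum of centred terms, independent once their times differ by more than
-- `h`, so its second moment is `O(T d⁴)`. The scores are correlated through the state, and this is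
-- where stability enters. Averaging over the covariates and observation noise replaces a score by
-- its drift, the kernel applied to the deviation of `β (t+h) βᵀ t` from its mean
-- (`integral_mul_score`). Correlating a deviation with the past and moving it `k` steps ahead
-- multiplies it by `A ^ (h+k)` on the left and `(A ^ k)ᵀ` on the right (`devCorr_eq`): new
-- innovations are independent of the past, and the Lyapunov equation cancels their covariance.
-- Hence score correlations decay like `τ² γ^(2k)`, and their sum contributes `τ² / (1 - γ²)` to the
-- second moment (`sum_integral_sum_score_sq_le`).
--
-- Four applications of Markov's inequality, two for each lag, each cost probability `δ / 4`. On the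
-- remaining event both Frobenius errors are at most some `r ≤ lamMin S / 2`, so the covariance
-- estimate is invertible, with inverse of norm at most `2 / lamMin S`. The perturbation bound
-- `frobNorm_mul_inv_sub_le` then handles the quotient.

open scoped NNReal ENNReal

set_option linter.unusedSectionVars false

-- Random variables with moments of all orders.

/-- A real random variable which is measurable with respect to `m` and has moments of all orders. -/
structure HasMoments {Ω : Type*} {mΩ : MeasurableSpace Ω} (P : Measure Ω) (m : MeasurableSpace Ω)
    (X : Ω → ℝ) : Prop where
  measurable : Measurable[m] X
  memLp : ∀ p : ℝ≥0, MemLp X p P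

namespace HasMoments

variable {Ω : Type*} {mΩ : MeasurableSpace Ω} {P : Measure Ω} {m m' : MeasurableSpace Ω}
  {X Y : Ω → ℝ}

theorem mono (hX : HasMoments P m X) (h : m ≤ m') : HasMoments P m' X :=
  ⟨hX.measurable.mono h le_rfl, hX.memLp⟩

theorem integrable (hX : HasMoments P m X) : Integrable X P :=
  memLp_one_iff_integrable.1 (by simpa using hX.memLp 1)

theorem const [IsFiniteMeasure P] (c : ℝ) : HasMoments P m (fun _ => c) :=
  ⟨measurable_const, fun _ => memLp_const c⟩

theorem add (hX : HasMoments P m X) (hY : HasMoments P m Y) :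
    HasMoments P m (fun ω => X ω + Y ω) :=
  ⟨hX.measurable.add hY.measurable, fun p => (hX.memLp p).add (hY.memLp p)⟩

theorem sub (hX : HasMoments P m X) (hY : HasMoments P m Y) :
    HasMoments P m (fun ω => X ω - Y ω) :=
  ⟨hX.measurable.sub hY.measurable, fun p => (hX.memLp p).sub (hY.memLp p)⟩

theorem mul (hX : HasMoments P m X) (hY : HasMoments P m Y) :
    HasMoments P m (fun ω => X ω * Y ω) := by
  refine ⟨hX.measurable.mul hY.measurable, fun p => ?_⟩
  -- Hölder with exponents `2p, 2p`. Asking for every moment at once is what makes the class closed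
  -- under products.
  have h : ENNReal.HolderTriple ((2 * p : ℝ≥0) : ℝ≥0∞) ((2 * p : ℝ≥0) : ℝ≥0∞) (p : ℝ≥0∞) := by
    refine ⟨?_⟩
    rcases eq_or_ne p 0 with rfl | hp
    · simp
    · push_cast
      rw [ENNReal.mul_inv (by simp) (by simp), ← add_mul, ENNReal.inv_two_add_inv_two, one_mul]
  exact MemLp.mul' (hY.memLp (2 * p)) (hX.memLp (2 * p))

theorem const_mul [IsFiniteMeasure P] (c : ℝ) (hX : HasMoments P m X) :
    HasMoments P m (fun ω => c * X ω) :=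
  (HasMoments.const c).mul hX

theorem pow [IsFiniteMeasure P] (hX : HasMoments P m X) (n : ℕ) :
    HasMoments P m (fun ω => X ω ^ n) := by
  induction n with
  | zero => simpa using HasMoments.const 1
  | succ n ih => simpa only [pow_succ] using ih.mul hX

theorem sum [IsFiniteMeasure P] {κ : Type*} (s : Finset κ) {F : κ → Ω → ℝ}
    (h : ∀ k ∈ s, HasMoments P m (F k)) : HasMoments P m (fun ω => ∑ k ∈ s, F k ω) := by
  classical
  induction s using Finset.induction_on with
  | empty => simpa using HasMoments.const 0
  | insert a s ha ih =>
    simp only [Finset.sum_insert ha]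
    exact (h a (Finset.mem_insert_self a s)).add
      (ih fun k hk => h k (Finset.mem_insert_of_mem hk))

/-- The σ-algebra carried by `HasMoments` serves this purpose: expectations factor as soon as the
two carried σ-algebras are independent. -/
theorem integral_mul_of_indep (hX : HasMoments P m X) (hY : HasMoments P m' Y)
    (h : Indep m m' P) : ∫ ω, X ω * Y ω ∂P = (∫ ω, X ω ∂P) * ∫ ω, Y ω ∂P := by
  have hXY : IndepFun X Y P := by
    rw [IndepFun_iff_Indep]
    exact indep_of_indep_of_le_left (indep_of_indep_of_le_right h hY.measurable.comap_le)
      hX.measurable.comap_le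
  exact hXY.integral_fun_mul_eq_mul_integral (hX.memLp 1).1 (hY.memLp 1).1

end HasMoments

-- Second moments of sums of weakly correlated variables, and Markov's inequality.

/-- The `σ`-algebra generated by the members of a family with index in `I`. -/
abbrev iSupOn {Ω ι : Type*} (m : ι → MeasurableSpace Ω) (I : Set ι) : MeasurableSpace Ω :=
  ⨆ i ∈ I, m i

theorem iSupOn_mono {Ω ι : Type*} (m : ι → MeasurableSpace Ω) {I J : Set ι} (h : I ⊆ J) :
    iSupOn m I ≤ iSupOn m J :=
  biSup_mono h

/-- If the correlations of a family of random vectors are bounded in terms of the time lag, then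
the second moment of the sum is bounded by the length times the sum of the bounds. -/
theorem sum_integral_sum_sq_le {Ω κ : Type*} [Fintype κ] {mΩ : MeasurableSpace Ω} {P : Measure Ω}
    [IsFiniteMeasure P] (Z : ℕ → κ → Ω → ℝ) (hZ : ∀ t a, HasMoments P mΩ (Z t a)) (c : ℕ → ℝ)
    (C : ℝ) (T : ℕ) (hc : ∀ k, 0 ≤ c k) (hC : ∑ k ∈ Finset.range T, c k ≤ C)
    (h : ∀ t k, ∑ a, ∫ ω, Z t a ω * Z (t + k) a ω ∂P ≤ c k) :
    ∑ a, ∫ ω, (∑ t ∈ Finset.range T, Z t a ω) ^ 2 ∂P ≤ 2 * T * C := by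
  have hsymm : ∀ t s, t ≤ s → ∑ a, ∫ ω, Z t a ω * Z s a ω ∂P ≤ c (s - t) := by
    intro t s hts
    obtain ⟨k, rfl⟩ := Nat.exists_eq_add_of_le hts
    simpa using h t k
  have hexp : ∑ a, ∫ ω, (∑ t ∈ Finset.range T, Z t a ω) ^ 2 ∂P =
      ∑ t ∈ Finset.range T, ∑ s ∈ Finset.range T, ∑ a, ∫ ω, Z t a ω * Z s a ω ∂P := by
    have : ∀ a, ∫ ω, (∑ t ∈ Finset.range T, Z t a ω) ^ 2 ∂P =
        ∑ t ∈ Finset.range T, ∑ s ∈ Finset.range T, ∫ ω, Z t a ω * Z s a ω ∂P := by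
      intro a
      simp_rw [sq, Finset.sum_mul_sum]
      rw [integral_finsetSum]
      · refine Finset.sum_congr rfl fun t _ => integral_finsetSum _ fun s _ => ?_
        exact ((hZ t a).mul (hZ s a)).integrable
      · exact fun t _ => (HasMoments.sum _ fun s _ => (hZ t a).mul (hZ s a)).integrable
    simp_rw [this]
    rw [Finset.sum_comm]
    exact Finset.sum_congr rfl fun t _ => Finset.sum_comm
  rw [hexp]
  have hrow : ∀ t ∈ Finset.range T,
      ∑ s ∈ Finset.range T, ∑ a, ∫ ω, Z t a ω * Z s a ω ∂P ≤ 2 * C := by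
    intro t ht
    -- Later and earlier times `s` each contribute at most `C`. The diagonal `s = t` is counted in
    -- both halves, which only enlarges the bound.
    have h1 : ∀ s ∈ Finset.range T, ∑ a, ∫ ω, Z t a ω * Z s a ω ∂P ≤
        (if t ≤ s then c (s - t) else 0) + (if s ≤ t then c (t - s) else 0) := by
      intro s _
      have e1 : t ≤ s → ∑ a, ∫ ω, Z t a ω * Z s a ω ∂P ≤ c (s - t) := hsymm t s
      have e2 : s ≤ t → ∑ a, ∫ ω, Z t a ω * Z s a ω ∂P ≤ c (t - s) := by
        intro hst
        simpa only [mul_comm] using hsymm s t hst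
      rcases le_total t s with hts | hts
      · rw [if_pos hts]
        have := e1 hts
        split_ifs <;> linarith [hc (t - s)]
      · rw [if_pos hts]
        have := e2 hts
        split_ifs <;> linarith [hc (s - t)]
    refine (Finset.sum_le_sum h1).trans ?_
    rw [Finset.sum_add_distrib, two_mul]
    -- Each half of the row is reindexed by the lag, which is injective there, and so is a partial
    -- sum of `c`.
    have inj : ∀ (f : ℕ → ℕ) (p : ℕ → Prop) [DecidablePred p],
        (∀ s ∈ Finset.range T, p s → f s ∈ Finset.range T) →
        (∀ s s', p s → p s' → f s = f s' → s = s') →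
        ∑ s ∈ Finset.range T, (if p s then c (f s) else 0) ≤ C := by
      intro f p _ hf hinj
      rw [← Finset.sum_filter]
      refine le_trans ?_ hC
      rw [← Finset.sum_image (f := c) (g := f)]
      · refine Finset.sum_le_sum_of_subset_of_nonneg ?_ fun _ _ _ => hc _
        intro k hk
        obtain ⟨s, hs, rfl⟩ := Finset.mem_image.1 hk
        rw [Finset.mem_filter] at hs
        exact hf s hs.1 hs.2
      · intro s hs s' hs' e
        exact hinj s s' (Finset.mem_filter.1 hs).2 (Finset.mem_filter.1 hs').2 e
    simp only [Finset.mem_range] at ht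
    refine add_le_add (inj (fun s => s - t) (fun s => t ≤ s) ?_ ?_)
      (inj (fun s => t - s) (fun s => s ≤ t) ?_ ?_)
    all_goals (try simp only [Finset.mem_range]); intros; omega
  refine (Finset.sum_le_sum hrow).trans ?_
  simp only [Finset.sum_const, Finset.card_range, nsmul_eq_mul]
  linarith

/-- Markov's inequality for a sum of squares. -/
theorem measure_sum_sq_gt_le {Ω κ : Type*} [Fintype κ] {mΩ : MeasurableSpace Ω} {P : Measure Ω}
    [IsFiniteMeasure P] (Z : κ → Ω → ℝ) (hZ : ∀ a, HasMoments P mΩ (Z a)) {R p : ℝ} (hR : 0 < R)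
    (h : ∑ a, ∫ ω, Z a ω ^ 2 ∂P ≤ R * p) :
    P {ω | R < ∑ a, Z a ω ^ 2} ≤ ENNReal.ofReal p := by
  have hm : HasMoments P mΩ (fun ω => ∑ a, Z a ω ^ 2) :=
    HasMoments.sum _ fun a _ => (hZ a).pow 2
  have h1 := mul_meas_ge_le_integral_of_nonneg (μ := P) (f := fun ω => ∑ a, Z a ω ^ 2)
    (Filter.Eventually.of_forall fun ω => Finset.sum_nonneg fun a _ => sq_nonneg _)
    hm.integrable R
  rw [integral_finsetSum _ fun a _ => ((hZ a).pow 2).integrable] at h1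
  have h2 : P.real {ω | R ≤ ∑ a, Z a ω ^ 2} ≤ p := by
    have := h1.trans h
    exact le_of_mul_le_mul_left this hR
  have h3 : {ω | R < ∑ a, Z a ω ^ 2} ⊆ {ω | R ≤ ∑ a, Z a ω ^ 2} :=
    Set.ofPred_subset_ofPred.2 fun ω hω => le_of_lt hω
  refine (measure_mono h3).trans ?_
  rw [← ENNReal.ofReal_toReal (measure_ne_top P {ω | R ≤ ∑ a, Z a ω ^ 2})]
  exact ENNReal.ofReal_le_ofReal h2

-- Moments of Gaussian variables and vectors.

theorem integrable_pow_gaussianReal (v : ℝ≥0) (n : ℕ) :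
    Integrable (fun x : ℝ => x ^ n) (gaussianReal 0 v) := by
  have h : HasMoments (gaussianReal 0 v) inferInstance (fun x : ℝ => x) :=
    ⟨measurable_id, fun p => memLp_id_gaussianReal p⟩
  exact (h.pow n).integrable

theorem integral_sq_gaussianReal (v : ℝ≥0) : ∫ x : ℝ, x ^ 2 ∂gaussianReal 0 v = v := by
  have h := variance_fun_id_gaussianReal (μ := 0) (v := v)
  rwa [variance_of_integral_eq_zero measurable_id'.aemeasurable
    integral_id_gaussianReal] at h

theorem gaussianReal_eq_map_sqrt (v : ℝ≥0) :
    gaussianReal 0 v = (gaussianReal 0 1).map (fun x => √(v : ℝ) * x) := by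
  rw [gaussianReal_map_const_mul]
  congr 1
  · simp
  · ext
    simp

theorem integral_pow_gaussianReal (v : ℝ≥0) (n : ℕ) :
    ∫ x : ℝ, x ^ n ∂gaussianReal 0 v = √(v : ℝ) ^ n * ∫ x : ℝ, x ^ n ∂gaussianReal 0 1 := by
  rw [gaussianReal_eq_map_sqrt v, integral_map (by fun_prop) (by fun_prop)]
  simp_rw [mul_pow]
  rw [integral_const_mul]

/-- For independent standard `Z, Z'`, the fourth moment of `Z + Z' ∼ N(0, 2)` is `4 m` by scaling
and `2 m + 6` by expansion, so `m = 3`. The third moment appears only multiplied by a vanishing mean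
and need not be computed. -/
theorem integral_pow_four_gaussianReal_one : ∫ x : ℝ, x ^ 4 ∂gaussianReal 0 1 = 3 := by
  have h1 := integral_pow_gaussianReal 2 4
  have h2 : gaussianReal 0 2 = (gaussianReal 0 1).conv (gaussianReal 0 1) := by
    rw [gaussianReal_conv_gaussianReal]
    norm_num
  have hs : √((2 : ℝ≥0) : ℝ) ^ 4 = 4 := by
    rw [show (4 : ℕ) = 2 * 2 from rfl, pow_mul, Real.sq_sqrt (by simp)]
    norm_num
  have hi := integrable_pow_gaussianReal 1
  have hinner : ∀ x : ℝ, ∫ y : ℝ, (x + y) ^ 4 ∂gaussianReal 0 1 =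
      x ^ 4 + 6 * x ^ 2 + (4 * ∫ y : ℝ, y ^ 3 ∂gaussianReal 0 1) * x ^ 1 +
        ∫ y : ℝ, y ^ 4 ∂gaussianReal 0 1 := by
    intro x
    have e : ∀ y : ℝ, (x + y) ^ 4 =
        x ^ 4 + (4 * x ^ 3) * y ^ 1 + (6 * x ^ 2) * y ^ 2 + (4 * x) * y ^ 3 + y ^ 4 := by
      intro y; ring
    simp_rw [e]
    rw [integral_add, integral_add, integral_add, integral_add]
    · simp_rw [integral_const_mul, integral_sq_gaussianReal]
      simp only [pow_one, integral_id_gaussianReal, integral_const, smul_eq_mul]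
      simp
      ring
    · exact integrable_const _
    · exact (hi 1).const_mul _
    · exact (integrable_const _).add ((hi 1).const_mul _)
    · exact (hi 2).const_mul _
    · exact ((integrable_const _).add ((hi 1).const_mul _)).add ((hi 2).const_mul _)
    · exact (hi 3).const_mul _
    · exact (((integrable_const _).add ((hi 1).const_mul _)).add ((hi 2).const_mul _)).add
        ((hi 3).const_mul _)
    · exact hi 4
  rw [hs, h2, integral_conv] at h1
  · simp_rw [hinner] at h1
    rw [integral_add, integral_add, integral_add] at h1
    · simp_rw [integral_const_mul, integral_sq_gaussianReal] at h1
      simp only [pow_one, integral_id_gaussianReal, integral_const, smul_eq_mul] at h1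
      simp at h1
      linarith
    · exact hi 4
    · exact (hi 2).const_mul _
    · exact (hi 4).add ((hi 2).const_mul _)
    · exact (hi 1).const_mul _
    · exact ((hi 4).add ((hi 2).const_mul _)).add ((hi 1).const_mul _)
    · exact integrable_const _
  · rw [← h2]
    exact integrable_pow_gaussianReal 2 4

theorem integral_pow_four_gaussianReal (v : ℝ≥0) :
    ∫ x : ℝ, x ^ 4 ∂gaussianReal 0 v = 3 * (v : ℝ) ^ 2 := by
  rw [integral_pow_gaussianReal, integral_pow_four_gaussianReal_one, show (4 : ℕ) = 2 * 2 from rfl,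
    pow_mul, Real.sq_sqrt v.coe_nonneg]
  ring

/-- The real random variables `V i` are the coordinates of a centred Gaussian vector of
covariance `S`. -/
def HasGaussianCoords {Ω ι : Type*} [Fintype ι] {mΩ : MeasurableSpace Ω} (P : Measure Ω)
    (S : Matrix ι ι ℝ) (V : ι → Ω → ℝ) : Prop :=
  ∀ u : ι → ℝ, HasLaw (fun ω => ∑ i, u i * V i ω)
    (gaussianReal 0 (dotProduct u (S.mulVec u)).toNNReal) P

theorem hasGaussianCoords_of_hasLaw {Ω ι : Type*} [Fintype ι] [DecidableEq ι]
    {mΩ : MeasurableSpace Ω} {P : Measure Ω} {S : Matrix ι ι ℝ} (hS : S.PosSemidef)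
    {X : Ω → EuclideanSpace ℝ ι} (h : HasLaw X (multivariateGaussian 0 S) P) :
    HasGaussianCoords P S (fun i ω => X ω i) := by
  intro u
  have hL : HasLaw (innerSL ℝ (WithLp.toLp 2 u : EuclideanSpace ℝ ι))
      (gaussianReal 0 (dotProduct u (S.mulVec u)).toNNReal) (multivariateGaussian 0 S) := by
    refine ⟨by fun_prop, ?_⟩
    rw [IsGaussian.map_eq_gaussianReal, ContinuousLinearMap.integral_comp_id_comm
      IsGaussian.integrable_id, integral_id_multivariateGaussian, map_zero]
    congr 2
    have := covarianceBilin_multivariateGaussian (μ := 0) hS (WithLp.toLp 2 u) (WithLp.toLp 2 u)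
    rw [covarianceBilin_self IsGaussian.memLp_two_id] at this
    exact this
  have := hL.comp h
  convert this using 2 with ω
  simp [PiLp.inner_apply, mul_comm]

namespace HasGaussianCoords

variable {Ω ι : Type*} [Fintype ι] {mΩ : MeasurableSpace Ω} {P : Measure Ω}
  {S : Matrix ι ι ℝ} {V : ι → Ω → ℝ}

theorem memLp_linear (h : HasGaussianCoords P S V) (u : ι → ℝ) (p : ℝ≥0) :
    MemLp (fun ω => ∑ i, u i * V i ω) p P := by
  have h1 := memLp_id_gaussianReal (μ := 0) (v := (dotProduct u (S.mulVec u)).toNNReal) p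
  rw [← (h u).map_eq] at h1
  exact h1.comp_of_map (h u).aemeasurable

theorem integral_linear_pow (h : HasGaussianCoords P S V) (u : ι → ℝ) (n : ℕ) :
    ∫ ω, (∑ i, u i * V i ω) ^ n ∂P =
      ∫ x, x ^ n ∂gaussianReal 0 (dotProduct u (S.mulVec u)).toNNReal :=
  (h u).integral_comp (f := fun x : ℝ => x ^ n) (by fun_prop)

theorem integral_linear_sq (hS : S.PosSemidef) (h : HasGaussianCoords P S V) (u : ι → ℝ) :
    ∫ ω, (∑ i, u i * V i ω) ^ 2 ∂P = dotProduct u (S.mulVec u) := by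
  rw [h.integral_linear_pow, integral_sq_gaussianReal, Real.coe_toNNReal]
  simpa using hS.dotProduct_mulVec_nonneg u

theorem integral_linear_pow_four (hS : S.PosSemidef) (h : HasGaussianCoords P S V) (u : ι → ℝ) :
    ∫ ω, (∑ i, u i * V i ω) ^ 4 ∂P = 3 * dotProduct u (S.mulVec u) ^ 2 := by
  rw [h.integral_linear_pow, integral_pow_four_gaussianReal, Real.coe_toNNReal]
  simpa using hS.dotProduct_mulVec_nonneg u

variable [DecidableEq ι]

theorem memLp (h : HasGaussianCoords P S V) (i : ι) (p : ℝ≥0) : MemLp (V i) p P := by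
  simpa [Pi.single_apply] using h.memLp_linear (Pi.single i 1) p

theorem integral_pow (h : HasGaussianCoords P S V) (i : ι) (n : ℕ) :
    ∫ ω, V i ω ^ n ∂P = ∫ x, x ^ n ∂gaussianReal 0 (S i i).toNNReal := by
  simpa [Pi.single_apply] using h.integral_linear_pow (Pi.single i 1) n

theorem integral_eq_zero (h : HasGaussianCoords P S V) (i : ι) : ∫ ω, V i ω ∂P = 0 := by
  simpa [integral_id_gaussianReal] using h.integral_pow i 1

theorem integral_pow_four (hS : S.PosSemidef) (h : HasGaussianCoords P S V) (i : ι) :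
    ∫ ω, V i ω ^ 4 ∂P = 3 * S i i ^ 2 := by
  simpa [Pi.single_apply] using h.integral_linear_pow_four hS (Pi.single i 1)

theorem hasMoments {m : MeasurableSpace Ω} (h : HasGaussianCoords P S V)
    {i : ι} (hm : Measurable[m] (V i)) : HasMoments P m (V i) :=
  ⟨hm, h.memLp i⟩

/-- Polarization of the second moments of linear forms: expand `(V i + V j) ^ 2`. -/
theorem integral_mul [IsFiniteMeasure P] (hS : S.PosSemidef) (h : HasGaussianCoords P S V)
    (hm : ∀ i, Measurable (V i)) (i j : ι) : ∫ ω, V i ω * V j ω ∂P = S i j := by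
  have hV : ∀ i, HasMoments P mΩ (V i) := fun i => h.hasMoments (hm i)
  have h1 := h.integral_linear_sq hS (Pi.single i 1 + Pi.single j 1)
  have h2 := h.integral_linear_sq hS (Pi.single i 1)
  have h3 := h.integral_linear_sq hS (Pi.single j 1)
  have hsymm : S j i = S i j := by simpa using hS.1.apply i j
  simp [Pi.single_apply, add_mul, Finset.sum_add_distrib, Matrix.mulVec_add, hsymm] at h1 h2 h3
  have e : ∀ ω, (V i ω + V j ω) ^ 2 = V i ω ^ 2 + V j ω ^ 2 + 2 * (V i ω * V j ω) := by
    intro ω; ring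
  simp_rw [e] at h1
  rw [integral_add (((hV i).pow 2).add ((hV j).pow 2)).integrable
    (((hV i).mul (hV j)).const_mul 2).integrable, integral_add ((hV i).pow 2).integrable
    ((hV j).pow 2).integrable, integral_const_mul] at h1
  linarith

end HasGaussianCoords

/-- Isserlis' formula for a product of four random variables, by polarization. -/
theorem integral_mul_four_of_integral_pow_four {Ω : Type*} {mΩ : MeasurableSpace Ω} {P : Measure Ω}
    [IsFiniteMeasure P] {a b c e : Ω → ℝ} (ha : HasMoments P mΩ a) (hb : HasMoments P mΩ b)
    (hc : HasMoments P mΩ c) (he : HasMoments P mΩ e)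
    {kaa kbb kcc kee kab kac kae kbc kbe kce : ℝ}
    (h : ∀ s t r : ℝ, ∫ ω, (a ω + s * b ω + t * c ω + r * e ω) ^ 4 ∂P =
      3 * (kaa + s ^ 2 * kbb + t ^ 2 * kcc + r ^ 2 * kee + 2 * s * kab + 2 * t * kac + 2 * r * kae
        + 2 * s * t * kbc + 2 * s * r * kbe + 2 * t * r * kce) ^ 2) :
    ∫ ω, a ω * b ω * c ω * e ω ∂P = kab * kce + kac * kbe + kae * kbc := by
  have hq : ∀ s t r : ℝ, Integrable (fun ω => (a ω + s * b ω + t * c ω + r * e ω) ^ 4) P :=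
    fun s t r => ((((ha.add (hb.const_mul s)).add (hc.const_mul t)).add (he.const_mul r)).pow
      4).integrable
  -- Alternating sum over the eight sign choices for `b, c, e`: only the monomial `a b c e`
  -- survives, with coefficient `8 * 4! = 192`.
  have hid : ∀ ω, 192 * (a ω * b ω * c ω * e ω) =
      ((a ω + 1 * b ω + 1 * c ω + 1 * e ω) ^ 4 - (a ω + 1 * b ω + 1 * c ω + (-1) * e ω) ^ 4)
      - ((a ω + 1 * b ω + (-1) * c ω + 1 * e ω) ^ 4
        - (a ω + 1 * b ω + (-1) * c ω + (-1) * e ω) ^ 4)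
      - (((a ω + (-1) * b ω + 1 * c ω + 1 * e ω) ^ 4
        - (a ω + (-1) * b ω + 1 * c ω + (-1) * e ω) ^ 4)
      - ((a ω + (-1) * b ω + (-1) * c ω + 1 * e ω) ^ 4
        - (a ω + (-1) * b ω + (-1) * c ω + (-1) * e ω) ^ 4)) := by
    intro ω; ring
  have h1 : ∫ ω, 192 * (a ω * b ω * c ω * e ω) ∂P =
      192 * (kab * kce + kac * kbe + kae * kbc) := by
    simp_rw [hid]
    rw [integral_sub, integral_sub, integral_sub, integral_sub, integral_sub, integral_sub,
      integral_sub]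
    · simp only [h]
      ring
    all_goals
      first
      | exact hq _ _ _
      | exact (hq _ _ _).sub (hq _ _ _)
      | exact ((hq _ _ _).sub (hq _ _ _)).sub ((hq _ _ _).sub (hq _ _ _))
  rw [integral_const_mul] at h1
  linarith

theorem HasGaussianCoords.integral_mul_four {Ω ι : Type*} [Fintype ι] [DecidableEq ι]
    {mΩ : MeasurableSpace Ω} {P : Measure Ω} [IsFiniteMeasure P] {V : ι → Ω → ℝ}
    (h : HasGaussianCoords P 1 V) (hm : ∀ i, Measurable (V i)) (i j k l : ι) :
    ∫ ω, V i ω * V j ω * V k ω * V l ω ∂P =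
      (1 : Matrix ι ι ℝ) i j * (1 : Matrix ι ι ℝ) k l +
      (1 : Matrix ι ι ℝ) i k * (1 : Matrix ι ι ℝ) j l +
      (1 : Matrix ι ι ℝ) i l * (1 : Matrix ι ι ℝ) j k := by
  have hV : ∀ i, HasMoments P mΩ (V i) := fun i => h.hasMoments (hm i)
  refine integral_mul_four_of_integral_pow_four (hV i) (hV j) (hV k) (hV l)
    (kaa := 1) (kbb := 1) (kcc := 1) (kee := 1) fun s t r => ?_
  have := h.integral_linear_pow_four Matrix.PosSemidef.one
    (Pi.single i 1 + s • Pi.single j 1 + t • Pi.single k 1 + r • Pi.single l 1)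
  have hsymm : ∀ i j, (1 : Matrix ι ι ℝ) i j = if j = i then 1 else 0 := by
    intro i j
    simp [Matrix.one_apply, eq_comm]
  simp only [Matrix.one_mulVec, add_dotProduct, dotProduct_add, smul_dotProduct, dotProduct_smul,
    single_one_dotProduct, Pi.single_apply, smul_eq_mul, Pi.add_apply, Pi.smul_apply, add_mul,
    Finset.sum_add_distrib, ite_mul, mul_ite, one_mul, zero_mul, mul_zero, mul_one,
    Finset.sum_ite_eq', Finset.mem_univ, if_true] at this
  simp only [mul_assoc, this, Matrix.one_apply]
  simp only [eq_comm (a := j) (b := i), eq_comm (a := k) (b := i), eq_comm (a := l) (b := i),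
    eq_comm (a := k) (b := j), eq_comm (a := l) (b := j), eq_comm (a := l) (b := k)]
  split_ifs <;> ring

-- Operator and Frobenius norms, perturbation of the inverse, powers of a stable matrix.

section LinearAlgebra

open Matrix

variable {d : ℕ}

theorem frobNorm_sq (M : Matrix (Fin d) (Fin d) ℝ) : frobNorm M ^ 2 = ∑ i, ∑ j, M i j ^ 2 :=
  Real.sq_sqrt (Finset.sum_nonneg fun _ _ => Finset.sum_nonneg fun _ _ => sq_nonneg _)

theorem frobNorm_nonneg (M : Matrix (Fin d) (Fin d) ℝ) : 0 ≤ frobNorm M := Real.sqrt_nonneg _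

theorem opNorm_nonneg (M : Matrix (Fin d) (Fin d) ℝ) : 0 ≤ opNorm M := norm_nonneg _

theorem frobNorm_eq_sqrt_prod (M : Matrix (Fin d) (Fin d) ℝ) :
    frobNorm M = √(∑ p : Fin d × Fin d, M p.1 p.2 ^ 2) := by
  rw [frobNorm, Fintype.sum_prod_type]

theorem sum_mul_le_frobNorm_mul (M N : Matrix (Fin d) (Fin d) ℝ) :
    ∑ i, ∑ j, M i j * N i j ≤ frobNorm M * frobNorm N := by
  rw [frobNorm_eq_sqrt_prod, frobNorm_eq_sqrt_prod, ← Fintype.sum_prod_type']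
  exact Real.sum_mul_le_sqrt_mul_sqrt _ _ _

theorem frobNorm_add_le (M N : Matrix (Fin d) (Fin d) ℝ) :
    frobNorm (M + N) ≤ frobNorm M + frobNorm N := by
  refine abs_le_of_sq_le_sq' ?_ (add_nonneg (frobNorm_nonneg M) (frobNorm_nonneg N)) |>.2
  have h := sum_mul_le_frobNorm_mul M N
  have e : frobNorm (M + N) ^ 2 =
      frobNorm M ^ 2 + frobNorm N ^ 2 + 2 * ∑ i, ∑ j, M i j * N i j := by
    simp_rw [frobNorm_sq, Finset.mul_sum, ← Finset.sum_add_distrib]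
    refine Finset.sum_congr rfl fun i _ => Finset.sum_congr rfl fun j _ => ?_
    simp only [Matrix.add_apply]
    ring
  rw [e]
  linarith

theorem norm_toLp_sq (v : Fin d → ℝ) : ‖(WithLp.toLp 2 v : EuclideanSpace ℝ (Fin d))‖ ^ 2 =
    ∑ i, v i ^ 2 := by
  rw [EuclideanSpace.real_norm_sq_eq]

theorem sum_sq_mulVec_le (M : Matrix (Fin d) (Fin d) ℝ) (v : Fin d → ℝ) :
    ∑ i, (M.mulVec v i) ^ 2 ≤ opNorm M ^ 2 * ∑ i, v i ^ 2 := by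
  have h := (Matrix.toEuclideanCLM (n := Fin d) (𝕜 := ℝ) M).le_opNorm (WithLp.toLp 2 v)
  rw [Matrix.toEuclideanCLM_toLp] at h
  rw [← norm_toLp_sq, ← norm_toLp_sq, ← mul_pow]
  exact pow_le_pow_left₀ (norm_nonneg _) h 2

theorem opNorm_le_of_sum_sq_mulVec_le {M : Matrix (Fin d) (Fin d) ℝ} {C : ℝ} (hC : 0 ≤ C)
    (h : ∀ v : Fin d → ℝ, ∑ i, (M.mulVec v i) ^ 2 ≤ C ^ 2 * ∑ i, v i ^ 2) : opNorm M ≤ C := by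
  refine ContinuousLinearMap.opNorm_le_bound _ hC fun v => ?_
  refine abs_le_of_sq_le_sq' ?_ (mul_nonneg hC (norm_nonneg _)) |>.2
  rw [mul_pow, EuclideanSpace.real_norm_sq_eq, EuclideanSpace.real_norm_sq_eq]
  exact h v

theorem opNorm_le_frobNorm (M : Matrix (Fin d) (Fin d) ℝ) : opNorm M ≤ frobNorm M := by
  refine opNorm_le_of_sum_sq_mulVec_le (frobNorm_nonneg M) fun v => ?_
  rw [frobNorm_sq, Finset.sum_mul]
  exact Finset.sum_le_sum fun i _ => Finset.sum_mul_sq_le_sq_mul_sq Finset.univ (M i) v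

theorem opNorm_mul_le (M N : Matrix (Fin d) (Fin d) ℝ) :
    opNorm (M * N) ≤ opNorm M * opNorm N := by
  rw [opNorm, map_mul]
  exact norm_mul_le _ _

theorem frobNorm_transpose (M : Matrix (Fin d) (Fin d) ℝ) : frobNorm Mᵀ = frobNorm M := by
  rw [frobNorm, frobNorm, Finset.sum_comm]
  rfl

theorem frobNorm_mul_le (M N : Matrix (Fin d) (Fin d) ℝ) :
    frobNorm (M * N) ≤ opNorm M * frobNorm N := by
  refine abs_le_of_sq_le_sq' ?_ (mul_nonneg (opNorm_nonneg M) (frobNorm_nonneg N)) |>.2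
  rw [mul_pow, frobNorm_sq, frobNorm_sq, Finset.sum_comm, Finset.sum_comm (f := fun i j => N i j ^ 2),
    Finset.mul_sum]
  exact Finset.sum_le_sum fun j _ => sum_sq_mulVec_le M fun i => N i j

theorem frobNorm_mul_transpose_le (M N : Matrix (Fin d) (Fin d) ℝ) :
    frobNorm (N * Mᵀ) ≤ opNorm M * frobNorm N := by
  rw [← frobNorm_transpose, transpose_mul, transpose_transpose, ← frobNorm_transpose N]
  exact frobNorm_mul_le _ _

theorem sq_dotProduct_mulVec_le (M : Matrix (Fin d) (Fin d) ℝ) (u v : Fin d → ℝ) :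
    (u ⬝ᵥ M *ᵥ v) ^ 2 ≤ opNorm M ^ 2 * (∑ i, u i ^ 2) * ∑ i, v i ^ 2 := by
  refine (Finset.sum_mul_sq_le_sq_mul_sq _ _ _).trans ?_
  have h := sum_sq_mulVec_le M v
  have hu : 0 ≤ ∑ i, u i ^ 2 := Finset.sum_nonneg fun _ _ => sq_nonneg _
  calc _ ≤ (∑ i, u i ^ 2) * (opNorm M ^ 2 * ∑ i, v i ^ 2) := mul_le_mul_of_nonneg_left h hu
    _ = _ := by ring

theorem abs_dotProduct_mulVec_self_le (M : Matrix (Fin d) (Fin d) ℝ) (v : Fin d → ℝ) :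
    |v ⬝ᵥ M *ᵥ v| ≤ opNorm M * ∑ i, v i ^ 2 := by
  have hv : 0 ≤ ∑ i, v i ^ 2 := Finset.sum_nonneg fun _ _ => sq_nonneg _
  refine abs_le_of_sq_le_sq ?_ (mul_nonneg (opNorm_nonneg M) hv)
  refine (sq_dotProduct_mulVec_le M v v).trans_eq ?_
  ring

theorem abs_diag_le_opNorm (M : Matrix (Fin d) (Fin d) ℝ) (i : Fin d) : |M i i| ≤ opNorm M := by
  have h := abs_dotProduct_mulVec_self_le M (Pi.single i 1)
  have e : ∑ k, (Pi.single i 1 : Fin d → ℝ) k ^ 2 = 1 := by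
    simp [Pi.single_apply]
  rw [e] at h
  simpa using h

theorem opNorm_one [NeZero d] : opNorm (1 : Matrix (Fin d) (Fin d) ℝ) = 1 := by
  rw [opNorm, map_one, norm_one]

/-- In the Loewner order, a scalar lies below a Hermitian matrix when it lies below its spectrum,
which makes `S - lamMin S • 1` positive semidefinite. -/
theorem lamMin_mul_le {S : Matrix (Fin d) (Fin d) ℝ} (hS : S.IsHermitian) (v : Fin d → ℝ) :
    lamMin S * ∑ i, v i ^ 2 ≤ v ⬝ᵥ S *ᵥ v := by
  have h : (S - lamMin S • (1 : Matrix (Fin d) (Fin d) ℝ)).PosSemidef := by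
    open scoped MatrixOrder in
    have hle : algebraMap ℝ (Matrix (Fin d) (Fin d) ℝ) (lamMin S) ≤ S := by
      rw [algebraMap_le_iff_le_spectrum (a := S) hS]
      intro x hx
      exact csInf_le (Matrix.finite_real_spectrum.bddBelow) hx
    rw [Matrix.le_iff, Algebra.algebraMap_eq_smul_one] at hle
    exact hle
  have h1 := h.dotProduct_mulVec_nonneg v
  simp only [star_trivial, Matrix.sub_mulVec, Matrix.smul_mulVec, Matrix.one_mulVec,
    dotProduct_sub, dotProduct_smul, smul_eq_mul] at h1
  have e : v ⬝ᵥ v = ∑ i, v i ^ 2 := by simp [dotProduct, sq]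
  rw [e] at h1
  linarith

theorem lamMin_le_opNorm [NeZero d] {S : Matrix (Fin d) (Fin d) ℝ} (hS : S.IsHermitian) :
    lamMin S ≤ opNorm S := by
  have h1 := lamMin_mul_le hS (Pi.single 0 1)
  have h2 := (le_abs_self _).trans (abs_dotProduct_mulVec_self_le S (Pi.single 0 1))
  have e : ∑ k, (Pi.single 0 1 : Fin d → ℝ) k ^ 2 = 1 := by
    simp [Pi.single_apply]
  rw [e] at h1 h2
  linarith

/-- A symmetric matrix close to a positive definite one is bounded below. -/
theorem lamMin_sq_mul_le_sum_sq_mulVec {S S' : Matrix (Fin d) (Fin d) ℝ} (hS : S.IsHermitian)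
    (hlam : 0 < lamMin S) (h : frobNorm (S' - S) ≤ lamMin S / 2) (v : Fin d → ℝ) :
    (lamMin S / 2) ^ 2 * ∑ i, v i ^ 2 ≤ ∑ i, (S'.mulVec v i) ^ 2 := by
  have h1 := lamMin_mul_le hS v
  have h2 := (neg_abs_le _).trans' (neg_le_neg (abs_dotProduct_mulVec_self_le (S' - S) v))
  set q := ∑ i, v i ^ 2 with hq
  have hq0 : 0 ≤ q := Finset.sum_nonneg fun _ _ => sq_nonneg _
  have h3 : opNorm (S' - S) * q ≤ lamMin S / 2 * q :=
    mul_le_mul_of_nonneg_right ((opNorm_le_frobNorm _).trans h) hq0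
  rw [Matrix.sub_mulVec, dotProduct_sub] at h2
  -- The perturbation costs at most half of the quadratic form; Cauchy–Schwarz then turns the lower
  -- bound on `v ⬝ᵥ S' *ᵥ v` into one on the length of `S' *ᵥ v`.
  have h4 : lamMin S / 2 * q ≤ v ⬝ᵥ S' *ᵥ v := by linarith
  have h5 : (v ⬝ᵥ S' *ᵥ v) ^ 2 ≤ q * ∑ i, (S'.mulVec v i) ^ 2 :=
    Finset.sum_mul_sq_le_sq_mul_sq _ _ _
  rcases hq0.eq_or_lt with h0 | h0
  · rw [← h0, mul_zero]
    exact Finset.sum_nonneg fun _ _ => sq_nonneg _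
  · have h6 : (lamMin S / 2 * q) ^ 2 ≤ (v ⬝ᵥ S' *ᵥ v) ^ 2 :=
      pow_le_pow_left₀ (by positivity) h4 2
    refine le_of_mul_le_mul_left ?_ h0
    calc q * ((lamMin S / 2) ^ 2 * q) = (lamMin S / 2 * q) ^ 2 := by ring
      _ ≤ _ := h6.trans h5

theorem isUnit_det_of_frobNorm_sub_le {S S' : Matrix (Fin d) (Fin d) ℝ} (hS : S.IsHermitian)
    (hlam : 0 < lamMin S) (h : frobNorm (S' - S) ≤ lamMin S / 2) : IsUnit S'.det := by
  rw [isUnit_iff_ne_zero]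
  intro h0
  obtain ⟨v, hv, hv0⟩ := Matrix.exists_mulVec_eq_zero_iff.2 h0
  have h1 := lamMin_sq_mul_le_sum_sq_mulVec hS hlam h v
  rw [hv0] at h1
  simp only [Pi.zero_apply, ne_eq, OfNat.ofNat_ne_zero, not_false_eq_true, zero_pow,
    Finset.sum_const_zero] at h1
  apply hv
  have h2 : ∑ i, v i ^ 2 ≤ 0 := by
    by_contra! hc
    have : 0 < (lamMin S / 2) ^ 2 * ∑ i, v i ^ 2 := by positivity
    linarith
  have h3 := (Finset.sum_eq_zero_iff_of_nonneg fun i _ => sq_nonneg (v i)).1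
    (h2.antisymm (Finset.sum_nonneg fun _ _ => sq_nonneg _))
  ext i
  simpa using h3 i (Finset.mem_univ i)

theorem opNorm_inv_le {S S' : Matrix (Fin d) (Fin d) ℝ} (hS : S.IsHermitian)
    (hlam : 0 < lamMin S) (h : frobNorm (S' - S) ≤ lamMin S / 2) :
    opNorm S'⁻¹ ≤ 2 / lamMin S := by
  have hu := isUnit_det_of_frobNorm_sub_le hS hlam h
  refine opNorm_le_of_sum_sq_mulVec_le (by positivity) fun v => ?_
  have h1 := lamMin_sq_mul_le_sum_sq_mulVec hS hlam h (S'⁻¹ *ᵥ v)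
  rw [Matrix.mulVec_mulVec, Matrix.mul_nonsing_inv _ hu, Matrix.one_mulVec] at h1
  calc ∑ i, (S'⁻¹ *ᵥ v) i ^ 2
      = (2 / lamMin S) ^ 2 * ((lamMin S / 2) ^ 2 * ∑ i, (S'⁻¹ *ᵥ v) i ^ 2) := by
        field_simp
    _ ≤ _ := by gcongr

/-- The error of the plug-in estimator `M S'⁻¹` of `A`. -/
theorem frobNorm_mul_inv_sub_le {A S S' M : Matrix (Fin d) (Fin d) ℝ} (hS : S.IsHermitian)
    (hS' : S'.IsSymm) (hlam : 0 < lamMin S) {r : ℝ} (h : frobNorm (S' - S) ≤ r)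
    (hr : r ≤ lamMin S / 2) (hM : frobNorm (M - A * S) ≤ r) :
    frobNorm (M * S'⁻¹ - A) ≤ 2 * ((1 + opNorm A) / lamMin S) * r := by
  have hu := isUnit_det_of_frobNorm_sub_le hS hlam (h.trans hr)
  -- Adding and subtracting `A * S` separates the two estimation errors. The symmetry of `S'` lets
  -- the inverse be written as a transpose, the form needed to bound a right factor by its operator
  -- norm.
  have e : M * S'⁻¹ - A = ((M - A * S) + A * (S - S')) * (S'⁻¹)ᵀ := by
    rw [Matrix.transpose_nonsing_inv, hS'.eq, Matrix.mul_sub, sub_add_sub_cancel, Matrix.sub_mul,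
      Matrix.mul_assoc A, Matrix.mul_nonsing_inv _ hu, Matrix.mul_one]
  have hneg : frobNorm (S - S') = frobNorm (S' - S) := by
    simp only [frobNorm, Matrix.sub_apply, sub_sq_comm]
  have h1 : frobNorm ((M - A * S) + A * (S - S')) ≤ (1 + opNorm A) * r := by
    refine (frobNorm_add_le _ _).trans ?_
    have := (frobNorm_mul_le A (S - S')).trans
      (mul_le_mul_of_nonneg_left (hneg.trans_le h) (opNorm_nonneg A))
    linarith
  rw [e]
  refine (frobNorm_mul_transpose_le _ _).trans ?_
  calc _ ≤ 2 / lamMin S * ((1 + opNorm A) * r) :=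
        mul_le_mul (opNorm_inv_le hS hlam (h.trans hr)) h1 (frobNorm_nonneg _) (by positivity)
    _ = _ := by ring

/-- Restricts the complex operator to real vectors. The comparison is needed because the spectral
radius is defined over `ℂ`. -/
theorem opNorm_le_norm_complex (M : Matrix (Fin d) (Fin d) ℝ) :
    opNorm M ≤ ‖Matrix.toEuclideanCLM (n := Fin d) (𝕜 := ℂ) (M.map (algebraMap ℝ ℂ))‖ := by
  refine opNorm_le_of_sum_sq_mulVec_le (norm_nonneg _) fun v => ?_
  have h := (Matrix.toEuclideanCLM (n := Fin d) (𝕜 := ℂ) (M.map (algebraMap ℝ ℂ))).le_opNorm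
    (WithLp.toLp 2 fun i => (v i : ℂ))
  rw [Matrix.toEuclideanCLM_toLp] at h
  have h2 := pow_le_pow_left₀ (norm_nonneg _) h 2
  rw [mul_pow, EuclideanSpace.norm_sq_eq, EuclideanSpace.norm_sq_eq] at h2
  have e : ∀ i, ((M.map (algebraMap ℝ ℂ)) *ᵥ fun i => (v i : ℂ)) i = ((M *ᵥ v) i : ℂ) := by
    intro i
    simp [Matrix.mulVec, dotProduct]
  simp only [e] at h2
  simpa [sq_abs] using h2

/-- Gelfand's formula: `‖A ^ k‖ ^ (1/k)` tends to the spectral radius, hence is eventually below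
`γ`, and finitely many `k` do not affect boundedness. This makes the supremum in `tauConst` a
genuine one. -/
theorem bddAbove_opNorm_pow {A : Matrix (Fin d) (Fin d) ℝ} {γ : ℝ}
    (h : specRad A < ENNReal.ofReal γ) :
    BddAbove (Set.range fun k : ℕ => opNorm (A ^ k) * (γ ^ k)⁻¹) := by
  have hγ : 0 < γ := by
    by_contra! h0
    rw [ENNReal.ofReal_of_nonpos h0] at h
    exact not_lt_bot h
  set a := Matrix.toEuclideanCLM (n := Fin d) (𝕜 := ℂ) (A.map (algebraMap ℝ ℂ)) with ha
  have hrad : spectralRadius ℂ a = specRad A := by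
    rw [specRad, spectralRadius, spectralRadius, ha, AlgEquiv.spectrum_eq]
  have hg := spectrum.pow_norm_pow_one_div_tendsto_nhds_spectralRadius a
  rw [hrad] at hg
  refine Filter.IsBoundedUnder.bddAbove_range ⟨1, ?_⟩
  rw [Filter.eventually_map]
  filter_upwards [hg.eventually_lt_const h, Filter.eventually_ge_atTop 1] with k hk hk1
  have h1 : ‖a ^ k‖ ^ (1 / k : ℝ) < γ :=
    (ENNReal.ofReal_lt_ofReal_iff hγ).1 hk
  have h2 : ‖a ^ k‖ ≤ γ ^ k := by
    have := pow_le_pow_left₀ (by positivity) h1.le k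
    rwa [← Real.rpow_natCast (_ ^ _), ← Real.rpow_mul (norm_nonneg _), one_div,
      inv_mul_cancel₀ (by positivity), Real.rpow_one] at this
  have h3 : opNorm (A ^ k) ≤ ‖a ^ k‖ := by
    have := opNorm_le_norm_complex (A ^ k)
    rwa [Matrix.map_pow, map_pow] at this
  rw [← div_eq_mul_inv, div_le_one (by positivity)]
  exact h3.trans h2

theorem opNorm_pow_le_tauConst {A : Matrix (Fin d) (Fin d) ℝ} {γ : ℝ} (hγ : 0 < γ)
    (h : specRad A < ENNReal.ofReal γ) (k : ℕ) : opNorm (A ^ k) ≤ tauConst A γ * γ ^ k := by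
  have h1 := le_ciSup (bddAbove_opNorm_pow h) k
  rwa [← div_eq_mul_inv, div_le_iff₀ (by positivity)] at h1

theorem one_le_tauConst [NeZero d] {A : Matrix (Fin d) (Fin d) ℝ} {γ : ℝ}
    (h : specRad A < ENNReal.ofReal γ) : 1 ≤ tauConst A γ := by
  have h1 := le_ciSup (bddAbove_opNorm_pow h) 0
  simp only [pow_zero, opNorm_one, inv_one, mul_one] at h1
  exact h1

end LinearAlgebra

-- Bookkeeping of the independent sources: disjoint index sets generate independent σ-algebras.

section Sources

/-- The index set of the independent sources of randomness of the regression model: the initial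
state, the covariates, the process noise and the observation noise. -/
abbrev SourceIdx := Unit ⊕ ℕ ⊕ ℕ ⊕ ℕ

/-- The sources which determine the state at time `n`. -/
def stateIdx (n : ℕ) : Set SourceIdx :=
  {i | i = Sum.inl () ∨ ∃ t < n, i = Sum.inr (Sum.inr (Sum.inl t))}

/-- The process noise at time `n`. -/
def innovIdx (n : ℕ) : Set SourceIdx := {Sum.inr (Sum.inr (Sum.inl n))}

/-- The covariates at the times in `D`. -/
def covIdx (D : Set ℕ) : Set SourceIdx := {i | ∃ t ∈ D, i = Sum.inr (Sum.inl t)}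

/-- The observation noise at the times in `D`. -/
def noiseIdx (D : Set ℕ) : Set SourceIdx := {i | ∃ t ∈ D, i = Sum.inr (Sum.inr (Sum.inr t))}

theorem stateIdx_mono {n k : ℕ} (h : n ≤ k) : stateIdx n ⊆ stateIdx k := by
  rintro i (hi | ⟨t, ht, hi⟩)
  · exact Or.inl hi
  · exact Or.inr ⟨t, ht.trans_le h, hi⟩

theorem innovIdx_subset_stateIdx {n k : ℕ} (h : n < k) : innovIdx n ⊆ stateIdx k := by
  rintro i rfl
  exact Or.inr ⟨n, h, rfl⟩

theorem disjoint_stateIdx_innovIdx (n : ℕ) : Disjoint (stateIdx n) (innovIdx n) := by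
  rw [Set.disjoint_left]
  rintro i (rfl | ⟨t, ht, rfl⟩) h
  · simp [innovIdx] at h
  · simp only [innovIdx, Set.mem_singleton_iff, Sum.inr.injEq, Sum.inl.injEq] at h
    omega

theorem disjoint_stateIdx_covIdx (n : ℕ) (D : Set ℕ) : Disjoint (stateIdx n) (covIdx D) := by
  rw [Set.disjoint_left]
  rintro i hi ⟨t, -, rfl⟩
  simp [stateIdx] at hi

theorem disjoint_stateIdx_noiseIdx (n : ℕ) (D : Set ℕ) : Disjoint (stateIdx n) (noiseIdx D) := by
  rw [Set.disjoint_left]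
  rintro i hi ⟨t, -, rfl⟩
  simp [stateIdx] at hi

theorem disjoint_covIdx_noiseIdx (D E : Set ℕ) : Disjoint (covIdx D) (noiseIdx E) := by
  rw [Set.disjoint_left]
  rintro i ⟨t, -, rfl⟩ ⟨s, -, h⟩
  simp at h

theorem disjoint_covIdx {D E : Set ℕ} (h : Disjoint D E) : Disjoint (covIdx D) (covIdx E) := by
  rw [Set.disjoint_left] at h ⊢
  rintro i ⟨t, ht, rfl⟩ ⟨s, hs, e⟩
  simp only [Sum.inr.injEq, Sum.inl.injEq] at e
  exact h ht (e ▸ hs)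

theorem disjoint_noiseIdx {D E : Set ℕ} (h : Disjoint D E) :
    Disjoint (noiseIdx D) (noiseIdx E) := by
  rw [Set.disjoint_left] at h ⊢
  rintro i ⟨t, ht, rfl⟩ ⟨s, hs, e⟩
  simp only [Sum.inr.injEq] at e
  exact h ht (e ▸ hs)

/-- The covariates and the observation noise at the times in `D`. -/
def obsIdx (D : Set ℕ) : Set SourceIdx := covIdx D ∪ noiseIdx D

theorem disjoint_stateIdx_obsIdx (n : ℕ) (D : Set ℕ) : Disjoint (stateIdx n) (obsIdx D) :=
  (disjoint_stateIdx_covIdx n D).union_right (disjoint_stateIdx_noiseIdx n D)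

theorem disjoint_obsIdx {D E : Set ℕ} (h : Disjoint D E) : Disjoint (obsIdx D) (obsIdx E) :=
  ((disjoint_covIdx h).union_right (disjoint_covIdx_noiseIdx D E)).union_left
    ((disjoint_covIdx_noiseIdx E D).symm.union_right (disjoint_noiseIdx h))

/-- The `σ`-algebras generated by the independent sources. -/
abbrev sourceSigma {d : ℕ} {Ω : Type*} (x w β : ℕ → Ω → EuclideanSpace ℝ (Fin d))
    (ε : ℕ → Ω → ℝ) : SourceIdx → MeasurableSpace Ω :=
  Sum.elim (fun _ : Unit => MeasurableSpace.comap (β 0) inferInstance)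
    (Sum.elim (fun t : ℕ => MeasurableSpace.comap (x t) inferInstance)
      (Sum.elim (fun t : ℕ => MeasurableSpace.comap (w t) inferInstance)
        (fun t : ℕ => MeasurableSpace.comap (ε t) inferInstance)))

end Sources

/-- Expectation of a function of two independent random variables as an iterated integral. -/
theorem integral_comp_of_indepFun {Ω E F : Type*} {mΩ : MeasurableSpace Ω} {P : Measure Ω}
    [IsFiniteMeasure P] [MeasurableSpace E] [MeasurableSpace F] {X : Ω → E} {Y : Ω → F}
    (hX : Measurable X) (hY : Measurable Y) (hXY : IndepFun X Y P) {f : E × F → ℝ}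
    (hf : Measurable f) (hi : Integrable (fun ω => f (X ω, Y ω)) P) :
    ∫ ω, f (X ω, Y ω) ∂P = ∫ ω, ∫ ω', f (X ω, Y ω') ∂P ∂P := by
  have hlaw : P.map (fun ω => (X ω, Y ω)) = (P.map X).prod (P.map Y) :=
    (indepFun_iff_map_prod_eq_prod_map_map hX.aemeasurable hY.aemeasurable).1 hXY
  have h1 : ∫ ω, f (X ω, Y ω) ∂P = ∫ z, f z ∂(P.map (fun ω => (X ω, Y ω))) :=
    (integral_map (hX.prodMk hY).aemeasurable hf.aestronglyMeasurable).symm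
  have hint : Integrable f (P.map (fun ω => (X ω, Y ω))) :=
    (integrable_map_measure hf.aestronglyMeasurable (hX.prodMk hY).aemeasurable).2 hi
  rw [hlaw] at h1 hint
  rw [h1, integral_prod _ hint, integral_map hX.aemeasurable]
  · congr 1 with ω
    exact integral_map hY.aemeasurable (hf.comp measurable_prodMk_left).aestronglyMeasurable
  · exact hf.stronglyMeasurable.integral_prod_right'.aestronglyMeasurable

-- Adaptedness and stationarity of the state process.

namespace IsRegressionModel

open Matrix

variable {d : ℕ} {Ω : Type*} [mΩ : MeasurableSpace Ω] {P : Measure Ω} [IsProbabilityMeasure P]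
  {A W S : Matrix (Fin d) (Fin d) ℝ} {σ : NNReal}
  {x w β : ℕ → Ω → EuclideanSpace ℝ (Fin d)} {ε y : ℕ → Ω → ℝ}

theorem sourceSigma_le (H : IsRegressionModel P A W S σ x w β ε y) (i : SourceIdx) :
    sourceSigma x w β ε i ≤ mΩ := by
  rcases i with _ | t | t | t
  · exact H.measurable_init.comap_le
  · exact (H.measurable_x t).comap_le
  · exact (H.measurable_w t).comap_le
  · exact (H.measurable_ε t).comap_le

theorem iSupOn_le (H : IsRegressionModel P A W S σ x w β ε y) (I : Set SourceIdx) :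
    iSupOn (sourceSigma x w β ε) I ≤ mΩ :=
  iSup₂_le fun i _ => H.sourceSigma_le i

theorem indep_of_disjoint (H : IsRegressionModel P A W S σ x w β ε y) {I J : Set SourceIdx}
    (h : Disjoint I J) :
    Indep (iSupOn (sourceSigma x w β ε) I) (iSupOn (sourceSigma x w β ε) J) P :=
  indep_iSup_of_disjoint H.sourceSigma_le H.indep h

theorem integral_mul_of_disjoint (H : IsRegressionModel P A W S σ x w β ε y)
    {I J : Set SourceIdx} (h : Disjoint I J) {X Y : Ω → ℝ}
    (hX : HasMoments P (iSupOn (sourceSigma x w β ε) I) X)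
    (hY : HasMoments P (iSupOn (sourceSigma x w β ε) J) Y) :
    ∫ ω, X ω * Y ω ∂P = (∫ ω, X ω ∂P) * ∫ ω, Y ω ∂P :=
  hX.integral_mul_of_indep hY (H.indep_of_disjoint h)

theorem gaussian_x (H : IsRegressionModel P A W S σ x w β ε y) (t : ℕ) :
    HasGaussianCoords P 1 (fun i ω => x t ω i) :=
  hasGaussianCoords_of_hasLaw Matrix.PosSemidef.one (H.law_x t)

theorem measurable_comap_coord {V : Ω → EuclideanSpace ℝ (Fin d)} (i : Fin d) :
    Measurable[MeasurableSpace.comap V inferInstance] (fun ω => V ω i) := by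
  have h1 : Measurable (fun v : EuclideanSpace ℝ (Fin d) => v i) := by fun_prop
  exact h1.comp (comap_measurable V)

theorem hasMoments_x (H : IsRegressionModel P A W S σ x w β ε y) {t : ℕ} {D : Set ℕ} (ht : t ∈ D)
    (i : Fin d) : HasMoments P (iSupOn (sourceSigma x w β ε) (covIdx D)) (fun ω => x t ω i) :=
  (H.gaussian_x t).hasMoments ((measurable_comap_coord i).mono
    (le_iSup₂_of_le (f := fun i (_ : i ∈ covIdx D) => sourceSigma x w β ε i)
      (Sum.inr (Sum.inl t)) ⟨t, ht, rfl⟩ le_rfl) le_rfl)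

theorem hasMoments_w (H : IsRegressionModel P A W S σ x w β ε y) (hW : W.PosSemidef) (t : ℕ)
    (i : Fin d) : HasMoments P (iSupOn (sourceSigma x w β ε) (innovIdx t)) (fun ω => w t ω i) :=
  (hasGaussianCoords_of_hasLaw hW (H.law_w t)).hasMoments ((measurable_comap_coord i).mono
    (le_iSup₂_of_le (f := fun i (_ : i ∈ innovIdx t) => sourceSigma x w β ε i)
      (Sum.inr (Sum.inr (Sum.inl t))) rfl le_rfl) le_rfl)

theorem hasMoments_ε (H : IsRegressionModel P A W S σ x w β ε y) {t : ℕ} {D : Set ℕ} (ht : t ∈ D) :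
    HasMoments P (iSupOn (sourceSigma x w β ε) (noiseIdx D)) (ε t) := by
  refine ⟨(comap_measurable (ε t)).mono
    (le_iSup₂_of_le (f := fun i (_ : i ∈ noiseIdx D) => sourceSigma x w β ε i)
      (Sum.inr (Sum.inr (Sum.inr t))) ⟨t, ht, rfl⟩ le_rfl) le_rfl, fun p => ?_⟩
  have h1 := memLp_id_gaussianReal (μ := 0) (v := σ ^ 2) p
  rw [← (H.law_ε t).map_eq] at h1
  exact h1.comp_of_map (H.law_ε t).aemeasurable

theorem state_succ (H : IsRegressionModel P A W S σ x w β ε y) (t : ℕ) (ω : Ω) (i : Fin d) :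
    β (t + 1) ω i = ∑ j, A i j * β t ω j + w t ω i := by
  rw [H.dynamics]
  rfl

theorem observation_eq (H : IsRegressionModel P A W S σ x w β ε y) (t : ℕ) (ω : Ω) :
    y t ω = ∑ i, x t ω i * β t ω i + ε t ω := by
  rw [H.observation]
  simp [PiLp.inner_apply, mul_comm]

/-- Adaptedness: `β t` involves only `β 0` and the process noise before time `t`, so it is
independent of `w t` and of all covariates and observation noises. -/
theorem hasMoments_state (H : IsRegressionModel P A W S σ x w β ε y) (hW : W.PosSemidef)
    (hS : S.PosSemidef) (t : ℕ) (i : Fin d) :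
    HasMoments P (iSupOn (sourceSigma x w β ε) (stateIdx t)) (fun ω => β t ω i) := by
  induction t generalizing i with
  | zero =>
    exact (hasGaussianCoords_of_hasLaw hS H.law_init).hasMoments ((measurable_comap_coord i).mono
      (le_iSup₂_of_le (f := fun i (_ : i ∈ stateIdx 0) => sourceSigma x w β ε i)
        (Sum.inl ()) (Or.inl rfl) le_rfl) le_rfl)
  | succ t ih =>
    simp_rw [H.state_succ]
    exact (HasMoments.sum _ fun j _ =>
      ((ih j).mono (iSupOn_mono _ (stateIdx_mono (Nat.le_succ t)))).const_mul _).add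
      ((H.hasMoments_w hW t i).mono (iSupOn_mono _ (innovIdx_subset_stateIdx (Nat.lt_succ_self t))))

theorem measurable_state (H : IsRegressionModel P A W S σ x w β ε y) (t : ℕ) :
    Measurable (β t) := by
  induction t with
  | zero => exact H.measurable_init
  | succ t ih =>
    have e : β (t + 1) =
        fun ω => Matrix.toEuclideanCLM (n := Fin d) (𝕜 := ℝ) A (β t ω) + w t ω :=
      funext (H.dynamics t)
    rw [e]
    exact ((ContinuousLinearMap.measurable _).comp ih).add (H.measurable_w t)

/-- Stationarity, by induction: a linear form of `β (t+1)` is a form of `β t` plus an independent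
Gaussian form of `w t`, and by the Lyapunov equation the two variances add up to that given by `S`.
-/
theorem gaussian_state (H : IsRegressionModel P A W S σ x w β ε y) (hW : W.PosSemidef)
    (hS : IsStationaryCov A W S) (t : ℕ) : HasGaussianCoords P S (fun i ω => β t ω i) := by
  induction t with
  | zero => exact hasGaussianCoords_of_hasLaw hS.posSemidef H.law_init
  | succ t ih =>
    intro u
    have h1 := ih (Aᵀ *ᵥ u)
    have h2 := hasGaussianCoords_of_hasLaw hW (H.law_w t) u
    have hm1 : HasMoments P (iSupOn (sourceSigma x w β ε) (stateIdx t))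
        (fun ω => ∑ i, (Aᵀ *ᵥ u) i * β t ω i) :=
      HasMoments.sum _ fun i _ => (H.hasMoments_state hW hS.posSemidef t i).const_mul _
    have hm2 : HasMoments P (iSupOn (sourceSigma x w β ε) (innovIdx t))
        (fun ω => ∑ i, u i * w t ω i) :=
      HasMoments.sum _ fun i _ => (H.hasMoments_w hW t i).const_mul _
    have hind : IndepFun (fun ω => ∑ i, (Aᵀ *ᵥ u) i * β t ω i) (fun ω => ∑ i, u i * w t ω i) P := by
      rw [IndepFun_iff_Indep]
      exact indep_of_indep_of_le_left (indep_of_indep_of_le_right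
        (H.indep_of_disjoint (disjoint_stateIdx_innovIdx t)) hm2.measurable.comap_le)
        hm1.measurable.comap_le
    have hsum := gaussianReal_add_gaussianReal_of_indepFun hind h1.map_eq h2.map_eq
    refine ⟨?_, ?_⟩
    · refine Measurable.aemeasurable ?_
      have := H.measurable_state (t + 1)
      fun_prop
    · have e : (fun ω => ∑ i, u i * β (t + 1) ω i) =
          (fun ω => ∑ i, (Aᵀ *ᵥ u) i * β t ω i) + fun ω => ∑ i, u i * w t ω i := by
        funext ω
        simp only [H.state_succ, Pi.add_apply, mul_add, Finset.sum_add_distrib, Matrix.mulVec,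
          dotProduct, Matrix.transpose_apply, Finset.sum_mul, Finset.mul_sum]
        rw [Finset.sum_comm]
        congr 1
        refine Finset.sum_congr rfl fun i _ => Finset.sum_congr rfl fun j _ => by ring
      rw [e, hsum, add_zero]
      congr 1
      rw [← Real.toNNReal_add]
      · congr 1
        conv_rhs => rw [hS.lyapunov]
        rw [Matrix.add_mulVec, dotProduct_add, ← Matrix.mulVec_mulVec, ← Matrix.mulVec_mulVec,
          Matrix.dotProduct_mulVec u A, ← Matrix.mulVec_transpose]
      · simpa using hS.posSemidef.dotProduct_mulVec_nonneg (Aᵀ *ᵥ u)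
      · simpa using hW.dotProduct_mulVec_nonneg u

end IsRegressionModel

-- Variance and product bounds.

namespace HasMoments

variable {Ω : Type*} {mΩ : MeasurableSpace Ω} {P : Measure Ω} [IsProbabilityMeasure P]
  {m : MeasurableSpace Ω} {X Y : Ω → ℝ}

theorem integral_sub_sq_le (hX : HasMoments P m X) {c : ℝ} (hc : ∫ ω, X ω ∂P = c) :
    ∫ ω, (X ω - c) ^ 2 ∂P ≤ ∫ ω, X ω ^ 2 ∂P := by
  have e : ∀ ω, (X ω - c) ^ 2 = X ω ^ 2 - 2 * c * X ω + c ^ 2 := by intro ω; ring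
  simp_rw [e]
  rw [integral_add ((hX.pow 2).sub (hX.const_mul _)).integrable (integrable_const _),
    integral_sub (hX.pow 2).integrable (hX.const_mul _).integrable, integral_const_mul, hc]
  simp only [integral_const, probReal_univ, smul_eq_mul]
  nlinarith [sq_nonneg c]

theorem integral_mul_le_add_div_two (hX : HasMoments P m X) (hY : HasMoments P m Y) :
    ∫ ω, X ω * Y ω ∂P ≤ (∫ ω, X ω ^ 2 ∂P + ∫ ω, Y ω ^ 2 ∂P) / 2 := by
  rw [← integral_add (hX.pow 2).integrable (hY.pow 2).integrable, ← integral_div]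
  refine integral_mono (hX.mul hY).integrable (((hX.pow 2).add (hY.pow 2)).integrable.div_const 2)
    fun ω => ?_
  simp only
  nlinarith [sq_nonneg (X ω - Y ω)]

end HasMoments

-- The population Gram operator of the features.

section FeatureKernel

variable {d : ℕ}

/-- The second moments of the features `x' i * x j`, where `x' = x` for `h = 0` and `x'` is
independent of `x` otherwise. -/
def featureKernel (h : ℕ) (a b : Fin d × Fin d) : ℝ :=
  (1 : Matrix (Fin d) (Fin d) ℝ) a.1 b.1 * (1 : Matrix (Fin d) (Fin d) ℝ) a.2 b.2 +
    if h = 0 then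
      (1 : Matrix (Fin d) (Fin d) ℝ) a.1 a.2 * (1 : Matrix (Fin d) (Fin d) ℝ) b.1 b.2 +
        (1 : Matrix (Fin d) (Fin d) ℝ) a.1 b.2 * (1 : Matrix (Fin d) (Fin d) ℝ) a.2 b.1
    else 0

/-- As an operator on matrices, the kernel is the identity for `h ≠ 0` and `M ↦ M + tr(M) I + Mᵀ`
for `h = 0`. -/
theorem sum_featureKernel_mul (h : ℕ) (a : Fin d × Fin d) (M : Fin d × Fin d → ℝ) :
    ∑ b, featureKernel h a b * M b = M a +
      if h = 0 then (1 : Matrix (Fin d) (Fin d) ℝ) a.1 a.2 * ∑ i, M (i, i) + M (a.2, a.1)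
      else 0 := by
  have e1 : ∑ b : Fin d × Fin d, (1 : Matrix (Fin d) (Fin d) ℝ) a.1 b.1 *
      (1 : Matrix (Fin d) (Fin d) ℝ) a.2 b.2 * M b = M a := by
    simp [Fintype.sum_prod_type, Matrix.one_apply]
  have e2 : ∑ b : Fin d × Fin d, (1 : Matrix (Fin d) (Fin d) ℝ) a.1 a.2 *
      (1 : Matrix (Fin d) (Fin d) ℝ) b.1 b.2 * M b =
      (1 : Matrix (Fin d) (Fin d) ℝ) a.1 a.2 * ∑ i, M (i, i) := by
    simp [Fintype.sum_prod_type, Matrix.one_apply]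
  have e3 : ∑ b : Fin d × Fin d, (1 : Matrix (Fin d) (Fin d) ℝ) a.1 b.2 *
      (1 : Matrix (Fin d) (Fin d) ℝ) a.2 b.1 * M b = M (a.2, a.1) := by
    simp [Fintype.sum_prod_type, Matrix.one_apply]
  unfold featureKernel
  split_ifs
  · simp only [add_mul, Finset.sum_add_distrib, e1, e2, e3]
  · simp only [add_zero, e1]

theorem sum_sq_swap (M : Fin d × Fin d → ℝ) : ∑ a : Fin d × Fin d, M (a.2, a.1) ^ 2 =
    ∑ a, M a ^ 2 :=
  (Equiv.prodComm (Fin d) (Fin d)).sum_comp fun a => M a ^ 2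

theorem sum_diag_sq_le (M : Fin d × Fin d → ℝ) : ∑ i, M (i, i) ^ 2 ≤ ∑ a, M a ^ 2 := by
  rw [Fintype.sum_prod_type]
  exact Finset.sum_le_sum fun i _ =>
    Finset.single_le_sum (f := fun j => M (i, j) ^ 2) (fun j _ => sq_nonneg _) (Finset.mem_univ i)

theorem sq_sum_le_card_mul (f : Fin d → ℝ) : (∑ i, f i) ^ 2 ≤ d * ∑ i, f i ^ 2 := by
  simpa using sq_sum_le_card_mul_sum_sq (s := Finset.univ) (f := f)

/-- The operator has Frobenius norm at most `3 d`; the worst term is `tr(M) I`, of squared norm `d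
(tr M)² ≤ d² ‖M‖²`. -/
theorem sum_sq_featureKernel_le [NeZero d] (h : ℕ) (M : Fin d × Fin d → ℝ) :
    ∑ a, (∑ b, featureKernel h a b * M b) ^ 2 ≤ 9 * (d : ℝ) ^ 2 * ∑ a, M a ^ 2 := by
  have hd : (1 : ℝ) ≤ d := by exact_mod_cast Nat.one_le_iff_ne_zero.2 (NeZero.ne d)
  have hM : 0 ≤ ∑ a, M a ^ 2 := Finset.sum_nonneg fun _ _ => sq_nonneg _
  have hd2 : (1 : ℝ) ≤ (d : ℝ) ^ 2 := one_le_pow₀ hd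
  simp_rw [sum_featureKernel_mul]
  split_ifs
  · have h1 : ∀ a : Fin d × Fin d,
        (M a + ((1 : Matrix (Fin d) (Fin d) ℝ) a.1 a.2 * ∑ i, M (i, i) + M (a.2, a.1))) ^ 2 ≤
        3 * (M a ^ 2 + (1 : Matrix (Fin d) (Fin d) ℝ) a.1 a.2 * (∑ i, M (i, i)) ^ 2
          + M (a.2, a.1) ^ 2) := by
      intro a
      rw [Matrix.one_apply]
      split_ifs
      · nlinarith [sq_nonneg (M a - ∑ i, M (i, i)), sq_nonneg (M a - M (a.2, a.1)),
          sq_nonneg (∑ i, M (i, i) - M (a.2, a.1))]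
      · nlinarith [sq_nonneg (M a - M (a.2, a.1)), sq_nonneg (M a), sq_nonneg (M (a.2, a.1))]
    have h2 : ∑ a : Fin d × Fin d, (1 : Matrix (Fin d) (Fin d) ℝ) a.1 a.2 = d := by
      rw [Fintype.sum_prod_type]
      simp [Matrix.one_apply]
    refine (Finset.sum_le_sum fun a _ => h1 a).trans ?_
    rw [← Finset.mul_sum, Finset.sum_add_distrib, Finset.sum_add_distrib, sum_sq_swap,
      ← Finset.sum_mul, h2]
    have h3 : (∑ i, M (i, i)) ^ 2 ≤ d * ∑ a, M a ^ 2 :=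
      (sq_sum_le_card_mul _).trans (mul_le_mul_of_nonneg_left (sum_diag_sq_le M) (by positivity))
    have h4 : (d : ℝ) * (∑ i, M (i, i)) ^ 2 ≤ d * (d * ∑ a, M a ^ 2) :=
      mul_le_mul_of_nonneg_left h3 (by positivity)
    nlinarith
  · simp only [add_zero]
    nlinarith

/-- Identifiability of the regression. For `h = 0` and symmetric `M` the form is `2 ‖M‖² + (tr M)²`.
Symmetry cannot be dropped there, since the operator annihilates antisymmetric matrices. -/
theorem sum_sq_le_featureKernel (h : ℕ) (M : Fin d × Fin d → ℝ)
    (hM : h = 0 → ∀ i j, M (i, j) = M (j, i)) :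
    ∑ a, M a ^ 2 ≤ ∑ a, M a * ∑ b, featureKernel h a b * M b := by
  simp_rw [sum_featureKernel_mul]
  split_ifs with h0
  · have e1 : ∀ a : Fin d × Fin d,
        M a * (M a + ((1 : Matrix (Fin d) (Fin d) ℝ) a.1 a.2 * ∑ i, M (i, i) + M (a.2, a.1))) =
        M a ^ 2 + (M a * (1 : Matrix (Fin d) (Fin d) ℝ) a.1 a.2) * (∑ i, M (i, i))
          + M a ^ 2 := by
      intro a
      rw [hM h0 a.2 a.1]
      ring
    have e2 : ∑ a : Fin d × Fin d, M a * (1 : Matrix (Fin d) (Fin d) ℝ) a.1 a.2 =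
        ∑ i, M (i, i) := by
      simp [Fintype.sum_prod_type, Matrix.one_apply]
    simp_rw [e1]
    rw [Finset.sum_add_distrib, Finset.sum_add_distrib, ← Finset.sum_mul, e2]
    have : 0 ≤ ∑ a, M a ^ 2 := Finset.sum_nonneg fun _ _ => sq_nonneg _
    nlinarith [mul_self_nonneg (∑ i, M (i, i))]
  · refine Finset.sum_le_sum fun a _ => ?_
    rw [add_zero, sq]

end FeatureKernel

-- Propagation of state deviations, and fourth and eighth moment bounds.

/-- The eighth moment of the standard Gaussian distribution. -/
noncomputable def gaussianEighthMoment : ℝ := ∫ z : ℝ, z ^ 8 ∂gaussianReal 0 1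

theorem gaussianEighthMoment_nonneg : 0 ≤ gaussianEighthMoment :=
  integral_nonneg fun z => by positivity

namespace IsRegressionModel

open Matrix

variable {d : ℕ} {Ω : Type*} [mΩ : MeasurableSpace Ω] {P : Measure Ω} [IsProbabilityMeasure P]
  {A W S : Matrix (Fin d) (Fin d) ℝ} {σ : NNReal}
  {x w β : ℕ → Ω → EuclideanSpace ℝ (Fin d)} {ε y : ℕ → Ω → ℝ}

/-- The matrix of correlations of `X` with the deviations of the lag-`h` products of the state at
time `s` from their stationary means. -/
noncomputable def devCorr (P : Measure Ω) (A S : Matrix (Fin d) (Fin d) ℝ)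
    (β : ℕ → Ω → EuclideanSpace ℝ (Fin d)) (X : Ω → ℝ) (h s : ℕ) : Matrix (Fin d) (Fin d) ℝ :=
  Matrix.of fun i j => ∫ ω, X ω * (β (s + h) ω i * β s ω j - (A ^ h * S) i j) ∂P

theorem hasMoments_state_of_le (H : IsRegressionModel P A W S σ x w β ε y) (hW : W.PosSemidef)
    (hS : S.PosSemidef) {t n : ℕ} (h : t ≤ n) (i : Fin d) :
    HasMoments P (iSupOn (sourceSigma x w β ε) (stateIdx n)) (fun ω => β t ω i) :=
  (H.hasMoments_state hW hS t i).mono (iSupOn_mono _ (stateIdx_mono h))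

theorem integral_w (H : IsRegressionModel P A W S σ x w β ε y) (hW : W.PosSemidef) (t : ℕ)
    (i : Fin d) : ∫ ω, w t ω i ∂P = 0 :=
  (hasGaussianCoords_of_hasLaw hW (H.law_w t)).integral_eq_zero i

theorem integral_mul_w (H : IsRegressionModel P A W S σ x w β ε y) (hW : W.PosSemidef) (t : ℕ)
    {X : Ω → ℝ} (hX : HasMoments P (iSupOn (sourceSigma x w β ε) (stateIdx t)) X) (i : Fin d) :
    ∫ ω, X ω * w t ω i ∂P = 0 := by
  rw [H.integral_mul_of_disjoint (disjoint_stateIdx_innovIdx t) hX (H.hasMoments_w hW t i),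
    H.integral_w hW, mul_zero]

/-- In `β (s+h+1) = A β (s+h) + w (s+h)`, the innovation is centred and independent of `X` and `β
s`, so only the factor `A` remains. -/
theorem devCorr_lag_succ (H : IsRegressionModel P A W S σ x w β ε y) (hW : W.PosSemidef)
    (hS : S.PosSemidef) {X : Ω → ℝ} {s : ℕ}
    (hX : HasMoments P (iSupOn (sourceSigma x w β ε) (stateIdx s)) X) (h : ℕ) :
    devCorr P A S β X (h + 1) s = A * devCorr P A S β X h s := by
  ext i j
  have hX' := hX.mono (iSupOn_mono (sourceSigma x w β ε) (stateIdx_mono (Nat.le_add_right s h)))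
  have hβ : ∀ t ≤ s + h, ∀ i, HasMoments P (iSupOn (sourceSigma x w β ε) (stateIdx (s + h)))
      (fun ω => β t ω i) := fun t ht i => H.hasMoments_state_of_le hW hS ht i
  have hT : ∀ k, HasMoments P (iSupOn (sourceSigma x w β ε) (stateIdx (s + h)))
      (fun ω => A i k * (X ω * (β (s + h) ω k * β s ω j - (A ^ h * S) k j))) := fun k =>
    (hX'.mul (((hβ _ le_rfl k).mul (hβ s (Nat.le_add_right s h) j)).sub
      (HasMoments.const _))).const_mul _
  have hXβ : HasMoments P (iSupOn (sourceSigma x w β ε) (stateIdx (s + h)))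
      (fun ω => X ω * β s ω j) := hX'.mul (hβ s (Nat.le_add_right s h) j)
  have e : ∀ ω, X ω * (β (s + (h + 1)) ω i * β s ω j - (A ^ (h + 1) * S) i j) =
      ∑ k, A i k * (X ω * (β (s + h) ω k * β s ω j - (A ^ h * S) k j))
        + (X ω * β s ω j) * w (s + h) ω i := by
    intro ω
    have e1 : (A ^ (h + 1) * S) i j = ∑ k, A i k * (A ^ h * S) k j := by
      rw [pow_succ', Matrix.mul_assoc, Matrix.mul_apply]
    have e2 : ∑ k, A i k * (X ω * (β (s + h) ω k * β s ω j - (A ^ h * S) k j)) =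
        X ω * β s ω j * (∑ k, A i k * β (s + h) ω k) - X ω * ∑ k, A i k * (A ^ h * S) k j := by
      rw [Finset.mul_sum, Finset.mul_sum, ← Finset.sum_sub_distrib]
      exact Finset.sum_congr rfl fun k _ => by ring
    rw [e1, e2, ← add_assoc, H.state_succ]
    ring
  simp only [devCorr, Matrix.of_apply, Matrix.mul_apply]
  simp_rw [← Matrix.mul_apply, e]
  rw [integral_add (HasMoments.sum _ fun k _ => hT k).integrable ((hXβ.mono (H.iSupOn_le _)).mul
      ((H.hasMoments_w hW (s + h) i).mono (H.iSupOn_le _))).integrable,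
    H.integral_mul_w hW _ hXβ, add_zero, integral_finsetSum _ fun k _ => (hT k).integrable]
  exact Finset.sum_congr rfl fun k _ => integral_const_mul _ _

/-- Expanding both factors of `β (s+1)`, the cross terms with `w s` vanish. The term quadratic in `w
s` has mean `W`, exactly the amount by which `S` exceeds `A S Aᵀ`. -/
theorem devCorr_time_succ (H : IsRegressionModel P A W S σ x w β ε y) (hW : W.PosSemidef)
    (hS : IsStationaryCov A W S) {X : Ω → ℝ} {s : ℕ}
    (hX : HasMoments P (iSupOn (sourceSigma x w β ε) (stateIdx s)) X) :
    devCorr P A S β X 0 (s + 1) = A * devCorr P A S β X 0 s * Aᵀ := by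
  ext i j
  have hβ : ∀ i, HasMoments P (iSupOn (sourceSigma x w β ε) (stateIdx s)) (fun ω => β s ω i) :=
    H.hasMoments_state hW hS.posSemidef s
  have hw := H.hasMoments_w hW s
  have hXβ : ∀ i, HasMoments P (iSupOn (sourceSigma x w β ε) (stateIdx s))
      (fun ω => X ω * β s ω i) := fun i => hX.mul (hβ i)
  have hT : ∀ k l, HasMoments P mΩ
      (fun ω => A i k * A j l * (X ω * (β s ω k * β s ω l - S k l))) := fun k l =>
    ((hX.mul (((hβ k).mul (hβ l)).sub (HasMoments.const _))).const_mul _).mono (H.iSupOn_le _)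
  have hX0 := hX.mono (H.iSupOn_le _)
  have hβ0 := fun i => (hβ i).mono (H.iSupOn_le _)
  have hw0 := fun i => (hw i).mono (H.iSupOn_le _)
  have hXβ0 := fun i => (hXβ i).mono (H.iSupOn_le _)
  have hU : ∀ i j k, HasMoments P mΩ (fun ω => A i k * ((X ω * β s ω k) * w s ω j)) :=
    fun i j k => ((hXβ0 k).mul (hw0 j)).const_mul _
  have hU0 : ∀ i j k, ∫ ω, A i k * ((X ω * β s ω k) * w s ω j) ∂P = 0 := by
    intro i j k
    rw [integral_const_mul, H.integral_mul_w hW s (hXβ k), mul_zero]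
  have hww : HasMoments P (iSupOn (sourceSigma x w β ε) (innovIdx s))
      (fun ω => w s ω i * w s ω j - W i j) := ((hw i).mul (hw j)).sub (HasMoments.const _)
  have hww0 : ∫ ω, (w s ω i * w s ω j - W i j) ∂P = 0 := by
    rw [integral_sub ((hw i).mul (hw j)).integrable (integrable_const _),
      (hasGaussianCoords_of_hasLaw hW (H.law_w s)).integral_mul hW
        (fun i => (hw0 i).measurable)]
    simp
  have e : ∀ ω, X ω * (β (s + 1) ω i * β (s + 1) ω j - S i j) =
      ((∑ k, ∑ l, A i k * A j l * (X ω * (β s ω k * β s ω l - S k l))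
        + ∑ k, A i k * ((X ω * β s ω k) * w s ω j))
        + ∑ k, A j k * ((X ω * β s ω k) * w s ω i)) + X ω * (w s ω i * w s ω j - W i j) := by
    intro ω
    have e1 : S i j = ∑ k, ∑ l, A i k * A j l * S k l + W i j := by
      conv_lhs => rw [hS.lyapunov]
      rw [Matrix.add_apply, Matrix.mul_apply]
      simp only [Matrix.mul_apply, Matrix.transpose_apply, Finset.sum_mul]
      rw [Finset.sum_comm]
      congr 1
      exact Finset.sum_congr rfl fun k _ => Finset.sum_congr rfl fun l _ => by ring
    have e2 : ∑ k, ∑ l, A i k * A j l * (X ω * (β s ω k * β s ω l - S k l)) =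
        X ω * ((∑ k, A i k * β s ω k) * ∑ l, A j l * β s ω l) -
          X ω * ∑ k, ∑ l, A i k * A j l * S k l := by
      rw [Finset.sum_mul_sum]
      simp only [Finset.mul_sum, ← Finset.sum_sub_distrib]
      exact Finset.sum_congr rfl fun k _ => Finset.sum_congr rfl fun l _ => by ring
    have e3 : ∀ i j, ∑ k, A i k * ((X ω * β s ω k) * w s ω j) =
        X ω * w s ω j * ∑ k, A i k * β s ω k := by
      intro i j
      rw [Finset.mul_sum]
      exact Finset.sum_congr rfl fun k _ => by ring
    rw [e1, e2, e3, e3, H.state_succ, H.state_succ]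
    ring
  have hlhs : devCorr P A S β X 0 (s + 1) i j =
      ∫ ω, X ω * (β (s + 1) ω i * β (s + 1) ω j - S i j) ∂P := by
    simp [devCorr]
  have hrhs : (A * devCorr P A S β X 0 s * Aᵀ) i j =
      ∑ k, ∑ l, A i k * A j l * ∫ ω, X ω * (β s ω k * β s ω l - S k l) ∂P := by
    rw [Matrix.mul_apply]
    simp only [Matrix.mul_apply, Matrix.transpose_apply, Finset.sum_mul, devCorr, pow_zero,
      add_zero, Matrix.of_apply]
    rw [Finset.sum_comm]
    refine Finset.sum_congr rfl fun k _ => Finset.sum_congr rfl fun l _ => ?_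
    simp only [← Matrix.mul_apply, Matrix.one_mul]
    ring
  rw [hlhs, hrhs]
  simp_rw [e]
  have hs1 : HasMoments P mΩ
      (fun ω => ∑ k, ∑ l, A i k * A j l * (X ω * (β s ω k * β s ω l - S k l))) :=
    HasMoments.sum _ fun k _ => HasMoments.sum _ fun l _ => hT k l
  have hs2 : ∀ i j, HasMoments P mΩ (fun ω => ∑ k, A i k * ((X ω * β s ω k) * w s ω j)) :=
    fun i j => HasMoments.sum _ fun k _ => hU i j k
  rw [integral_add ((hs1.add (hs2 i j)).add (hs2 j i)).integrable
      (hX0.mul (hww.mono (H.iSupOn_le _))).integrable,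
    integral_add (hs1.add (hs2 i j)).integrable (hs2 j i).integrable,
    integral_add hs1.integrable (hs2 i j).integrable,
    integral_finsetSum _ fun k _ => (hU i j k).integrable,
    integral_finsetSum _ fun k _ => (hU j i k).integrable,
    H.integral_mul_of_disjoint (disjoint_stateIdx_innovIdx s) hX hww, hww0,
    integral_finsetSum _ fun k _ => (HasMoments.sum _ fun l _ => hT k l).integrable]
  simp only [hU0, Finset.sum_const_zero, add_zero, mul_zero]
  refine Finset.sum_congr rfl fun k _ => ?_
  rw [integral_finsetSum _ fun l _ => (hT k l).integrable]
  exact Finset.sum_congr rfl fun l _ => integral_const_mul _ _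

/-- Move `k` steps in time at lag zero, then `h` steps in lag. The two-sided action of `A ^ k` is
the source of the decay rate `γ ^ (2k)`. -/
theorem devCorr_eq (H : IsRegressionModel P A W S σ x w β ε y) (hW : W.PosSemidef)
    (hS : IsStationaryCov A W S) {X : Ω → ℝ} {s : ℕ}
    (hX : HasMoments P (iSupOn (sourceSigma x w β ε) (stateIdx s)) X) (h k : ℕ) :
    devCorr P A S β X h (s + k) = A ^ (h + k) * devCorr P A S β X 0 s * (A ^ k)ᵀ := by
  have h0 : devCorr P A S β X 0 (s + k) = A ^ k * devCorr P A S β X 0 s * (A ^ k)ᵀ := by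
    induction k with
    | zero => simp
    | succ k ih =>
      rw [← add_assoc, H.devCorr_time_succ hW hS
        (hX.mono (iSupOn_mono _ (stateIdx_mono (Nat.le_add_right s k)))), ih, pow_succ',
        Matrix.transpose_mul]
      simp only [Matrix.mul_assoc]
  induction h with
  | zero => rw [h0, zero_add]
  | succ h ih =>
    rw [H.devCorr_lag_succ hW hS.posSemidef
      (hX.mono (iSupOn_mono _ (stateIdx_mono (Nat.le_add_right s k)))), ih,
      show h + 1 + k = (h + k) + 1 by ring, pow_succ']
    simp only [Matrix.mul_assoc]

theorem integral_state_mul_state (H : IsRegressionModel P A W S σ x w β ε y) (hW : W.PosSemidef)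
    (hS : IsStationaryCov A W S) (h t : ℕ) (i j : Fin d) :
    ∫ ω, β (t + h) ω i * β t ω j ∂P = (A ^ h * S) i j := by
  have hβ : ∀ t i, HasMoments P mΩ (fun ω => β t ω i) := fun t i =>
    (H.hasMoments_state hW hS.posSemidef t i).mono (H.iSupOn_le _)
  have h0 : devCorr P A S β (fun _ => 1) 0 t = 0 := by
    ext i j
    simp only [devCorr, add_zero, pow_zero, one_mul, Matrix.of_apply, Matrix.zero_apply]
    rw [integral_sub ((hβ t i).mul (hβ t j)).integrable (integrable_const _),
      (H.gaussian_state hW hS t).integral_mul hS.posSemidef (fun i => (hβ t i).measurable)]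
    simp
  -- With `X = 1` the lag-zero correlation vanishes by stationarity, hence so does the one at every
  -- lag.
  have h1 := H.devCorr_eq hW hS (X := fun _ => 1) (s := t) (HasMoments.const 1) h 0
  rw [h0, Matrix.mul_zero, Matrix.zero_mul] at h1
  have h2 := congrFun (congrFun h1 i) j
  simp only [devCorr, add_zero, one_mul, Matrix.of_apply, Matrix.zero_apply] at h2
  rw [integral_sub ((hβ _ i).mul (hβ t j)).integrable (integrable_const _)] at h2
  simp only [integral_const, probReal_univ, smul_eq_mul, one_mul] at h2
  linarith

theorem integral_sum_sq_state_sq_le (H : IsRegressionModel P A W S σ x w β ε y)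
    (hW : W.PosSemidef) (hS : IsStationaryCov A W S) (t : ℕ) :
    ∫ ω, (∑ i, β t ω i ^ 2) ^ 2 ∂P ≤ 3 * (d : ℝ) ^ 2 * opNorm S ^ 2 := by
  have hβ : ∀ i, HasMoments P mΩ (fun ω => β t ω i) := fun i =>
    (H.hasMoments_state hW hS.posSemidef t i).mono (H.iSupOn_le _)
  -- Cauchy–Schwarz over coordinates reduces to the one-dimensional fourth moments `3 (S i i)²`, at
  -- the cost of a factor `d`.
  have h1 : ∫ ω, (∑ i, β t ω i ^ 2) ^ 2 ∂P ≤ ∫ ω, d * ∑ i, β t ω i ^ 4 ∂P := by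
    refine integral_mono ((HasMoments.sum _ fun i _ => (hβ i).pow 2).pow 2).integrable
      ((HasMoments.sum _ fun i _ => (hβ i).pow 4).const_mul _).integrable fun ω => ?_
    have h2 := sq_sum_le_card_mul fun i => β t ω i ^ 2
    simp only [← pow_mul] at h2
    exact h2
  refine h1.trans ?_
  rw [integral_const_mul, integral_finsetSum _ fun i _ => ((hβ i).pow 4).integrable]
  have h2 : ∀ i, ∫ ω, β t ω i ^ 4 ∂P ≤ 3 * opNorm S ^ 2 := by
    intro i
    rw [(H.gaussian_state hW hS t).integral_pow_four hS.posSemidef i]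
    have := pow_le_pow_left₀ (abs_nonneg _) (abs_diag_le_opNorm S i) 2
    rw [sq_abs] at this
    linarith
  calc (d : ℝ) * ∑ i, ∫ ω, β t ω i ^ 4 ∂P ≤ d * ∑ i : Fin d, 3 * opNorm S ^ 2 := by
        gcongr with i
        exact h2 i
    _ = _ := by
        simp
        ring

/-- The total variance of the products of the coordinates of the states at times `t + h`
and `t`. -/
theorem sum_integral_dev_sq_le (H : IsRegressionModel P A W S σ x w β ε y)
    (hW : W.PosSemidef) (hS : IsStationaryCov A W S) (h t : ℕ) :
    ∫ ω, ∑ a : Fin d × Fin d, (β (t + h) ω a.1 * β t ω a.2 - (A ^ h * S) a.1 a.2) ^ 2 ∂P ≤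
      3 * (d : ℝ) ^ 2 * opNorm S ^ 2 := by
  have hβ : ∀ t i, HasMoments P mΩ (fun ω => β t ω i) := fun t i =>
    (H.hasMoments_state hW hS.posSemidef t i).mono (H.iSupOn_le _)
  rw [integral_finsetSum _ fun a _ =>
    ((((hβ _ _).mul (hβ _ _)).sub (HasMoments.const _)).pow 2).integrable]
  have h1 : ∑ a : Fin d × Fin d,
      ∫ ω, (β (t + h) ω a.1 * β t ω a.2 - (A ^ h * S) a.1 a.2) ^ 2 ∂P ≤
      ∑ a : Fin d × Fin d, ∫ ω, (β (t + h) ω a.1 * β t ω a.2) ^ 2 ∂P :=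
    Finset.sum_le_sum fun a _ => ((hβ _ _).mul (hβ _ _)).integral_sub_sq_le
      (H.integral_state_mul_state hW hS h t a.1 a.2)
  refine h1.trans ?_
  rw [← integral_finsetSum _ fun a _ => (((hβ _ _).mul (hβ _ _)).pow 2).integrable]
  have e : ∀ ω, ∑ a : Fin d × Fin d, (β (t + h) ω a.1 * β t ω a.2) ^ 2 =
      (∑ i, β (t + h) ω i ^ 2) * ∑ i, β t ω i ^ 2 := by
    intro ω
    simp_rw [Fintype.sum_prod_type, Finset.sum_mul_sum, mul_pow]
  simp_rw [e]
  refine (HasMoments.integral_mul_le_add_div_two (HasMoments.sum _ fun i _ => (hβ _ i).pow 2)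
    (HasMoments.sum _ fun i _ => (hβ _ i).pow 2)).trans ?_
  have := H.integral_sum_sq_state_sq_le hW hS t
  have := H.integral_sum_sq_state_sq_le hW hS (t + h)
  linarith

theorem hasMoments_x' (H : IsRegressionModel P A W S σ x w β ε y) (t : ℕ) (i : Fin d) :
    HasMoments P mΩ (fun ω => x t ω i) :=
  (H.hasMoments_x (Set.mem_univ t) i).mono (H.iSupOn_le _)

theorem hasMoments_ε' (H : IsRegressionModel P A W S σ x w β ε y) (t : ℕ) :
    HasMoments P mΩ (ε t) :=
  (H.hasMoments_ε (Set.mem_univ t)).mono (H.iSupOn_le _)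

theorem integral_sum_sq_x_sq_le (H : IsRegressionModel P A W S σ x w β ε y) (t : ℕ) :
    ∫ ω, (∑ i, x t ω i ^ 2) ^ 2 ∂P ≤ 3 * (d : ℝ) ^ 2 := by
  have hx := H.hasMoments_x' t
  have h1 : ∫ ω, (∑ i, x t ω i ^ 2) ^ 2 ∂P ≤ ∫ ω, d * ∑ i, x t ω i ^ 4 ∂P := by
    refine integral_mono ((HasMoments.sum _ fun i _ => (hx i).pow 2).pow 2).integrable
      ((HasMoments.sum _ fun i _ => (hx i).pow 4).const_mul _).integrable fun ω => ?_
    have h2 := sq_sum_le_card_mul fun i => x t ω i ^ 2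
    simp only [← pow_mul] at h2
    exact h2
  refine h1.trans_eq ?_
  rw [integral_const_mul, integral_finsetSum _ fun i _ => ((hx i).pow 4).integrable]
  simp_rw [(H.gaussian_x t).integral_pow_four Matrix.PosSemidef.one]
  simp
  ring

theorem integral_sum_sq_x_pow_four_le (H : IsRegressionModel P A W S σ x w β ε y) (t : ℕ) :
    ∫ ω, (∑ i, x t ω i ^ 2) ^ 4 ∂P ≤ gaussianEighthMoment * (d : ℝ) ^ 4 := by
  have hx := H.hasMoments_x' t
  have h1 : ∫ ω, (∑ i, x t ω i ^ 2) ^ 4 ∂P ≤ ∫ ω, (d : ℝ) ^ 3 * ∑ i, x t ω i ^ 8 ∂P := by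
    refine integral_mono ((HasMoments.sum _ fun i _ => (hx i).pow 2).pow 4).integrable
      ((HasMoments.sum _ fun i _ => (hx i).pow 8).const_mul _).integrable fun ω => ?_
    have h2 := sq_sum_le_card_mul fun i => x t ω i ^ 2
    have h3 := sq_sum_le_card_mul fun i => x t ω i ^ 4
    simp only [← pow_mul] at h2 h3
    calc (∑ i, x t ω i ^ 2) ^ 4 = ((∑ i, x t ω i ^ 2) ^ 2) ^ 2 := by rw [← pow_mul]
      _ ≤ (d * ∑ i, x t ω i ^ 4) ^ 2 := pow_le_pow_left₀ (sq_nonneg _) h2 2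
      _ = (d : ℝ) ^ 2 * (∑ i, x t ω i ^ 4) ^ 2 := mul_pow _ _ _
      _ ≤ (d : ℝ) ^ 2 * (d * ∑ i, x t ω i ^ 8) := mul_le_mul_of_nonneg_left h3 (by positivity)
      _ = _ := by ring
  refine h1.trans_eq ?_
  rw [integral_const_mul, integral_finsetSum _ fun i _ => ((hx i).pow 8).integrable]
  simp_rw [(H.gaussian_x t).integral_pow]
  simp [gaussianEighthMoment]
  ring

/-- The fourth moment of `⟨x, β⟩`, weighted by the covariates. -/
theorem integral_signal_pow_four_le (H : IsRegressionModel P A W S σ x w β ε y)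
    (hW : W.PosSemidef) (hS : IsStationaryCov A W S) (t : ℕ) :
    ∫ ω, (∑ i, x t ω i * β t ω i) ^ 4 * (∑ i, x t ω i ^ 2) ^ 2 ∂P ≤
      3 * opNorm S ^ 2 * (gaussianEighthMoment * (d : ℝ) ^ 4) := by
  have hx := H.hasMoments_x' t
  have hβ : ∀ i, HasMoments P mΩ (fun ω => β t ω i) := fun i =>
    (H.hasMoments_state hW hS.posSemidef t i).mono (H.iSupOn_le _)
  have hind : IndepFun (fun ω i => x t ω i) (fun ω i => β t ω i) P := by
    rw [IndepFun_iff_Indep]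
    refine indep_of_indep_of_le_left (indep_of_indep_of_le_right
      (H.indep_of_disjoint (disjoint_stateIdx_covIdx t Set.univ).symm) ?_) ?_
    · exact Measurable.comap_le (@measurable_pi_lambda _ _ _ (_) _ _ fun i =>
        (H.hasMoments_state hW hS.posSemidef t i).measurable)
    · exact Measurable.comap_le (@measurable_pi_lambda _ _ _ (_) _ _ fun i =>
        (H.hasMoments_x (Set.mem_univ t) i).measurable)
  have hxm : Measurable (fun ω i => x t ω i) := measurable_pi_lambda _ fun i => (hx i).measurable
  have hβm : Measurable (fun ω i => β t ω i) := measurable_pi_lambda _ fun i => (hβ i).measurable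
  have hq : HasMoments P mΩ (fun ω => ∑ i, x t ω i ^ 2) := HasMoments.sum _ fun i _ => (hx i).pow 2
  have h1 := integral_comp_of_indepFun hxm hβm hind
    (f := fun z : (Fin d → ℝ) × (Fin d → ℝ) => (∑ i, z.1 i * z.2 i) ^ 4 * (∑ i, z.1 i ^ 2) ^ 2)
    (by fun_prop)
    (((HasMoments.sum _ fun i _ => (hx i).mul (hβ i)).pow 4).mul (hq.pow 2)).integrable
  simp only at h1
  rw [h1]
  -- With the covariate frozen at `u`, the signal is a centred Gaussian of variance `u ⬝ᵥ S *ᵥ u ≤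
  -- ‖S‖ |u|²`. Together with the weight this leaves the eighth power of `|x|`.
  have h2 : ∀ u : Fin d → ℝ,
      ∫ ω', (∑ i, u i * β t ω' i) ^ 4 * (∑ i, u i ^ 2) ^ 2 ∂P ≤
        3 * opNorm S ^ 2 * (∑ i, u i ^ 2) ^ 4 := by
    intro u
    rw [integral_mul_const, (H.gaussian_state hW hS t).integral_linear_pow_four hS.posSemidef]
    have h3 := sq_dotProduct_mulVec_le S u u
    calc 3 * (u ⬝ᵥ S *ᵥ u) ^ 2 * (∑ i, u i ^ 2) ^ 2
        ≤ 3 * (opNorm S ^ 2 * (∑ i, u i ^ 2) * ∑ i, u i ^ 2) * (∑ i, u i ^ 2) ^ 2 := by gcongr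
      _ = _ := by ring
  have h4 : ∫ ω, ∫ ω', (∑ i, x t ω i * β t ω' i) ^ 4 * (∑ i, x t ω i ^ 2) ^ 2 ∂P ∂P ≤
      ∫ ω, 3 * opNorm S ^ 2 * (∑ i, x t ω i ^ 2) ^ 4 ∂P :=
    integral_mono_of_nonneg
      (Filter.Eventually.of_forall fun ω => integral_nonneg fun ω' => by positivity)
      ((hq.pow 4).const_mul _).integrable
      (Filter.Eventually.of_forall fun ω => h2 fun i => x t ω i)
  refine h4.trans ?_
  rw [integral_const_mul]
  have := H.integral_sum_sq_x_pow_four_le t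
  gcongr

end IsRegressionModel

-- Features, residuals and drift; averaging out covariates and observation noise.

/-- The features `x (t + h) i * x t j` of the least squares problems. -/
def lagFeature {d : ℕ} {Ω : Type*} (x : ℕ → Ω → EuclideanSpace ℝ (Fin d)) (h t : ℕ)
    (a : Fin d × Fin d) (ω : Ω) : ℝ :=
  x (t + h) ω a.1 * x t ω a.2

/-- The residual of the least squares problem of lag `h` at the true lag-`h` covariance. -/
noncomputable def lagResidual {d : ℕ} {Ω : Type*} (A S : Matrix (Fin d) (Fin d) ℝ) (σ : ℝ)
    (x : ℕ → Ω → EuclideanSpace ℝ (Fin d)) (y : ℕ → Ω → ℝ) (h t : ℕ) (ω : Ω) : ℝ :=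
  y t ω * y (t + h) ω - ∑ a : Fin d × Fin d, (A ^ h * S) a.1 a.2 * lagFeature x h t a ω -
    if h = 0 then σ ^ 2 else 0

/-- The deviation of the products of states at times `t + h` and `t` from their means. -/
noncomputable def lagDev {d : ℕ} {Ω : Type*} (A S : Matrix (Fin d) (Fin d) ℝ)
    (β : ℕ → Ω → EuclideanSpace ℝ (Fin d)) (h t : ℕ) (a : Fin d × Fin d) (ω : Ω) : ℝ :=
  β (t + h) ω a.1 * β t ω a.2 - (A ^ h * S) a.1 a.2

/-- The conditional expectation of residual times feature given the states. -/
noncomputable def lagDrift {d : ℕ} {Ω : Type*} (A S : Matrix (Fin d) (Fin d) ℝ)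
    (β : ℕ → Ω → EuclideanSpace ℝ (Fin d)) (h t : ℕ) (a : Fin d × Fin d) (ω : Ω) : ℝ :=
  ∑ b, featureKernel h a b * lagDev A S β h t b ω

namespace IsRegressionModel

open Matrix

variable {d : ℕ} {Ω : Type*} [mΩ : MeasurableSpace Ω] {P : Measure Ω} [IsProbabilityMeasure P]
  {A W S : Matrix (Fin d) (Fin d) ℝ} {σ : NNReal}
  {x w β : ℕ → Ω → EuclideanSpace ℝ (Fin d)} {ε y : ℕ → Ω → ℝ}

theorem hasMoments_feature (H : IsRegressionModel P A W S σ x w β ε y) {D : Set ℕ} {h t : ℕ}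
    (ht : t ∈ D) (hth : t + h ∈ D) (a : Fin d × Fin d) :
    HasMoments P (iSupOn (sourceSigma x w β ε) (covIdx D)) (lagFeature x h t a) :=
  (H.hasMoments_x hth a.1).mul (H.hasMoments_x ht a.2)

theorem hasMoments_dev (H : IsRegressionModel P A W S σ x w β ε y) (hW : W.PosSemidef)
    (hS : S.PosSemidef) {h t n : ℕ} (hn : t + h ≤ n) (a : Fin d × Fin d) :
    HasMoments P (iSupOn (sourceSigma x w β ε) (stateIdx n)) (lagDev A S β h t a) :=
  ((H.hasMoments_state_of_le hW hS hn _).mul (H.hasMoments_state_of_le hW hS (by omega) _)).sub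
    (HasMoments.const _)

theorem hasMoments_drift (H : IsRegressionModel P A W S σ x w β ε y) (hW : W.PosSemidef)
    (hS : S.PosSemidef) {h t n : ℕ} (hn : t + h ≤ n) (a : Fin d × Fin d) :
    HasMoments P (iSupOn (sourceSigma x w β ε) (stateIdx n)) (lagDrift A S β h t a) :=
  HasMoments.sum _ fun b _ => (H.hasMoments_dev hW hS hn b).const_mul _

theorem hasMoments_y (H : IsRegressionModel P A W S σ x w β ε y) (hW : W.PosSemidef)
    (hS : S.PosSemidef) {t n : ℕ} {D : Set ℕ} (hn : t ≤ n) (ht : t ∈ D) :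
    HasMoments P (iSupOn (sourceSigma x w β ε) (stateIdx n ∪ obsIdx D)) (y t) := by
  have e : y t = fun ω => ∑ i, x t ω i * β t ω i + ε t ω := funext (H.observation_eq t)
  rw [e]
  refine (HasMoments.sum _ fun i _ => ((H.hasMoments_x ht i).mono ?_).mul
    ((H.hasMoments_state_of_le hW hS hn i).mono ?_)).add ((H.hasMoments_ε ht).mono ?_)
  · exact iSupOn_mono _ (Set.subset_union_left.trans Set.subset_union_right)
  · exact iSupOn_mono _ Set.subset_union_left
  · exact iSupOn_mono _ (Set.subset_union_right.trans Set.subset_union_right)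

theorem hasMoments_residual (H : IsRegressionModel P A W S σ x w β ε y) (hW : W.PosSemidef)
    (hS : S.PosSemidef) {h t n : ℕ} {D : Set ℕ} (hn : t + h ≤ n) (ht : t ∈ D) (hth : t + h ∈ D) :
    HasMoments P (iSupOn (sourceSigma x w β ε) (stateIdx n ∪ obsIdx D))
      (lagResidual A S σ x y h t) :=
  (((H.hasMoments_y hW hS (by omega) ht).mul (H.hasMoments_y hW hS hn hth)).sub
    (HasMoments.sum _ fun a _ => ((H.hasMoments_feature ht hth a).mono (iSupOn_mono _
      (Set.subset_union_left.trans Set.subset_union_right))).const_mul _)).sub (HasMoments.const _)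

theorem hasMoments_score (H : IsRegressionModel P A W S σ x w β ε y) (hW : W.PosSemidef)
    (hS : S.PosSemidef) {h t n : ℕ} {D : Set ℕ} (hn : t + h ≤ n) (ht : t ∈ D) (hth : t + h ∈ D)
    (a : Fin d × Fin d) :
    HasMoments P (iSupOn (sourceSigma x w β ε) (stateIdx n ∪ obsIdx D))
      (fun ω => lagResidual A S σ x y h t ω * lagFeature x h t a ω) :=
  (H.hasMoments_residual hW hS hn ht hth).mul ((H.hasMoments_feature ht hth a).mono (iSupOn_mono _
      (Set.subset_union_left.trans Set.subset_union_right)))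

theorem integral_ε (H : IsRegressionModel P A W S σ x w β ε y) (t : ℕ) : ∫ ω, ε t ω ∂P = 0 := by
  rw [(H.law_ε t).integral_eq, integral_id_gaussianReal]

theorem integral_ε_sq (H : IsRegressionModel P A W S σ x w β ε y) (t : ℕ) :
    ∫ ω, ε t ω ^ 2 ∂P = (σ : ℝ) ^ 2 := by
  refine ((H.law_ε t).integral_comp (f := fun z : ℝ => z ^ 2) (by fun_prop)).trans ?_
  rw [integral_sq_gaussianReal]
  simp

theorem integral_ε_pow_four (H : IsRegressionModel P A W S σ x w β ε y) (t : ℕ) :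
    ∫ ω, ε t ω ^ 4 ∂P = 3 * (σ : ℝ) ^ 4 := by
  refine ((H.law_ε t).integral_comp (f := fun z : ℝ => z ^ 4) (by fun_prop)).trans ?_
  rw [integral_pow_four_gaussianReal]
  simp [← pow_mul]

theorem integral_ε_mul_ε (H : IsRegressionModel P A W S σ x w β ε y) (t h : ℕ) :
    ∫ ω, ε t ω * ε (t + h) ω ∂P = if h = 0 then (σ : ℝ) ^ 2 else 0 := by
  split_ifs with h0
  · subst h0
    simp only [add_zero, ← sq, H.integral_ε_sq]
  · have hd : Disjoint ({t} : Set ℕ) {t + h} := by simp; omega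
    rw [H.integral_mul_of_disjoint (disjoint_noiseIdx hd) (H.hasMoments_ε (Set.mem_singleton _))
      (H.hasMoments_ε (Set.mem_singleton _)), H.integral_ε, zero_mul]

theorem integral_feature_mul_feature (H : IsRegressionModel P A W S σ x w β ε y) (h t : ℕ)
    (a b : Fin d × Fin d) :
    ∫ ω, lagFeature x h t a ω * lagFeature x h t b ω ∂P = featureKernel h a b := by
  unfold lagFeature featureKernel
  have hm : ∀ t i, Measurable (fun ω => x t ω i) := fun t i => (H.hasMoments_x' t i).measurable
  split_ifs with h0
  · subst h0
    have := (H.gaussian_x t).integral_mul_four (hm t) a.1 a.2 b.1 b.2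
    simp only [add_zero, ← mul_assoc, this]
    ring
  · have hd : Disjoint ({t + h} : Set ℕ) {t} := by simp; omega
    have e : ∀ ω, x (t + h) ω a.1 * x t ω a.2 * (x (t + h) ω b.1 * x t ω b.2) =
        (x (t + h) ω a.1 * x (t + h) ω b.1) * (x t ω a.2 * x t ω b.2) := by
      intro ω; ring
    simp_rw [e]
    have hx := fun t i => H.hasMoments_x (Set.mem_singleton t) i
    rw [H.integral_mul_of_disjoint (disjoint_covIdx hd) ((hx _ _).mul (hx _ _))
      ((hx _ _).mul (hx _ _)), (H.gaussian_x (t + h)).integral_mul PosSemidef.one (hm _),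
      (H.gaussian_x t).integral_mul PosSemidef.one (hm _), add_zero]

/-- Splits the residual into a state deviation paired with the features, two signal–noise cross
terms and a centred noise product. Only the first has nonzero mean, given the states, after
multiplication by a feature. -/
theorem residual_eq (H : IsRegressionModel P A W S σ x w β ε y) (h t : ℕ) (ω : Ω) :
    lagResidual A S σ x y h t ω =
      ((∑ b, lagDev A S β h t b ω * lagFeature x h t b ω
        + ∑ l, β t ω l * (ε (t + h) ω * x t ω l))
        + ∑ l, β (t + h) ω l * (ε t ω * x (t + h) ω l))
        + (ε t ω * ε (t + h) ω - if h = 0 then (σ : ℝ) ^ 2 else 0) := by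
  have e1 : ∑ b, lagDev A S β h t b ω * lagFeature x h t b ω =
      (∑ i, x (t + h) ω i * β (t + h) ω i) * (∑ i, x t ω i * β t ω i)
      - ∑ a : Fin d × Fin d, (A ^ h * S) a.1 a.2 * lagFeature x h t a ω := by
    rw [Finset.sum_mul_sum, ← Fintype.sum_prod_type', ← Finset.sum_sub_distrib]
    refine Finset.sum_congr rfl fun b _ => ?_
    unfold lagDev lagFeature
    ring
  have e2 : ∀ s r, ∑ l, β s ω l * (ε r ω * x s ω l) = ε r ω * ∑ i, x s ω i * β s ω i := by
    intro s r
    rw [Finset.mul_sum]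
    exact Finset.sum_congr rfl fun l _ => by ring
  rw [e1, e2, e2, lagResidual, H.observation_eq, H.observation_eq]
  ring

/-- Averaging over the covariates and the observation noise at the times `s` and `s + h` replaces
residual times feature by the drift. -/
theorem integral_mul_score (H : IsRegressionModel P A W S σ x w β ε y) (hW : W.PosSemidef)
    (hS : S.PosSemidef) {h s n : ℕ} {D : Set ℕ} (hn : s + h ≤ n) (hs : s ∉ D) (hsh : s + h ∉ D)
    {X : Ω → ℝ}
    (hX : HasMoments P (iSupOn (sourceSigma x w β ε) (stateIdx n ∪ obsIdx D)) X)
    (a : Fin d × Fin d) :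
    ∫ ω, X ω * (lagResidual A S σ x y h s ω * lagFeature x h s a ω) ∂P =
      ∫ ω, X ω * lagDrift A S β h s a ω ∂P := by
  set E : Set ℕ := {s, s + h} with hE
  have hsE : s ∈ E := by simp [hE]
  have hshE : s + h ∈ E := by simp [hE]
  have hDE : Disjoint D E := by
    rw [Set.disjoint_right]
    rintro r (rfl | rfl)
    · exact hs
    · exact hsh
  have hdisj : Disjoint (stateIdx n ∪ obsIdx D) (obsIdx E) :=
    (disjoint_stateIdx_obsIdx n E).union_left (disjoint_obsIdx hDE)
  have hst : ∀ {Y : Ω → ℝ}, HasMoments P (iSupOn (sourceSigma x w β ε) (stateIdx n)) Y →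
      HasMoments P (iSupOn (sourceSigma x w β ε) (stateIdx n ∪ obsIdx D)) Y :=
    fun hY => hY.mono (iSupOn_mono _ Set.subset_union_left)
  have hcv : ∀ {Y : Ω → ℝ}, HasMoments P (iSupOn (sourceSigma x w β ε) (covIdx E)) Y →
      HasMoments P (iSupOn (sourceSigma x w β ε) (obsIdx E)) Y :=
    fun hY => hY.mono (iSupOn_mono _ Set.subset_union_left)
  have hnz : ∀ {Y : Ω → ℝ}, HasMoments P (iSupOn (sourceSigma x w β ε) (noiseIdx E)) Y →
      HasMoments P (iSupOn (sourceSigma x w β ε) (obsIdx E)) Y :=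
    fun hY => hY.mono (iSupOn_mono _ Set.subset_union_right)
  have hφ := fun b => H.hasMoments_feature (h := h) hsE hshE b
  have hB := fun b => hst (H.hasMoments_dev hW hS hn b)
  have hXB := fun b => hX.mul (hB b)
  have hXβ : ∀ r ≤ n, ∀ l, HasMoments P
      (iSupOn (sourceSigma x w β ε) (stateIdx n ∪ obsIdx D)) (fun ω => X ω * β r ω l) :=
    fun r hr l => hX.mul (hst (H.hasMoments_state_of_le hW hS hr l))
  have hεx : ∀ r q, r ∈ E → q ∈ E → ∀ l, HasMoments P (iSupOn (sourceSigma x w β ε) (obsIdx E))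
      (fun ω => ε r ω * (x q ω l * lagFeature x h s a ω)) := fun r q hr hq l =>
    (hnz (H.hasMoments_ε hr)).mul (hcv ((H.hasMoments_x hq l).mul (hφ a)))
  have hεx0 : ∀ r q, r ∈ E → q ∈ E → ∀ l,
      ∫ ω, ε r ω * (x q ω l * lagFeature x h s a ω) ∂P = 0 := by
    intro r q hr hq l
    rw [H.integral_mul_of_disjoint (disjoint_covIdx_noiseIdx E E).symm (H.hasMoments_ε hr)
      ((H.hasMoments_x hq l).mul (hφ a)), H.integral_ε, zero_mul]
  have hv : HasMoments P (iSupOn (sourceSigma x w β ε) (noiseIdx E))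
      (fun ω => ε s ω * ε (s + h) ω - if h = 0 then (σ : ℝ) ^ 2 else 0) :=
    ((H.hasMoments_ε hsE).mul (H.hasMoments_ε hshE)).sub (HasMoments.const _)
  have hv0 : ∫ ω, (ε s ω * ε (s + h) ω - if h = 0 then (σ : ℝ) ^ 2 else 0) *
      lagFeature x h s a ω ∂P = 0 := by
    rw [H.integral_mul_of_disjoint (disjoint_covIdx_noiseIdx E E).symm hv (hφ a),
      integral_sub ((H.hasMoments_ε hsE).mul (H.hasMoments_ε hshE)).integrable
      (integrable_const _), H.integral_ε_mul_ε]
    simp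
  -- Every summand is written as a function of the states and the observations in `D` times a
  -- function of the observations in `E`. The two factors are independent, and all but the first sum
  -- integrate to zero.
  have e : ∀ ω, X ω * (lagResidual A S σ x y h s ω * lagFeature x h s a ω) =
      ((∑ b, (X ω * lagDev A S β h s b ω) * (lagFeature x h s a ω * lagFeature x h s b ω)
        + ∑ l, (X ω * β s ω l) * (ε (s + h) ω * (x s ω l * lagFeature x h s a ω)))
        + ∑ l, (X ω * β (s + h) ω l) * (ε s ω * (x (s + h) ω l * lagFeature x h s a ω)))
        + X ω * ((ε s ω * ε (s + h) ω - if h = 0 then (σ : ℝ) ^ 2 else 0)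
          * lagFeature x h s a ω) := by
    intro ω
    rw [H.residual_eq]
    have e1 : ∑ b, (X ω * lagDev A S β h s b ω) * (lagFeature x h s a ω * lagFeature x h s b ω) =
        X ω * lagFeature x h s a ω * ∑ b, lagDev A S β h s b ω * lagFeature x h s b ω := by
      rw [Finset.mul_sum]
      exact Finset.sum_congr rfl fun b _ => by ring
    have e2 : ∀ r q, ∑ l, (X ω * β q ω l) * (ε r ω * (x q ω l * lagFeature x h s a ω)) =
        X ω * lagFeature x h s a ω * ∑ l, β q ω l * (ε r ω * x q ω l) := by
      intro r q
      rw [Finset.mul_sum]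
      exact Finset.sum_congr rfl fun b _ => by ring
    rw [e1, e2, e2]
    ring
  have hle := H.iSupOn_le
  have m1 : ∀ b, HasMoments P mΩ (fun ω => (X ω * lagDev A S β h s b ω) *
      (lagFeature x h s a ω * lagFeature x h s b ω)) := fun b =>
    ((hXB b).mono (hle _)).mul (((hφ a).mul (hφ b)).mono (hle _))
  have m2 : ∀ r q, r ∈ E → q ∈ E → q ≤ n → ∀ l, HasMoments P mΩ
      (fun ω => (X ω * β q ω l) * (ε r ω * (x q ω l * lagFeature x h s a ω))) :=
    fun r q hr hq hqn l => ((hXβ q hqn l).mono (hle _)).mul ((hεx r q hr hq l).mono (hle _))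
  have i2 : ∀ r q, r ∈ E → q ∈ E → q ≤ n →
      ∫ ω, ∑ l, (X ω * β q ω l) * (ε r ω * (x q ω l * lagFeature x h s a ω)) ∂P = 0 := by
    intro r q hr hq hqn
    rw [integral_finsetSum _ fun l _ => (m2 r q hr hq hqn l).integrable]
    refine Finset.sum_eq_zero fun l _ => ?_
    rw [H.integral_mul_of_disjoint hdisj (hXβ q hqn l) (hεx r q hr hq l), hεx0 r q hr hq l,
      mul_zero]
  have m4 : HasMoments P mΩ (fun ω => X ω * ((ε s ω * ε (s + h) ω -
      if h = 0 then (σ : ℝ) ^ 2 else 0) * lagFeature x h s a ω)) :=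
    (hX.mono (hle _)).mul (((hnz hv).mul (hcv (hφ a))).mono (hle _))
  have hsn : s ≤ n := by omega
  simp_rw [e]
  rw [integral_add (((HasMoments.sum _ fun b _ => m1 b).add
      (HasMoments.sum _ fun l _ => m2 _ _ hshE hsE hsn l)).add
      (HasMoments.sum _ fun l _ => m2 _ _ hsE hshE hn l)).integrable m4.integrable,
    integral_add ((HasMoments.sum _ fun b _ => m1 b).add
      (HasMoments.sum _ fun l _ => m2 _ _ hshE hsE hsn l)).integrable
      (HasMoments.sum _ fun l _ => m2 _ _ hsE hshE hn l).integrable,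
    integral_add (HasMoments.sum _ fun b _ => m1 b).integrable
      (HasMoments.sum _ fun l _ => m2 _ _ hshE hsE hsn l).integrable,
    i2 _ _ hshE hsE hsn, i2 _ _ hsE hshE hn,
    H.integral_mul_of_disjoint hdisj hX ((hnz hv).mul (hcv (hφ a))), hv0,
    integral_finsetSum _ fun b _ => (m1 b).integrable]
  simp only [mul_zero, add_zero]
  have e3 : ∀ ω, X ω * lagDrift A S β h s a ω =
      ∑ b, featureKernel h a b * (X ω * lagDev A S β h s b ω) := by
    intro ω
    rw [lagDrift, Finset.mul_sum]
    exact Finset.sum_congr rfl fun b _ => by ring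
  simp_rw [e3]
  rw [integral_finsetSum _ fun b _ => (((hXB b).mono (hle _)).const_mul _).integrable]
  refine Finset.sum_congr rfl fun b _ => ?_
  rw [H.integral_mul_of_disjoint hdisj (hXB b) (hcv ((hφ a).mul (hφ b))),
    H.integral_feature_mul_feature, integral_const_mul, mul_comm]

end IsRegressionModel

theorem sum_featureKernel_mul_le {d : ℕ} [NeZero d] (h : ℕ) (M N : Matrix (Fin d) (Fin d) ℝ) :
    ∑ a, (∑ b, featureKernel h a b * M b.1 b.2) * (∑ b, featureKernel h a b * N b.1 b.2) ≤
      9 * (d : ℝ) ^ 2 * (frobNorm M * frobNorm N) := by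
  have h1 : ∀ M : Matrix (Fin d) (Fin d) ℝ,
      √(∑ a, (∑ b, featureKernel h a b * M b.1 b.2) ^ 2) ≤ 3 * d * frobNorm M := by
    intro M
    refine (Real.sqrt_le_sqrt (sum_sq_featureKernel_le h fun b => M b.1 b.2)).trans_eq ?_
    rw [Fintype.sum_prod_type (f := fun a : Fin d × Fin d => M a.1 a.2 ^ 2)]
    simp only
    rw [← frobNorm_sq,
      show 9 * (d : ℝ) ^ 2 * frobNorm M ^ 2 = (3 * d * frobNorm M) ^ 2 by ring,
      Real.sqrt_sq (by have := frobNorm_nonneg M; positivity)]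
  refine (Real.sum_mul_le_sqrt_mul_sqrt _ _ _).trans ?_
  refine (mul_le_mul (h1 M) (h1 N) (Real.sqrt_nonneg _)
    (by have := frobNorm_nonneg M; positivity)).trans_eq ?_
  ring

/-- Total of the envelope for correlations at time distance `k`: a crude bound `B` while the
observation windows may overlap, geometric decay afterwards. -/
theorem sum_range_ite_geometric_le {B K q : ℝ} (hB : 0 ≤ B) (hK : 0 ≤ K) (hq : 0 ≤ q) (hq1 : q < 1)
    (h T : ℕ) :
    ∑ k ∈ Finset.range T, (if k ≤ h then B else K * q ^ (k - (h + 1))) ≤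
      (h + 1) * B + K / (1 - q) := by
  have h0 : ∀ k, 0 ≤ (if k ≤ h then B else K * q ^ (k - (h + 1))) := by
    intro k
    split_ifs <;> positivity
  have h1 : ∑ k ∈ Finset.range T, (if k ≤ h then B else K * q ^ (k - (h + 1))) ≤
      ∑ k ∈ Finset.range (h + 1 + T), (if k ≤ h then B else K * q ^ (k - (h + 1))) :=
    Finset.sum_le_sum_of_subset_of_nonneg (Finset.range_mono (by omega)) fun k _ _ => h0 k
  refine h1.trans ?_
  rw [Finset.sum_range_add]
  refine add_le_add (le_of_eq ?_) ?_
  · rw [Finset.sum_congr rfl fun k hk => if_pos (Nat.lt_succ_iff.1 (Finset.mem_range.1 hk))]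
    simp
  · have e : ∀ k ∈ Finset.range T,
        (if h + 1 + k ≤ h then B else K * q ^ (h + 1 + k - (h + 1))) = K * q ^ k := by
      intro k _
      rw [if_neg (by omega), Nat.add_sub_cancel_left]
    rw [Finset.sum_congr rfl e, ← Finset.mul_sum, div_eq_mul_inv]
    refine mul_le_mul_of_nonneg_left ?_ hK
    rw [← tsum_geometric_of_lt_one hq hq1]
    exact (summable_geometric_of_lt_one hq hq1).sum_le_tsum _ fun k _ => by positivity

-- Correlations of the scores and second moments of the score and the Gram matrix.

namespace IsRegressionModel

open Matrix

variable {d : ℕ} {Ω : Type*} [mΩ : MeasurableSpace Ω] {P : Measure Ω} [IsProbabilityMeasure P]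
  {A W S : Matrix (Fin d) (Fin d) ℝ} {σ : NNReal}
  {x w β : ℕ → Ω → EuclideanSpace ℝ (Fin d)} {ε y : ℕ → Ω → ℝ}

/-- Since `t + h < s`, the observation windows are disjoint and can be averaged out in turn: first
the later one, with the earlier score as test variable, then the earlier one, with the later drift
as test variable and `D = ∅`. -/
theorem integral_score_mul_score (H : IsRegressionModel P A W S σ x w β ε y) (hW : W.PosSemidef)
    (hS : S.PosSemidef) {h t s : ℕ} (hts : t + h < s) (a : Fin d × Fin d) :
    ∫ ω, (lagResidual A S σ x y h t ω * lagFeature x h t a ω) *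
        (lagResidual A S σ x y h s ω * lagFeature x h s a ω) ∂P =
      ∫ ω, lagDrift A S β h t a ω * lagDrift A S β h s a ω ∂P := by
  have h1 := H.hasMoments_score (σ := σ) hW hS (h := h) (t := t) (n := s + h)
    (D := {t, t + h}) (by omega) (by simp) (by simp) a
  rw [H.integral_mul_score hW hS le_rfl (by simp; omega) (by simp; omega) h1]
  simp_rw [mul_comm _ (lagDrift A S β h s a _)]
  have h2 := (H.hasMoments_drift hW hS (h := h) (t := s) le_rfl a).mono
    (iSupOn_mono (sourceSigma x w β ε) (Set.subset_union_left (t := obsIdx ∅)))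
  rw [H.integral_mul_score hW hS (by omega) (by simp) (by simp) h2]

/-- Correlation of `X` with the drift `k` steps ahead, in terms of the propagated deviation. -/
theorem integral_mul_drift (H : IsRegressionModel P A W S σ x w β ε y) (hW : W.PosSemidef)
    (hS : IsStationaryCov A W S) {X : Ω → ℝ} {s : ℕ}
    (hX : HasMoments P (iSupOn (sourceSigma x w β ε) (stateIdx s)) X) (h k : ℕ)
    (a : Fin d × Fin d) :
    ∫ ω, X ω * lagDrift A S β h (s + k) a ω ∂P =
      ∫ ω, X ω * ∑ b, featureKernel h a b *
        (A ^ (h + k) * Matrix.of (fun i j => lagDev A S β 0 s (i, j) ω) * (A ^ k)ᵀ) b.1 b.2 ∂P := by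
  have hX0 := hX.mono (H.iSupOn_le _)
  have hB : ∀ h t b, HasMoments P mΩ (lagDev A S β h t b) := fun h t b =>
    (H.hasMoments_dev hW hS.posSemidef le_rfl b).mono (H.iSupOn_le _)
  have hprop : ∀ i j, HasMoments P mΩ (fun ω => (A ^ (h + k) *
      Matrix.of (fun i j => lagDev A S β 0 s (i, j) ω) * (A ^ k)ᵀ) i j) := by
    intro i j
    simp only [Matrix.mul_apply, Matrix.of_apply]
    exact HasMoments.sum _ fun l _ =>
      (HasMoments.sum _ fun l' _ => (hB _ _ _).const_mul _).mul (HasMoments.const _)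
  have hcorr : ∀ i j, ∫ ω, X ω * (A ^ (h + k) *
      Matrix.of (fun i j => lagDev A S β 0 s (i, j) ω) * (A ^ k)ᵀ) i j ∂P =
      devCorr P A S β X h (s + k) i j := by
    intro i j
    rw [H.devCorr_eq hW hS hX]
    have e : ∀ ω, X ω * (A ^ (h + k) *
        Matrix.of (fun i j => lagDev A S β 0 s (i, j) ω) * (A ^ k)ᵀ) i j =
        ∑ l, ∑ l', (A ^ (h + k)) i l' * (A ^ k)ᵀ l j * (X ω * lagDev A S β 0 s (l', l) ω) := by
      intro ω
      simp only [Matrix.mul_apply (N := (A ^ k)ᵀ), Matrix.mul_apply (M := A ^ (h + k)),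
        Matrix.of_apply, Finset.sum_mul, Finset.mul_sum]
      exact Finset.sum_congr rfl fun l _ => Finset.sum_congr rfl fun l' _ => by ring
    simp_rw [e]
    have m1 : ∀ l l', HasMoments P mΩ (fun ω => (A ^ (h + k)) i l' * (A ^ k)ᵀ l j *
      (X ω * lagDev A S β 0 s (l', l) ω)) := fun l l' => (hX0.mul (hB _ _ _)).const_mul _
    rw [integral_finsetSum _ fun l _ => (HasMoments.sum _ fun l' _ => m1 l l').integrable,
      Matrix.mul_apply]
    refine Finset.sum_congr rfl fun l _ => ?_
    rw [integral_finsetSum _ fun l' _ => (m1 l l').integrable, Matrix.mul_apply, Finset.sum_mul]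
    refine Finset.sum_congr rfl fun l' _ => ?_
    rw [integral_const_mul]
    simp only [devCorr, Matrix.of_apply, lagDev]
    ring
  have e1 : ∀ ω, X ω * lagDrift A S β h (s + k) a ω =
      ∑ b, featureKernel h a b * (X ω * lagDev A S β h (s + k) b ω) := by
    intro ω
    rw [lagDrift, Finset.mul_sum]
    exact Finset.sum_congr rfl fun b _ => by ring
  have e2 : ∀ ω, X ω * ∑ b, featureKernel h a b *
      (A ^ (h + k) * Matrix.of (fun i j => lagDev A S β 0 s (i, j) ω) * (A ^ k)ᵀ) b.1 b.2 =
      ∑ b, featureKernel h a b * (X ω * (A ^ (h + k) *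
        Matrix.of (fun i j => lagDev A S β 0 s (i, j) ω) * (A ^ k)ᵀ) b.1 b.2) := by
    intro ω
    rw [Finset.mul_sum]
    exact Finset.sum_congr rfl fun b _ => by ring
  simp_rw [e1, e2]
  rw [integral_finsetSum _ fun b _ => ((hX0.mul (hB _ _ _)).const_mul _).integrable,
    integral_finsetSum _ fun b _ => ((hX0.mul (hprop _ _)).const_mul _).integrable]
  refine Finset.sum_congr rfl fun b _ => ?_
  rw [integral_const_mul, integral_const_mul, hcorr]
  rfl

/-- The earlier drift is measurable at time `t + h`, so inside the expectation the later drift may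
be replaced by the propagated lag-zero deviation of that time. The propagated expression is small
pathwise, unlike the later drift itself. The constant is `9 d² / 2 * 6 d²`, from the squared kernel
norm and two deviation bounds. -/
theorem sum_integral_score_mul_score_le [NeZero d] (H : IsRegressionModel P A W S σ x w β ε y)
    (hW : W.PosSemidef) (hS : IsStationaryCov A W S) {τ γ : ℝ} (hγ : 0 < γ) (hγ1 : γ < 1)
    (hτ : ∀ k, opNorm (A ^ k) ≤ τ * γ ^ k) (h t k : ℕ) (hk : 1 ≤ k) :
    ∑ a, ∫ ω, (lagResidual A S σ x y h t ω * lagFeature x h t a ω) *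
        (lagResidual A S σ x y h (t + h + k) ω * lagFeature x h (t + h + k) a ω) ∂P ≤
      27 * (d : ℝ) ^ 4 * opNorm S ^ 2 * τ ^ 2 * (γ ^ 2) ^ k := by
  have hB : ∀ h t b, HasMoments P mΩ (lagDev A S β h t b) := fun h t b =>
    (H.hasMoments_dev hW hS.posSemidef le_rfl b).mono (H.iSupOn_le _)
  have hD := fun a => H.hasMoments_drift hW hS.posSemidef (h := h) (t := t) le_rfl a
  have hprop : ∀ i j, HasMoments P mΩ (fun ω => (A ^ (h + k) *
      Matrix.of (fun i j => lagDev A S β 0 (t + h) (i, j) ω) * (A ^ k)ᵀ) i j) := by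
    intro i j
    simp only [Matrix.mul_apply, Matrix.of_apply]
    exact HasMoments.sum _ fun l _ =>
      (HasMoments.sum _ fun l' _ => (hB _ _ _).const_mul _).mul (HasMoments.const _)
  simp_rw [H.integral_score_mul_score hW hS.posSemidef (show t + h < t + h + k by omega),
    H.integral_mul_drift hW hS (hD _) h k]
  have hterm : ∀ a, HasMoments P mΩ (fun ω => lagDrift A S β h t a ω * ∑ b, featureKernel h a b *
        (A ^ (h + k) * Matrix.of (fun i j => lagDev A S β 0 (t + h) (i, j) ω) * (A ^ k)ᵀ)
          b.1 b.2) := fun a =>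
    ((hD a).mono (H.iSupOn_le _)).mul (HasMoments.sum _ fun b _ => (hprop _ _).const_mul _)
  rw [← integral_finsetSum _ fun a _ => (hterm a).integrable]
  have hτ0 : 0 ≤ τ := by
    have := (opNorm_nonneg _).trans (hτ 0)
    simpa using this
  have hpt : ∀ ω, ∑ a, lagDrift A S β h t a ω * ∑ b, featureKernel h a b *
        (A ^ (h + k) * Matrix.of (fun i j => lagDev A S β 0 (t + h) (i, j) ω) * (A ^ k)ᵀ)
          b.1 b.2 ≤
      9 * (d : ℝ) ^ 2 * (τ ^ 2 * (γ ^ 2) ^ k) / 2 *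
        (∑ a : Fin d × Fin d, lagDev A S β h t a ω ^ 2
          + ∑ a : Fin d × Fin d, lagDev A S β 0 (t + h) a ω ^ 2) := by
    intro ω
    have h1 := sum_featureKernel_mul_le h (Matrix.of (fun i j => lagDev A S β h t (i, j) ω))
      (A ^ (h + k) * Matrix.of (fun i j => lagDev A S β 0 (t + h) (i, j) ω) * (A ^ k)ᵀ)
    refine h1.trans ?_
    have h2 : frobNorm (A ^ (h + k) * Matrix.of (fun i j => lagDev A S β 0 (t + h) (i, j) ω) *
        (A ^ k)ᵀ) ≤ τ ^ 2 * (γ ^ 2) ^ k *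
          frobNorm (Matrix.of (fun i j => lagDev A S β 0 (t + h) (i, j) ω)) := by
      have hA : opNorm (A ^ k) * opNorm (A ^ (h + k)) ≤ τ ^ 2 * (γ ^ 2) ^ k := by
        -- The additional decay `γ ^ h` is discarded.
        have h3 : opNorm (A ^ (h + k)) ≤ τ * γ ^ k := (hτ _).trans
          (mul_le_mul_of_nonneg_left (pow_le_pow_of_le_one hγ.le hγ1.le (by omega)) hτ0)
        calc _ ≤ (τ * γ ^ k) * (τ * γ ^ k) :=
              mul_le_mul (hτ k) h3 (opNorm_nonneg _) (by positivity)
          _ = _ := by ring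
      refine (frobNorm_mul_transpose_le _ _).trans ?_
      refine (mul_le_mul_of_nonneg_left (frobNorm_mul_le _ _) (opNorm_nonneg _)).trans ?_
      rw [← mul_assoc]
      exact mul_le_mul_of_nonneg_right hA (frobNorm_nonneg _)
    set M := Matrix.of (fun i j => lagDev A S β h t (i, j) ω) with hM
    set N := Matrix.of (fun i j => lagDev A S β 0 (t + h) (i, j) ω) with hN
    have e1 : ∑ a : Fin d × Fin d, lagDev A S β h t a ω ^ 2 = frobNorm M ^ 2 := by
      rw [frobNorm_sq, Fintype.sum_prod_type]
      rfl
    have e2 : ∑ a : Fin d × Fin d, lagDev A S β 0 (t + h) a ω ^ 2 = frobNorm N ^ 2 := by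
      rw [frobNorm_sq, Fintype.sum_prod_type]
      rfl
    rw [e1, e2]
    have h4 : frobNorm M * frobNorm N ≤ (frobNorm M ^ 2 + frobNorm N ^ 2) / 2 := by
      nlinarith [sq_nonneg (frobNorm M - frobNorm N)]
    calc 9 * (d : ℝ) ^ 2 * (frobNorm M * frobNorm (A ^ (h + k) * N * (A ^ k)ᵀ))
        ≤ 9 * (d : ℝ) ^ 2 * (frobNorm M * (τ ^ 2 * (γ ^ 2) ^ k * frobNorm N)) := by
          have := frobNorm_nonneg M
          gcongr
      _ = 9 * (d : ℝ) ^ 2 * (τ ^ 2 * (γ ^ 2) ^ k) * (frobNorm M * frobNorm N) := by ring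
      _ ≤ 9 * (d : ℝ) ^ 2 * (τ ^ 2 * (γ ^ 2) ^ k) * ((frobNorm M ^ 2 + frobNorm N ^ 2) / 2) := by
          gcongr
      _ = _ := by ring
  have hsq : ∀ h t, HasMoments P mΩ (fun ω => ∑ a : Fin d × Fin d, lagDev A S β h t a ω ^ 2) :=
    fun h t => HasMoments.sum _ fun a _ => (hB _ _ _).pow 2
  refine (integral_mono (HasMoments.sum _ fun a _ => hterm a).integrable
    (((hsq h t).add (hsq 0 (t + h))).const_mul _).integrable hpt).trans ?_
  rw [integral_const_mul, integral_add (hsq _ _).integrable (hsq _ _).integrable]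
  have h5 := H.sum_integral_dev_sq_le hW hS h t
  have h6 := H.sum_integral_dev_sq_le hW hS 0 (t + h)
  calc _ ≤ 9 * (d : ℝ) ^ 2 * (τ ^ 2 * (γ ^ 2) ^ k) / 2 *
        (3 * (d : ℝ) ^ 2 * opNorm S ^ 2 + 3 * (d : ℝ) ^ 2 * opNorm S ^ 2) :=
        mul_le_mul_of_nonneg_left (add_le_add h5 h6) (by positivity)
    _ = _ := by ring

theorem integral_y_pow_four_le (H : IsRegressionModel P A W S σ x w β ε y)
    (hW : W.PosSemidef) (hS : IsStationaryCov A W S) (t : ℕ) :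
    ∫ ω, y t ω ^ 4 * (∑ i, x t ω i ^ 2) ^ 2 ∂P ≤
      24 * opNorm S ^ 2 * (gaussianEighthMoment * (d : ℝ) ^ 4) + 72 * (σ : ℝ) ^ 4 * (d : ℝ) ^ 2 := by
  have hx := H.hasMoments_x' t
  have hβ : ∀ i, HasMoments P mΩ (fun ω => β t ω i) := fun i =>
    (H.hasMoments_state hW hS.posSemidef t i).mono (H.iSupOn_le _)
  have hε := H.hasMoments_ε' t
  have hf : HasMoments P mΩ (fun ω => ∑ i, x t ω i * β t ω i) :=
    HasMoments.sum _ fun i _ => (hx i).mul (hβ i)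
  have hq : HasMoments P mΩ (fun ω => ∑ i, x t ω i ^ 2) :=
    HasMoments.sum _ fun i _ => (hx i).pow 2
  have hq' : HasMoments P (iSupOn (sourceSigma x w β ε) (covIdx Set.univ))
      (fun ω => ∑ i, x t ω i ^ 2) :=
    HasMoments.sum _ fun i _ => (H.hasMoments_x (Set.mem_univ t) i).pow 2
  have h1 : ∫ ω, y t ω ^ 4 * (∑ i, x t ω i ^ 2) ^ 2 ∂P ≤
      ∫ ω, (8 * ((∑ i, x t ω i * β t ω i) ^ 4 * (∑ i, x t ω i ^ 2) ^ 2) +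
        8 * (ε t ω ^ 4 * (∑ i, x t ω i ^ 2) ^ 2)) ∂P := by
    have hy : HasMoments P mΩ (y t) :=
      (H.hasMoments_y hW hS.posSemidef le_rfl (Set.mem_univ t)).mono (H.iSupOn_le _)
    refine integral_mono ((hy.pow 4).mul (hq.pow 2)).integrable
      ((((hf.pow 4).mul (hq.pow 2)).const_mul 8).add
        (((hε.pow 4).mul (hq.pow 2)).const_mul 8)).integrable fun ω => ?_
    simp only [H.observation_eq]
    have h2 : ∀ u v : ℝ, (u + v) ^ 4 ≤ 8 * u ^ 4 + 8 * v ^ 4 := by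
      intro u v
      nlinarith [sq_nonneg (u - v), sq_nonneg (u ^ 2 - v ^ 2), sq_nonneg (u + v),
        mul_nonneg (sq_nonneg (u - v)) (sq_nonneg (u + v)),
        mul_nonneg (sq_nonneg (u - v)) (sq_nonneg (u - v)), sq_nonneg (u * v), sq_nonneg (u^2),
        sq_nonneg (v^2), mul_nonneg (sq_nonneg (u - v)) (sq_nonneg u),
        mul_nonneg (sq_nonneg (u - v)) (sq_nonneg v)]
    have := mul_le_mul_of_nonneg_right (h2 (∑ i, x t ω i * β t ω i) (ε t ω))
      (sq_nonneg (∑ i, x t ω i ^ 2))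
    linarith
  refine h1.trans ?_
  rw [integral_add (((hf.pow 4).mul (hq.pow 2)).const_mul 8).integrable
    (((hε.pow 4).mul (hq.pow 2)).const_mul 8).integrable, integral_const_mul, integral_const_mul,
    H.integral_mul_of_disjoint (disjoint_covIdx_noiseIdx Set.univ Set.univ).symm
      ((H.hasMoments_ε (Set.mem_univ t)).pow 4) (hq'.pow 2), H.integral_ε_pow_four]
  have h3 := H.integral_signal_pow_four_le hW hS t
  have h4 := mul_le_mul_of_nonneg_left (H.integral_sum_sq_x_sq_le t)
    (show 0 ≤ 3 * (σ : ℝ) ^ 4 by positivity)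
  linarith

/-- The second moment of residual times feature. -/
theorem sum_integral_score_sq_le (H : IsRegressionModel P A W S σ x w β ε y)
    (hW : W.PosSemidef) (hS : IsStationaryCov A W S) {τ γ : ℝ} (hγ : 0 < γ) (hγ1 : γ < 1)
    (hτ1 : 1 ≤ τ) (hτ : ∀ k, opNorm (A ^ k) ≤ τ * γ ^ k) (h t : ℕ) :
    ∑ a, ∫ ω, (lagResidual A S σ x y h t ω * lagFeature x h t a ω) ^ 2 ∂P ≤
      (75 * gaussianEighthMoment + 225) * (d : ℝ) ^ 2 *
        ((σ : ℝ) ^ 4 + τ ^ 2 * opNorm S ^ 2 * (d : ℝ) ^ 2) := by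
  have hres : HasMoments P mΩ (lagResidual A S σ x y h t) :=
    (H.hasMoments_residual hW hS.posSemidef le_rfl (Set.mem_univ _) (Set.mem_univ _)).mono
      (H.iSupOn_le _)
  have hφ : ∀ a, HasMoments P mΩ (lagFeature x h t a) := fun a =>
    (H.hasMoments_feature (Set.mem_univ _) (Set.mem_univ _) a).mono (H.iSupOn_le _)
  have hx := H.hasMoments_x'
  have hq : ∀ t, HasMoments P mΩ (fun ω => ∑ i, x t ω i ^ 2) := fun t =>
    HasMoments.sum _ fun i _ => (hx t i).pow 2
  have hy : ∀ t, HasMoments P mΩ (y t) := fun t =>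
    (H.hasMoments_y hW hS.posSemidef le_rfl (Set.mem_univ t)).mono (H.iSupOn_le _)
  rw [← integral_finsetSum _ fun a _ => ((hres.mul (hφ a)).pow 2).integrable]
  set oM := opNorm (A ^ h * S) with hoM
  have hoM1 : oM ^ 2 ≤ τ ^ 2 * opNorm S ^ 2 := by
    rw [← mul_pow]
    refine pow_le_pow_left₀ (opNorm_nonneg _) ((opNorm_mul_le _ _).trans ?_) 2
    refine mul_le_mul_of_nonneg_right ((hτ h).trans ?_) (opNorm_nonneg _)
    exact mul_le_of_le_one_right (by linarith) (pow_le_one₀ hγ.le hγ1.le)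
  have hpt : ∀ ω, ∑ a, (lagResidual A S σ x y h t ω * lagFeature x h t a ω) ^ 2 ≤
      3 / 2 * (((y t ω ^ 4 * (∑ i, x t ω i ^ 2) ^ 2
          + y (t + h) ω ^ 4 * (∑ i, x (t + h) ω i ^ 2) ^ 2)
        + oM ^ 2 * ((∑ i, x t ω i ^ 2) ^ 4 + (∑ i, x (t + h) ω i ^ 2) ^ 4))
        + (σ : ℝ) ^ 4 * ((∑ i, x t ω i ^ 2) ^ 2 + (∑ i, x (t + h) ω i ^ 2) ^ 2)) := by
    intro ω
    have e1 : ∑ a, (lagResidual A S σ x y h t ω * lagFeature x h t a ω) ^ 2 =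
        lagResidual A S σ x y h t ω ^ 2 *
          ((∑ i, x (t + h) ω i ^ 2) * ∑ i, x t ω i ^ 2) := by
      rw [Finset.sum_mul_sum, ← Fintype.sum_prod_type', Finset.mul_sum]
      refine Finset.sum_congr rfl fun a _ => ?_
      unfold lagFeature
      ring
    rw [e1]
    have e2 : ∑ a : Fin d × Fin d, (A ^ h * S) a.1 a.2 * lagFeature x h t a ω =
        (fun i => x (t + h) ω i) ⬝ᵥ (A ^ h * S) *ᵥ fun i => x t ω i := by
      simp only [Fintype.sum_prod_type, dotProduct, Matrix.mulVec, Finset.mul_sum, lagFeature]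
      exact Finset.sum_congr rfl fun i _ => Finset.sum_congr rfl fun j _ => by ring
    have h2 := sq_dotProduct_mulVec_le (A ^ h * S) (fun i => x (t + h) ω i) fun i => x t ω i
    rw [← e2, ← hoM] at h2
    have h3 : ((if h = 0 then (σ : ℝ) ^ 2 else 0)) ^ 2 ≤ (σ : ℝ) ^ 4 := by
      split_ifs
      · exact le_of_eq (by ring)
      · simp only [ne_eq, OfNat.ofNat_ne_zero, not_false_eq_true, zero_pow]
        positivity
    set q := ∑ i, x t ω i ^ 2
    set q' := ∑ i, x (t + h) ω i ^ 2
    have hq0 : 0 ≤ q := Finset.sum_nonneg fun _ _ => sq_nonneg _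
    have hq0' : 0 ≤ q' := Finset.sum_nonneg fun _ _ => sq_nonneg _
    set m := ∑ a : Fin d × Fin d, (A ^ h * S) a.1 a.2 * lagFeature x h t a ω
    set v := if h = 0 then (σ : ℝ) ^ 2 else 0
    have e3 : lagResidual A S σ x y h t ω = y t ω * y (t + h) ω - m - v := rfl
    rw [e3]
    -- The three parts of the residual are separated at the cost of a factor 3. Each product of
    -- quantities at times `t` and `t + h` is then split by AM–GM, so that no joint moments are
    -- needed; this also treats `h = 0` uniformly.
    have h4 : (y t ω * y (t + h) ω - m - v) ^ 2 ≤
        3 * ((y t ω * y (t + h) ω) ^ 2 + oM ^ 2 * q' * q + (σ : ℝ) ^ 4) := by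
      nlinarith [sq_nonneg (y t ω * y (t + h) ω + m), sq_nonneg (y t ω * y (t + h) ω + v),
        sq_nonneg (m - v)]
    have h5 := mul_le_mul_of_nonneg_right h4 (mul_nonneg hq0' hq0)
    refine h5.trans ?_
    have h6 : (y t ω * y (t + h) ω) ^ 2 * (q' * q) ≤
        (y t ω ^ 4 * q ^ 2 + y (t + h) ω ^ 4 * q' ^ 2) / 2 := by
      nlinarith [sq_nonneg (y t ω ^ 2 * q - y (t + h) ω ^ 2 * q')]
    have h7 : oM ^ 2 * q' * q * (q' * q) ≤ oM ^ 2 * (q ^ 4 + q' ^ 4) / 2 := by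
      nlinarith [mul_nonneg (sq_nonneg oM) (sq_nonneg (q ^ 2 - q' ^ 2))]
    have h8 : (σ : ℝ) ^ 4 * (q' * q) ≤ (σ : ℝ) ^ 4 * (q ^ 2 + q' ^ 2) / 2 := by
      have : 0 ≤ (σ : ℝ) ^ 4 := by positivity
      nlinarith [mul_nonneg this (sq_nonneg (q - q'))]
    nlinarith
  have m1 := fun t => ((hy t).pow 4).mul ((hq t).pow 2)
  have m2 := fun t => (hq t).pow 4
  have m3 := fun t => (hq t).pow 2
  have M1 := (m1 t).add (m1 (t + h))
  have M2 := ((m2 t).add (m2 (t + h))).const_mul (oM ^ 2)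
  have M3 := ((m3 t).add (m3 (t + h))).const_mul ((σ : ℝ) ^ 4)
  refine (integral_mono (HasMoments.sum _ fun a _ => (hres.mul (hφ a)).pow 2).integrable
    (((M1.add M2).add M3).const_mul _).integrable hpt).trans ?_
  rw [integral_const_mul, integral_add (M1.add M2).integrable M3.integrable,
    integral_add M1.integrable M2.integrable, integral_add (m1 t).integrable (m1 _).integrable,
    integral_const_mul, integral_const_mul, integral_add (m2 t).integrable (m2 _).integrable,
    integral_add (m3 t).integrable (m3 _).integrable]
  have b1 := fun t => H.integral_y_pow_four_le hW hS t
  have b2 := H.integral_sum_sq_x_pow_four_le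
  have b3 := H.integral_sum_sq_x_sq_le
  have hG := gaussianEighthMoment_nonneg
  set G := gaussianEighthMoment
  have c2 := mul_le_mul_of_nonneg_left (add_le_add (b2 t) (b2 (t + h))) (sq_nonneg oM)
  have c3 := mul_le_mul_of_nonneg_left (add_le_add (b3 t) (b3 (t + h)))
    (show 0 ≤ (σ : ℝ) ^ 4 by positivity)
  have c1 := add_le_add (b1 t) (b1 (t + h))
  have hGd : 0 ≤ G * (d : ℝ) ^ 4 := by positivity
  have c4 := mul_le_mul_of_nonneg_right hoM1 hGd
  have c5 : opNorm S ^ 2 * (G * (d : ℝ) ^ 4) ≤ τ ^ 2 * opNorm S ^ 2 * (G * (d : ℝ) ^ 4) := by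
    refine mul_le_mul_of_nonneg_right ?_ hGd
    exact le_mul_of_one_le_left (sq_nonneg _) (one_le_pow₀ hτ1)
  have c6 : 0 ≤ G * (d : ℝ) ^ 2 * (σ : ℝ) ^ 4 := by positivity
  have c7 : 0 ≤ (d : ℝ) ^ 4 * τ ^ 2 * opNorm S ^ 2 := by positivity
  -- Constants: `3/2 * (48 + 2) = 75` in front of the eighth moment and `3/2 * (144 + 6) = 225` in
  -- front of `σ⁴ d²`.
  nlinarith

/-- The second moment of the score. -/
theorem sum_integral_sum_score_sq_le [NeZero d] (H : IsRegressionModel P A W S σ x w β ε y)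
    (hW : W.PosSemidef) (hS : IsStationaryCov A W S) {τ γ : ℝ} (hγ : 0 < γ) (hγ1 : γ < 1)
    (hτ1 : 1 ≤ τ) (hτ : ∀ k, opNorm (A ^ k) ≤ τ * γ ^ k) (h T : ℕ) :
    ∑ a, ∫ ω, (∑ t ∈ Finset.range T, lagResidual A S σ x y h t ω * lagFeature x h t a ω) ^ 2 ∂P ≤
      2 * T * ((h + 1) * ((75 * gaussianEighthMoment + 252) * (d : ℝ) ^ 2 *
        ((σ : ℝ) ^ 4 + τ ^ 3 / (1 - γ ^ 2) * opNorm S ^ 2 * (d : ℝ) ^ 2))) := by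
  have hG := gaussianEighthMoment_nonneg
  have hZ : ∀ t a, HasMoments P mΩ
      (fun ω => lagResidual A S σ x y h t ω * lagFeature x h t a ω) := fun t a =>
    (H.hasMoments_score hW hS.posSemidef le_rfl (Set.mem_univ _) (Set.mem_univ _) a).mono
      (H.iSupOn_le _)
  have hq1 : γ ^ 2 < 1 := pow_lt_one₀ hγ.le hγ1 two_ne_zero
  set B := (75 * gaussianEighthMoment + 225) * (d : ℝ) ^ 2 *
        ((σ : ℝ) ^ 4 + τ ^ 2 * opNorm S ^ 2 * (d : ℝ) ^ 2) with hBdef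
  set K := 27 * (d : ℝ) ^ 4 * opNorm S ^ 2 * τ ^ 2 with hKdef
  have hB0 : 0 ≤ B := by positivity
  have hK0 : 0 ≤ K := by positivity
  have hsum := sum_range_ite_geometric_le hB0 hK0 (sq_nonneg γ) hq1 h T
  have hCle : (h + 1) * B + K / (1 - γ ^ 2) ≤
      (h + 1) * ((75 * gaussianEighthMoment + 252) * (d : ℝ) ^ 2 *
        ((σ : ℝ) ^ 4 + τ ^ 3 / (1 - γ ^ 2) * opNorm S ^ 2 * (d : ℝ) ^ 2)) := by
    have hg : 0 < 1 - γ ^ 2 := by linarith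
    -- The argument yields `τ²`; since `τ ≥ 1` it may be raised to the power 3 of the variance term.
    have h1 : τ ^ 2 / (1 - γ ^ 2) ≤ τ ^ 3 / (1 - γ ^ 2) := by
      gcongr
      norm_num
    have h2 : τ ^ 2 ≤ τ ^ 2 / (1 - γ ^ 2) := by
      rw [le_div_iff₀ hg]
      nlinarith [sq_nonneg τ, sq_nonneg γ, mul_nonneg (sq_nonneg τ) (sq_nonneg γ)]
    set R := τ ^ 3 / (1 - γ ^ 2) with hR
    have h3 : K / (1 - γ ^ 2) = 27 * (d : ℝ) ^ 4 * opNorm S ^ 2 * (τ ^ 2 / (1 - γ ^ 2)) := by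
      rw [hKdef, mul_div_assoc]
    have h4 : K / (1 - γ ^ 2) ≤ 27 * (d : ℝ) ^ 2 *
        ((σ : ℝ) ^ 4 + R * opNorm S ^ 2 * (d : ℝ) ^ 2) := by
      rw [h3]
      calc 27 * (d : ℝ) ^ 4 * opNorm S ^ 2 * (τ ^ 2 / (1 - γ ^ 2))
          ≤ 27 * (d : ℝ) ^ 4 * opNorm S ^ 2 * R := by gcongr
        _ = 27 * (d : ℝ) ^ 2 * (0 + R * opNorm S ^ 2 * (d : ℝ) ^ 2) := by ring
        _ ≤ _ := by
          gcongr
          positivity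
    have hR0 : 0 ≤ R := by positivity
    have h5 : B ≤ (75 * gaussianEighthMoment + 225) * (d : ℝ) ^ 2 *
        ((σ : ℝ) ^ 4 + R * opNorm S ^ 2 * (d : ℝ) ^ 2) := by
      rw [hBdef]
      have := h2.trans h1
      gcongr
    set V := (σ : ℝ) ^ 4 + R * opNorm S ^ 2 * (d : ℝ) ^ 2
    have hV : 0 ≤ 27 * (d : ℝ) ^ 2 * V := by positivity
    have h6 : K / (1 - γ ^ 2) ≤ (h + 1) * (27 * (d : ℝ) ^ 2 * V) :=
      h4.trans (le_mul_of_one_le_left hV (by linarith [Nat.cast_nonneg (α := ℝ) h]))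
    have h7 := mul_le_mul_of_nonneg_left h5 (show 0 ≤ (h : ℝ) + 1 by positivity)
    calc _ ≤ _ := add_le_add h7 h6
      _ = _ := by ring
  refine sum_integral_sum_sq_le (fun t a ω => lagResidual A S σ x y h t ω * lagFeature x h t a ω)
    hZ (fun k => if k ≤ h then B else K * (γ ^ 2) ^ (k - (h + 1))) _ T ?_ (hsum.trans hCle) ?_
  · intro k
    split_ifs <;> positivity
  · intro t k
    split_ifs with hk
    · have h1 : ∀ a, _ := fun a => (hZ t a).integral_mul_le_add_div_two (hZ (t + k) a)
      refine (Finset.sum_le_sum fun a _ => h1 a).trans ?_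
      rw [← Finset.sum_div, Finset.sum_add_distrib]
      have h2 := H.sum_integral_score_sq_le hW hS hγ hγ1 hτ1 hτ h t
      have h3 := H.sum_integral_score_sq_le hW hS hγ hγ1 hτ1 hτ h (t + k)
      linarith
    -- At distance `h + j + 1` the gap beyond the window is `j + 1`; the bound `(γ ^ 2) ^ (j + 1)`
    -- is weakened to exponent `j` to match the envelope.
    · obtain ⟨j, rfl⟩ := Nat.exists_eq_add_of_lt (not_le.1 hk)
      have h1 := H.sum_integral_score_mul_score_le (σ := σ) hW hS hγ hγ1 hτ h t (j + 1) (by omega)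
      rw [show t + (h + j + 1) = t + h + (j + 1) by ring]
      refine h1.trans ?_
      rw [show h + j + 1 - (h + 1) = j by omega]
      refine mul_le_mul_of_nonneg_left ?_ hK0
      exact pow_le_pow_of_le_one (sq_nonneg γ) hq1.le (by omega)

/-- The variance of the Gram matrix of the features. -/
theorem sum_integral_gram_sq_le (H : IsRegressionModel P A W S σ x w β ε y) (h T : ℕ) :
    ∑ p : (Fin d × Fin d) × (Fin d × Fin d), ∫ ω, (∑ t ∈ Finset.range T,
      (lagFeature x h t p.1 ω * lagFeature x h t p.2 ω - featureKernel h p.1 p.2)) ^ 2 ∂P ≤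
      2 * T * ((h + 1) * (gaussianEighthMoment * (d : ℝ) ^ 4)) := by
  have hφ : ∀ t a, HasMoments P (iSupOn (sourceSigma x w β ε) (covIdx {t, t + h}))
      (lagFeature x h t a) := fun t a => H.hasMoments_feature (by simp) (by simp) a
  have hφ0 := fun t a => (hφ t a).mono (H.iSupOn_le _)
  have hY : ∀ t (p : (Fin d × Fin d) × (Fin d × Fin d)),
      HasMoments P (iSupOn (sourceSigma x w β ε) (covIdx {t, t + h}))
      (fun ω => lagFeature x h t p.1 ω * lagFeature x h t p.2 ω - featureKernel h p.1 p.2) :=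
    fun t p => ((hφ t _).mul (hφ t _)).sub (HasMoments.const _)
  have hY0 := fun t p => (hY t p).mono (H.iSupOn_le _)
  have hmean : ∀ t (p : (Fin d × Fin d) × (Fin d × Fin d)),
      ∫ ω, (lagFeature x h t p.1 ω * lagFeature x h t p.2 ω - featureKernel h p.1 p.2) ∂P = 0 := by
    intro t p
    rw [integral_sub ((hφ0 t _).mul (hφ0 t _)).integrable (integrable_const _),
      H.integral_feature_mul_feature]
    simp
  set B := gaussianEighthMoment * (d : ℝ) ^ 4
  have hB0 : 0 ≤ B := mul_nonneg gaussianEighthMoment_nonneg (by positivity)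
  -- No tail is needed (`K = 0` and ratio `0`): centred Gram terms more than `h` apart are
  -- independent, hence uncorrelated.
  have hsum := sum_range_ite_geometric_le hB0 le_rfl le_rfl one_pos h T
  rw [zero_div, add_zero] at hsum
  have hdiag : ∀ t, ∑ p : (Fin d × Fin d) × (Fin d × Fin d),
      ∫ ω, (lagFeature x h t p.1 ω * lagFeature x h t p.2 ω - featureKernel h p.1 p.2) ^ 2 ∂P ≤
      B := by
    intro t
    have h1 : ∀ p : (Fin d × Fin d) × (Fin d × Fin d), _ := fun p =>
      ((hφ0 t p.1).mul (hφ0 t p.2)).integral_sub_sq_le (H.integral_feature_mul_feature h t p.1 p.2)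
    refine (Finset.sum_le_sum fun p _ => h1 p).trans ?_
    rw [← integral_finsetSum _ fun p _ => (((hφ0 t p.1).mul (hφ0 t p.2)).pow 2).integrable]
    have e : ∀ ω, ∑ p : (Fin d × Fin d) × (Fin d × Fin d),
        (lagFeature x h t p.1 ω * lagFeature x h t p.2 ω) ^ 2 =
        (∑ i, x (t + h) ω i ^ 2) ^ 2 * (∑ i, x t ω i ^ 2) ^ 2 := by
      intro ω
      have e1 : ∑ a, lagFeature x h t a ω ^ 2 =
          (∑ i, x (t + h) ω i ^ 2) * ∑ i, x t ω i ^ 2 := by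
        rw [Finset.sum_mul_sum, ← Fintype.sum_prod_type']
        exact Finset.sum_congr rfl fun a _ => mul_pow _ _ _
      rw [← mul_pow, ← e1, sq, Finset.sum_mul_sum, ← Fintype.sum_prod_type']
      exact Finset.sum_congr rfl fun a _ => mul_pow _ _ _
    simp_rw [e]
    have hq : ∀ t, HasMoments P mΩ (fun ω => (∑ i, x t ω i ^ 2) ^ 2) := fun t =>
      (HasMoments.sum _ fun i _ => (H.hasMoments_x' t i).pow 2).pow 2
    refine ((hq (t + h)).integral_mul_le_add_div_two (hq t)).trans ?_
    simp_rw [← pow_mul]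
    have := H.integral_sum_sq_x_pow_four_le t
    have := H.integral_sum_sq_x_pow_four_le (t + h)
    linarith
  refine sum_integral_sum_sq_le
    (fun t (p : (Fin d × Fin d) × (Fin d × Fin d)) ω =>
      lagFeature x h t p.1 ω * lagFeature x h t p.2 ω - featureKernel h p.1 p.2)
    hY0 (fun k => if k ≤ h then B else 0 * 0 ^ (k - (h + 1))) _ T ?_ hsum ?_
  · intro k
    split_ifs <;> simp [hB0]
  · intro t k
    split_ifs with hk
    · have h1 : ∀ p, _ := fun p => (hY0 t p).integral_mul_le_add_div_two (hY0 (t + k) p)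
      refine (Finset.sum_le_sum fun p _ => h1 p).trans ?_
      rw [← Finset.sum_div, Finset.sum_add_distrib]
      have h2 := hdiag t
      have h3 := hdiag (t + k)
      linarith
    · rw [zero_mul]
      refine (Finset.sum_eq_zero fun p _ => ?_).le
      have hd : Disjoint ({t, t + h} : Set ℕ) {t + k, t + k + h} := by
        rw [Set.disjoint_left]
        simp only [Set.mem_insert_iff, Set.mem_singleton_iff]
        omega
      rw [H.integral_mul_of_disjoint (disjoint_covIdx hd) (hY t p) (hY (t + k) p), hmean,
        zero_mul]

end IsRegressionModel

-- Deterministic analysis of least squares.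

/-- Linear least squares problems have solutions. -/
theorem exists_least_squares {V : Type*} [AddCommGroup V] [Module ℝ V] (K : Submodule ℝ V)
    (L : ℕ → V →ₗ[ℝ] ℝ) (z : ℕ → ℝ) (T : ℕ) :
    ∃ v ∈ K, ∀ v' ∈ K, ∑ t ∈ Finset.range T, (z t - L t v) ^ 2 ≤
      ∑ t ∈ Finset.range T, (z t - L t v') ^ 2 := by
  let F : V →ₗ[ℝ] EuclideanSpace ℝ (Fin T) :=
    (WithLp.linearEquiv 2 ℝ (Fin T → ℝ)).symm.toLinearMap ∘ₗ LinearMap.pi fun t : Fin T => L t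
  let Z : EuclideanSpace ℝ (Fin T) := WithLp.toLp 2 fun t => z t
  have hnorm : ∀ v, ‖Z - F v‖ ^ 2 = ∑ t ∈ Finset.range T, (z t - L t v) ^ 2 := by
    intro v
    rw [EuclideanSpace.real_norm_sq_eq, Finset.sum_range]
    rfl
  -- The minimizer is a preimage of the projection of `Z` onto the image of `K`, which is complete
  -- because it is finite-dimensional. No injectivity of the design is needed.
  obtain ⟨q, hq, hmin⟩ := (K.map F).exists_norm_eq_iInf_of_complete_subspace
    (K.map F).complete_of_finiteDimensional Z
  obtain ⟨v, hv, rfl⟩ := Submodule.mem_map.1 hq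
  refine ⟨v, hv, fun v' hv' => ?_⟩
  rw [← hnorm, ← hnorm]
  refine pow_le_pow_left₀ (norm_nonneg _) ?_ 2
  rw [hmin]
  exact ciInf_le (f := fun q : (K.map F : Set (EuclideanSpace ℝ (Fin T))) => ‖Z - q‖)
    ⟨0, by rintro _ ⟨q, rfl⟩; exact norm_nonneg _⟩ ⟨F v', Submodule.mem_map_of_mem hv'⟩

/-- The error of a least squares estimate in terms of the score and of the Gram matrix. -/
theorem sum_sq_error_le {κ : Type*} [Fintype κ] {φ : ℕ → κ → ℝ} {η : ℕ → ℝ} {D : κ → ℝ}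
    {G : κ → κ → ℝ} {T : ℕ} (hT : 0 < T) {R : ℝ}
    (hopt : ∑ t ∈ Finset.range T, (η t - ∑ a, D a * φ t a) ^ 2 ≤ ∑ t ∈ Finset.range T, η t ^ 2)
    (hG : ∑ a, D a ^ 2 ≤ ∑ a, D a * ∑ b, G a b * D b)
    (hgram : ∑ p : κ × κ, (∑ t ∈ Finset.range T, (φ t p.1 * φ t p.2 - G p.1 p.2)) ^ 2 ≤
      (T : ℝ) ^ 2 / 4)
    (hscore : ∑ a, (∑ t ∈ Finset.range T, η t * φ t a) ^ 2 ≤ R) :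
    ∑ a, D a ^ 2 ≤ 16 * R / (T : ℝ) ^ 2 := by
  have hT' : (0 : ℝ) < T := by exact_mod_cast hT
  set X := ∑ a, D a ^ 2 with hX
  have hX0 : 0 ≤ X := Finset.sum_nonneg fun _ _ => sq_nonneg _
  set Q := ∑ t ∈ Finset.range T, (∑ a, D a * φ t a) ^ 2 with hQ
  set U := ∑ a, D a * ∑ t ∈ Finset.range T, η t * φ t a with hU
  -- The basic inequality: expanding the square in the comparison with the truth cancels the
  -- residual energy.
  have hQU : Q ≤ 2 * U := by
    have e : ∑ t ∈ Finset.range T, (η t - ∑ a, D a * φ t a) ^ 2 =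
        ∑ t ∈ Finset.range T, η t ^ 2 - 2 * U + Q := by
      have e1 : U = ∑ t ∈ Finset.range T, η t * ∑ a, D a * φ t a := by
        simp only [hU, Finset.mul_sum]
        rw [Finset.sum_comm]
        exact Finset.sum_congr rfl fun t _ => Finset.sum_congr rfl fun a _ => by ring
      rw [e1, hQ, Finset.mul_sum, ← Finset.sum_sub_distrib, ← Finset.sum_add_distrib]
      exact Finset.sum_congr rfl fun t _ => by ring
    rw [e] at hopt
    linarith
  have hU2 : U ^ 2 ≤ X * R := (Finset.sum_mul_sq_le_sq_mul_sq _ _ _).trans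
    (mul_le_mul_of_nonneg_left hscore hX0)
  set E := ∑ p : κ × κ, (D p.1 * D p.2) *
    ∑ t ∈ Finset.range T, (φ t p.1 * φ t p.2 - G p.1 p.2) with hE
  have hQE : Q = T * (∑ a, D a * ∑ b, G a b * D b) + E := by
    have e1 : ∀ t, (∑ a, D a * φ t a) ^ 2 = ∑ p : κ × κ, (D p.1 * D p.2) * G p.1 p.2 +
        ∑ p : κ × κ, (D p.1 * D p.2) * (φ t p.1 * φ t p.2 - G p.1 p.2) := by
      intro t
      rw [sq, Finset.sum_mul_sum, ← Fintype.sum_prod_type', ← Finset.sum_add_distrib]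
      exact Finset.sum_congr rfl fun p _ => by ring
    have e2 : ∑ a, D a * ∑ b, G a b * D b = ∑ p : κ × κ, (D p.1 * D p.2) * G p.1 p.2 := by
      simp only [Finset.mul_sum]
      rw [← Fintype.sum_prod_type']
      exact Finset.sum_congr rfl fun p _ => by ring
    rw [e2, hQ, Finset.sum_congr rfl fun t _ => e1 t, Finset.sum_add_distrib, hE]
    simp only [Finset.sum_const, Finset.card_range, nsmul_eq_mul, Finset.mul_sum]
    rw [Finset.sum_comm (s := Finset.range T)]
  -- Cauchy–Schwarz against the rank-one array `D ⊗ D`, whose squared norm is `X ^ 2`.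
  have hE2 : E ^ 2 ≤ (X * (T / 2)) ^ 2 := by
    have h1 : ∑ p : κ × κ, (D p.1 * D p.2) ^ 2 = X ^ 2 := by
      rw [sq X, hX, Finset.sum_mul_sum, ← Fintype.sum_prod_type']
      exact Finset.sum_congr rfl fun p _ => mul_pow _ _ _
    refine (Finset.sum_mul_sq_le_sq_mul_sq _ _ _).trans ?_
    rw [h1]
    refine (mul_le_mul_of_nonneg_left hgram (sq_nonneg X)).trans_eq ?_
    ring
  have hE3 : -(X * (T / 2)) ≤ E := (abs_le_of_sq_le_sq' hE2 (by positivity)).1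
  have hlow : T / 2 * X ≤ Q := by
    have := mul_le_mul_of_nonneg_left hG hT'.le
    rw [hQE]
    linarith
  rw [le_div_iff₀ (by positivity)]
  rcases hX0.eq_or_lt with h0 | h0
  · rw [← h0, zero_mul]
    have : 0 ≤ R := (Finset.sum_nonneg fun _ _ => sq_nonneg _).trans hscore
    linarith
  -- From `T X / 2 ≤ Q ≤ 2 U` and `U² ≤ X R` follows `T² X² / 4 ≤ 4 X R`; cancelling one `X` gives
  -- the constant 16.
  · have h1 : (T / 2 * X) ^ 2 ≤ (2 * U) ^ 2 :=
      pow_le_pow_left₀ (by positivity) (hlow.trans hQU) 2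
    refine le_of_mul_le_mul_left ?_ h0
    nlinarith

-- Existence of the estimators and their errors on a good sample.

section Estimators

open Matrix

variable {d : ℕ}

theorem bilin_eq_sum (M : Matrix (Fin d) (Fin d) ℝ) (u v : EuclideanSpace ℝ (Fin d)) :
    bilin M u v = ∑ a : Fin d × Fin d, M a.1 a.2 * (u a.1 * v a.2) := by
  rw [bilin, Matrix.inner_toEuclideanCLM]
  simp only [Fintype.sum_prod_type, dotProduct, Matrix.mulVec, Finset.mul_sum]
  exact Finset.sum_congr rfl fun i _ => Finset.sum_congr rfl fun j _ => by ring

theorem exists_isCovOLS (T : ℕ) (σ : ℝ) (x : ℕ → EuclideanSpace ℝ (Fin d)) (y : ℕ → ℝ) :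
    ∃ M, IsCovOLS T σ x y M := by
  let K : Submodule ℝ (Matrix (Fin d) (Fin d) ℝ) :=
    { carrier := {M | M.IsSymm}
      add_mem' := fun h h' => Matrix.IsSymm.add h h'
      zero_mem' := Matrix.isSymm_zero
      smul_mem' := fun c _ h => Matrix.IsSymm.smul h c }
  let L : ℕ → Matrix (Fin d) (Fin d) ℝ →ₗ[ℝ] ℝ := fun t =>
    { toFun := fun M => bilin M (x t) (x t)
      map_add' := fun M N => by
        simp only [bilin_eq_sum, Matrix.add_apply, add_mul, Finset.sum_add_distrib]
      map_smul' := fun c M => by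
        simp only [bilin_eq_sum, Matrix.smul_apply, smul_eq_mul, mul_assoc, Finset.mul_sum,
          RingHom.id_apply] }
  obtain ⟨M, hM, hmin⟩ := exists_least_squares K L (fun t => y t ^ 2 - σ ^ 2) T
  refine ⟨M, hM, fun M' hM' => ?_⟩
  simp only [sub_right_comm _ (bilin _ _ _) (σ ^ 2)]
  exact hmin M' hM'

theorem exists_isLagOLS (T : ℕ) (x : ℕ → EuclideanSpace ℝ (Fin d)) (y : ℕ → ℝ) :
    ∃ M, IsLagOLS T x y M := by
  let L : ℕ → Matrix (Fin d) (Fin d) ℝ →ₗ[ℝ] ℝ := fun t =>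
    { toFun := fun M => bilin M (x (t + 1)) (x t)
      map_add' := fun M N => by
        simp only [bilin_eq_sum, Matrix.add_apply, add_mul, Finset.sum_add_distrib]
      map_smul' := fun c M => by
        simp only [bilin_eq_sum, Matrix.smul_apply, smul_eq_mul, mul_assoc, Finset.mul_sum,
          RingHom.id_apply] }
  obtain ⟨M, -, hmin⟩ := exists_least_squares ⊤ L (fun t => y t * y (t + 1)) T
  exact ⟨M, fun M' => hmin M' trivial⟩

variable {Ω : Type*} {A S : Matrix (Fin d) (Fin d) ℝ} {σ : ℝ}
  {x : ℕ → Ω → EuclideanSpace ℝ (Fin d)} {y : ℕ → Ω → ℝ}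

/-- The Gram matrix of the features and the score of the least squares problem of lag `h` are
under control. -/
def IsGoodSample (A S : Matrix (Fin d) (Fin d) ℝ) (σ : ℝ) (x : ℕ → Ω → EuclideanSpace ℝ (Fin d))
    (y : ℕ → Ω → ℝ) (T : ℕ) (R : ℝ) (h : ℕ) (ω : Ω) : Prop :=
  ∑ p : (Fin d × Fin d) × (Fin d × Fin d), (∑ t ∈ Finset.range T,
      (lagFeature x h t p.1 ω * lagFeature x h t p.2 ω - featureKernel h p.1 p.2)) ^ 2 ≤
      (T : ℝ) ^ 2 / 4 ∧
    ∑ a, (∑ t ∈ Finset.range T, lagResidual A S σ x y h t ω * lagFeature x h t a ω) ^ 2 ≤ R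

/-- Instance of `sum_sq_error_le` with `D = M - A ^ h * S`, treating both lags at once. Only
optimality against the true parameter is used. -/
theorem IsGoodSample.frobNorm_sub_sq_le {T : ℕ} {R : ℝ} {h : ℕ} {ω : Ω}
    (hg : IsGoodSample A S σ x y T R h ω) (hT : 0 < T) {M : Matrix (Fin d) (Fin d) ℝ}
    (hM : h = 0 → (M - A ^ h * S).IsSymm)
    (hopt : ∑ t ∈ Finset.range T, (y t ω * y (t + h) ω -
        ∑ a : Fin d × Fin d, M a.1 a.2 * lagFeature x h t a ω - if h = 0 then σ ^ 2 else 0) ^ 2 ≤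
      ∑ t ∈ Finset.range T, lagResidual A S σ x y h t ω ^ 2) :
    frobNorm (M - A ^ h * S) ^ 2 ≤ 16 * R / (T : ℝ) ^ 2 := by
  rw [frobNorm_sq, ← Fintype.sum_prod_type' (f := fun i j => (M - A ^ h * S) i j ^ 2)]
  refine sum_sq_error_le (κ := Fin d × Fin d) (φ := fun t a => lagFeature x h t a ω)
    (η := fun t => lagResidual A S σ x y h t ω)
    (D := fun a => (M - A ^ h * S) a.1 a.2) hT ?_
    (sum_sq_le_featureKernel h _ fun h0 i j => ((hM h0).apply i j).symm) hg.1 hg.2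
  refine le_of_eq_of_le (Finset.sum_congr rfl fun t _ => ?_) hopt
  have e : ∑ a : Fin d × Fin d, (M - A ^ h * S) a.1 a.2 * lagFeature x h t a ω =
      ∑ a : Fin d × Fin d, M a.1 a.2 * lagFeature x h t a ω -
        ∑ a : Fin d × Fin d, (A ^ h * S) a.1 a.2 * lagFeature x h t a ω := by
    rw [← Finset.sum_sub_distrib]
    exact Finset.sum_congr rfl fun a _ => by rw [Matrix.sub_apply]; ring
  rw [e, lagResidual]
  ring

theorem IsGoodSample.frobNorm_covOLS_sub_sq_le {T : ℕ} {R : ℝ} {ω : Ω}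
    (hg : IsGoodSample A S σ x y T R 0 ω) (hT : 0 < T) (hS : S.IsSymm)
    {M : Matrix (Fin d) (Fin d) ℝ} (hM : IsCovOLS T σ (fun t => x t ω) (fun t => y t ω) M) :
    frobNorm (M - S) ^ 2 ≤ 16 * R / (T : ℝ) ^ 2 := by
  have h1 := hg.frobNorm_sub_sq_le hT (M := M)
    (fun _ => by simpa using Matrix.IsSymm.sub hM.1 hS) ?_
  · simpa using h1
  · have h2 := hM.2 S hS
    simpa [bilin_eq_sum, lagResidual, lagFeature, sq] using h2

theorem IsGoodSample.frobNorm_lagOLS_sub_sq_le {T : ℕ} {R : ℝ} {ω : Ω}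
    (hg : IsGoodSample A S σ x y T R 1 ω) (hT : 0 < T)
    {M : Matrix (Fin d) (Fin d) ℝ} (hM : IsLagOLS T (fun t => x t ω) (fun t => y t ω) M) :
    frobNorm (M - A * S) ^ 2 ≤ 16 * R / (T : ℝ) ^ 2 := by
  have h1 := hg.frobNorm_sub_sq_le hT (M := M) (fun h => absurd h one_ne_zero) ?_
  · simpa using h1
  · have h2 := hM (A * S)
    simpa [bilin_eq_sum, lagResidual, lagFeature] using h2

end Estimators

-- Probability of a good sample, and the main theorem.

theorem IsRegressionModel.measurableSet_isGoodSample {d : ℕ} {Ω : Type*} [mΩ : MeasurableSpace Ω]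
    {P : Measure Ω} [IsProbabilityMeasure P] {A W S : Matrix (Fin d) (Fin d) ℝ} {σ : NNReal}
    {x w β : ℕ → Ω → EuclideanSpace ℝ (Fin d)} {ε y : ℕ → Ω → ℝ}
    (H : IsRegressionModel P A W S σ x w β ε y) (hW : W.PosSemidef) (hS : S.PosSemidef)
    (T : ℕ) (R : ℝ) (h : ℕ) : MeasurableSet {ω | IsGoodSample A S σ x y T R h ω} := by
  have hφ : ∀ t a, Measurable (lagFeature x h t a) := fun t a =>
    ((H.hasMoments_feature (Set.mem_univ _) (Set.mem_univ _) a).mono (H.iSupOn_le _)).measurable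
  have hη : ∀ t, Measurable (lagResidual A S σ x y h t) := fun t =>
    ((H.hasMoments_residual hW hS le_rfl (Set.mem_univ _) (Set.mem_univ _)).mono
      (H.iSupOn_le _)).measurable
  have h1 : Measurable fun ω => ∑ p : (Fin d × Fin d) × (Fin d × Fin d), (∑ t ∈ Finset.range T,
      (lagFeature x h t p.1 ω * lagFeature x h t p.2 ω - featureKernel h p.1 p.2)) ^ 2 := by
    fun_prop
  have h2 : Measurable fun ω => ∑ a, (∑ t ∈ Finset.range T,
      lagResidual A S σ x y h t ω * lagFeature x h t a ω) ^ 2 := by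
    fun_prop
  exact (measurableSet_le h1 measurable_const).inter (measurableSet_le h2 measurable_const)

/-- Markov's inequality at level `δ / 4` for each of the two defining inequalities. With `h + 1 ≤
2`, the requirements are `4 T * G d⁴ ≤ (T² / 4) * (δ / 4)` and `4 T V ≤ R * δ / 4`, which is where
64 and 16 come from. -/
theorem IsRegressionModel.measure_compl_isGoodSample_le {d : ℕ} [NeZero d] {Ω : Type*}
    [mΩ : MeasurableSpace Ω]
    {P : Measure Ω} [IsProbabilityMeasure P] {A W S : Matrix (Fin d) (Fin d) ℝ} {σ : NNReal}
    {x w β : ℕ → Ω → EuclideanSpace ℝ (Fin d)} {ε y : ℕ → Ω → ℝ}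
    (H : IsRegressionModel P A W S σ x w β ε y) (hW : W.PosSemidef) (hS : IsStationaryCov A W S)
    {τ γ : ℝ} (hγ : 0 < γ) (hγ1 : γ < 1) (hτ1 : 1 ≤ τ) (hτ : ∀ k, opNorm (A ^ k) ≤ τ * γ ^ k)
    {T : ℕ} (hT : 0 < T) {R δ : ℝ} (hR : 0 < R) {h : ℕ} (hh : h ≤ 1)
    (hTd : 64 * gaussianEighthMoment * (d : ℝ) ^ 4 ≤ T * δ)
    (hRd : 16 * T * ((75 * gaussianEighthMoment + 252) * (d : ℝ) ^ 2 *
        ((σ : ℝ) ^ 4 + τ ^ 3 / (1 - γ ^ 2) * opNorm S ^ 2 * (d : ℝ) ^ 2)) ≤ R * δ) :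
    P {ω | ¬ IsGoodSample A S σ x y T R h ω} ≤ ENNReal.ofReal (δ / 2) := by
  have hT' : (0 : ℝ) < T := by exact_mod_cast hT
  have hh' : (h : ℝ) + 1 ≤ 2 := by
    have : (h : ℝ) ≤ 1 := by exact_mod_cast hh
    linarith
  have hφ : ∀ t a, HasMoments P mΩ (lagFeature x h t a) := fun t a =>
    (H.hasMoments_feature (Set.mem_univ _) (Set.mem_univ _) a).mono (H.iSupOn_le _)
  have hZ : ∀ t a, HasMoments P mΩ
      (fun ω => lagResidual A S σ x y h t ω * lagFeature x h t a ω) := fun t a =>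
    (H.hasMoments_score hW hS.posSemidef le_rfl (Set.mem_univ _) (Set.mem_univ _) a).mono
      (H.iSupOn_le _)
  have hG := gaussianEighthMoment_nonneg
  have h1 := measure_sum_sq_gt_le (P := P) (R := (T : ℝ) ^ 2 / 4) (p := δ / 4)
    (fun (p : (Fin d × Fin d) × (Fin d × Fin d)) ω => ∑ t ∈ Finset.range T,
      (lagFeature x h t p.1 ω * lagFeature x h t p.2 ω - featureKernel h p.1 p.2))
    (fun p => HasMoments.sum _ fun t _ => ((hφ t _).mul (hφ t _)).sub (HasMoments.const _))
    (by positivity) (by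
      refine (H.sum_integral_gram_sq_le h T).trans ?_
      have h2 : ((h : ℝ) + 1) * (gaussianEighthMoment * (d : ℝ) ^ 4) ≤
          2 * (gaussianEighthMoment * (d : ℝ) ^ 4) :=
        mul_le_mul_of_nonneg_right hh' (by positivity)
      have h3 := mul_le_mul_of_nonneg_left hTd hT'.le
      have h4 := mul_le_mul_of_nonneg_left h2 hT'.le
      nlinarith)
  have hg : 0 < 1 - γ ^ 2 := by
    have : γ ^ 2 < 1 := pow_lt_one₀ hγ.le hγ1 two_ne_zero
    linarith
  have h2 := measure_sum_sq_gt_le (P := P) (R := R) (p := δ / 4)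
    (fun (a : Fin d × Fin d) ω => ∑ t ∈ Finset.range T,
      lagResidual A S σ x y h t ω * lagFeature x h t a ω)
    (fun a => HasMoments.sum _ fun t _ => hZ t a) hR (by
      refine (H.sum_integral_sum_score_sq_le hW hS hγ hγ1 hτ1 hτ h T).trans ?_
      set V := (75 * gaussianEighthMoment + 252) * (d : ℝ) ^ 2 *
        ((σ : ℝ) ^ 4 + τ ^ 3 / (1 - γ ^ 2) * opNorm S ^ 2 * (d : ℝ) ^ 2)
      have hV : 0 ≤ V := by positivity
      have h4 := mul_le_mul_of_nonneg_left (mul_le_mul_of_nonneg_right hh' hV) hT'.le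
      nlinarith)
  refine (measure_mono ?_).trans ((measure_union_le _ _).trans ((add_le_add h1 h2).trans_eq ?_))
  · intro ω hω
    rcases not_and_or.1 hω with h3 | h3
    · exact Or.inl (not_le.1 h3)
    · exact Or.inr (not_le.1 h3)
  rcases le_or_gt 0 δ with hδ | hδ
  · rw [← ENNReal.ofReal_add (by positivity) (by positivity)]
    congr 1
    ring
  · rw [ENNReal.ofReal_of_nonpos (by linarith), ENNReal.ofReal_of_nonpos (by linarith), add_zero]

theorem corollary1 :
    ∃ c : ℝ, 0 < c ∧
      ∀ (d : ℕ) (_ : 1 ≤ d) (Ω : Type u) [MeasurableSpace Ω] (P : Measure Ω)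
        [IsProbabilityMeasure P]
        (A W S : Matrix (Fin d) (Fin d) ℝ) (σ : NNReal)
        (x w β : ℕ → Ω → EuclideanSpace ℝ (Fin d)) (ε y : ℕ → Ω → ℝ)
        (γ δ : ℝ) (T : ℕ),
        W.PosSemidef →
        specRad A < 1 →
        specRad A < ENNReal.ofReal γ → γ < 1 →
        IsStationaryCov A W S →
        0 < lamMin S →
        IsRegressionModel P A W S σ x w β ε y →
        0 < δ → δ < 1 →
        c * (d : ℝ) ^ 4 * Real.log (c * ((d : ℝ) ^ 2 / δ)) ≤ (T : ℝ) →
        c * (d : ℝ) ^ 2 / (lamMin S ^ 2 * δ) * varTerm A S σ γ δ T ≤ (T : ℝ) →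
        ∃ E : Set Ω, MeasurableSet E ∧ ENNReal.ofReal (1 - δ) ≤ P E ∧
          ∀ ω ∈ E,
            (∃ Shat, IsCovOLS T σ (fun t => x t ω) (fun t => y t ω) Shat) ∧
            (∃ Mhat, IsLagOLS T (fun t => x t ω) (fun t => y t ω) Mhat) ∧
            ∀ Shat Mhat : Matrix (Fin d) (Fin d) ℝ,
              IsCovOLS T σ (fun t => x t ω) (fun t => y t ω) Shat →
              IsLagOLS T (fun t => x t ω) (fun t => y t ω) Mhat →
              IsUnit Shat.det ∧
              frobNorm (Mhat * Shat⁻¹ - A) ≤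
                c * ((1 + opNorm A) / lamMin S) *
                  √(c * (d : ℝ) ^ 2 / (T * δ) * varTerm A S σ γ δ T) := by
  have hG := gaussianEighthMoment_nonneg
  set G := gaussianEighthMoment with hGdef
  set C : ℝ := 75 * G + 252 with hC
  have hC0 : 0 < C := by positivity
  -- Chosen so that the sample size condition becomes `256 * C * Y ≤ (lamMin S / 2) ^ 2`, with the
  -- squared radius `256 * C * Y` found below.
  refine ⟨1024 * C, by positivity, ?_⟩
  intro d hd Ω _ P _ A W S σ x w β ε y γ δ T hW _ hγρ hγ1 hS hlam H hδ hδ1 _ hT2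
  have : NeZero d := ⟨by omega⟩
  have hd1 : (1 : ℝ) ≤ d := by exact_mod_cast hd
  have hγ : 0 < γ := by
    by_contra! h0
    rw [ENNReal.ofReal_of_nonpos h0] at hγρ
    exact not_lt_bot hγρ
  have hγ2 : γ ^ 2 < 1 := pow_lt_one₀ hγ.le hγ1 two_ne_zero
  have hg : 0 < 1 - γ ^ 2 := by linarith
  have hτ1 := one_le_tauConst hγρ
  have hτ := opNorm_pow_le_tauConst hγ hγρ
  set τ := tauConst A γ with hτdef
  have hlamS := lamMin_le_opNorm hS.posSemidef.1
  set V := varTerm A S σ γ δ T with hVdef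
  set V₀ := (σ : ℝ) ^ 4 + τ ^ 3 / (1 - γ ^ 2) * opNorm S ^ 2 * (d : ℝ) ^ 2 with hV₀
  have hV₀V : V₀ ≤ V := by
    rw [hVdef, varTerm, hV₀, ← hτdef]
    have : 0 ≤ Real.log (2 * T / δ) ^ 2 := sq_nonneg _
    gcongr
    linarith
  -- As `lamMin S ≤ ‖S‖` and `τ³ / (1 - γ²) ≥ 1`, the variance term is at least `lamMin S² d²`. The
  -- variance-based sample size condition therefore forces `T δ` to be at least of order `d⁴`, as
  -- concentration of the Gram matrix requires.
  have hlamV : lamMin S ^ 2 * (d : ℝ) ^ 2 ≤ V₀ := by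
    have h1 : 1 ≤ τ ^ 3 / (1 - γ ^ 2) := by
      rw [le_div_iff₀ hg]
      nlinarith [one_le_pow₀ hτ1 (n := 3), sq_nonneg γ]
    have h2 : lamMin S ^ 2 ≤ opNorm S ^ 2 := pow_le_pow_left₀ hlam.le hlamS 2
    have h3 : opNorm S ^ 2 ≤ τ ^ 3 / (1 - γ ^ 2) * opNorm S ^ 2 :=
      le_mul_of_one_le_left (sq_nonneg _) h1
    have h4 := mul_le_mul_of_nonneg_right (h2.trans h3) (sq_nonneg (d : ℝ))
    have : 0 ≤ (σ : ℝ) ^ 4 := by positivity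
    linarith
  have hV0 : 0 < V := lt_of_lt_of_le (by positivity) (hlamV.trans hV₀V)
  have hT3 : 1024 * C * (d : ℝ) ^ 2 * V ≤ T * (lamMin S ^ 2 * δ) := by
    rwa [div_mul_eq_mul_div, div_le_iff₀ (by positivity)] at hT2
  have hTpos : (0 : ℝ) < T := by
    have h1 : 0 < 1024 * C * (d : ℝ) ^ 2 * V := by positivity
    exact pos_of_mul_pos_left (h1.trans_le hT3) (by positivity)
  have hTnat : 0 < T := by exact_mod_cast hTpos
  have hTd : 64 * G * (d : ℝ) ^ 4 ≤ T * δ := by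
    have h1 : 1024 * C * (d : ℝ) ^ 2 * (lamMin S ^ 2 * (d : ℝ) ^ 2) ≤ T * (lamMin S ^ 2 * δ) :=
      (mul_le_mul_of_nonneg_left (hlamV.trans hV₀V) (by positivity)).trans hT3
    have h2 : 1024 * C * (d : ℝ) ^ 4 ≤ T * δ := by
      refine le_of_mul_le_mul_left ?_ (show 0 < lamMin S ^ 2 by positivity)
      linarith
    refine le_trans ?_ h2
    have : 64 * G ≤ 1024 * C := by linarith
    gcongr
  -- The smallest score threshold for which Markov's inequality leaves probability `δ / 4`, with
  -- `V₀` enlarged to `V`.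
  set R : ℝ := 16 * T * (C * (d : ℝ) ^ 2 * V) / δ with hRdef
  have hR : 0 < R := by positivity
  have hRd : 16 * T * (C * (d : ℝ) ^ 2 * V₀) ≤ R * δ := by
    rw [hRdef, div_mul_cancel₀ _ hδ.ne']
    gcongr
  have hgood : ∀ h ≤ 1, P {ω | ¬ IsGoodSample A S σ x y T R h ω} ≤ ENNReal.ofReal (δ / 2) :=
    fun h hh => H.measure_compl_isGoodSample_le hW hS hγ hγ1 hτ1 hτ hTnat hR hh hTd hRd
  have hmeas := H.measurableSet_isGoodSample hW hS.posSemidef T R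
  refine ⟨{ω | IsGoodSample A S σ x y T R 0 ω} ∩ {ω | IsGoodSample A S σ x y T R 1 ω},
    (hmeas 0).inter (hmeas 1), ?_, ?_⟩
  · have hcompl : P ({ω | IsGoodSample A S σ x y T R 0 ω} ∩
        {ω | IsGoodSample A S σ x y T R 1 ω})ᶜ ≤ ENNReal.ofReal δ := by
      rw [Set.compl_inter]
      refine (measure_union_le _ _).trans
        ((add_le_add (hgood 0 zero_le_one) (hgood 1 le_rfl)).trans_eq ?_)
      rw [← ENNReal.ofReal_add (by positivity) (by positivity), add_halves]
    rw [ENNReal.ofReal_sub _ hδ.le, ENNReal.ofReal_one, tsub_le_iff_right]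
    rw [← prob_add_prob_compl (μ := P) ((hmeas 0).inter (hmeas 1))]
    gcongr
  · rintro ω ⟨h0, h1⟩
    refine ⟨exists_isCovOLS _ _ _ _, exists_isLagOLS _ _ _, fun Shat Mhat hSh hMh => ?_⟩
    have hSsymm : S.IsSymm :=
      Matrix.IsSymm.ext fun i j => by simpa using hS.posSemidef.1.apply i j
    set Y := (d : ℝ) ^ 2 / (T * δ) * V with hY
    have hY0 : 0 ≤ Y := by positivity
    have hRY : 16 * R / (T : ℝ) ^ 2 = 256 * (C * Y) := by
      rw [hRdef, hY]
      field_simp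
      ring
    set r := √(256 * (C * Y)) with hr
    have hS1 : frobNorm (Shat - S) ≤ r :=
      Real.le_sqrt_of_sq_le (hRY ▸ h0.frobNorm_covOLS_sub_sq_le hTnat hSsymm hSh)
    have hM1 : frobNorm (Mhat - A * S) ≤ r :=
      Real.le_sqrt_of_sq_le (hRY ▸ h1.frobNorm_lagOLS_sub_sq_le hTnat hMh)
    -- Exactly the variance-based sample size condition, by the choice of the constant.
    have hrlam : r ≤ lamMin S / 2 := by
      refine Real.sqrt_le_iff.2 ⟨by positivity, ?_⟩
      rw [hY, div_mul_eq_mul_div, mul_div_assoc', mul_div_assoc', div_le_iff₀ (by positivity)]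
      linarith
    refine ⟨isUnit_det_of_frobNorm_sub_le hS.posSemidef.1 hlam (hS1.trans hrlam), ?_⟩
    refine (frobNorm_mul_inv_sub_le hS.posSemidef.1 hSh.1 hlam hS1 hrlam hM1).trans ?_
    have hA := opNorm_nonneg A
    have hrle : r ≤ √(1024 * C * (d : ℝ) ^ 2 / (T * δ) * V) := by
      refine Real.sqrt_le_sqrt ?_
      have e : 1024 * C * (d : ℝ) ^ 2 / (T * δ) * V = 1024 * (C * Y) := by
        rw [hY]
        ring
      rw [e]
      have : 0 ≤ C * Y := by positivity
      linarith
    -- Absorbs the factor 2 of the plug-in bound into the universal constant.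
    have h2C : (2 : ℝ) ≤ 1024 * C := by linarith
    gcongr
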